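/- **Setting.** Let $h=h_{\bar 0}\oplus h_{\bar 1}$ be a $\mathbb Z_2$-graded complex Hilbert space with Klein operator $\gamma=P_{\bar 0}-P_{\bar 1}$, where $P_\alpha$ is the orthogonal projection onto $h_\alpha$. Let $J$ be a conjugation on $h$ (antilinear, norm-preserving, $J^2=1$) and $P$ an orthogonal projection on $h$, both commuting with $\gamma$ (i.e. even), with $JP=(1-P)J$. Put $\tilde h=Ph$ and $q=P-\gamma(1-P)$. For a bounded operator $X$ on $h$ let $\epsilon(X)$ be $X$ with the sign of its block $h_{\bar 1}\to h_{\bar 1}$ reversed. $X$ is self-dual if $X=qJ\epsilon(X)^*qJ$, and $g_2$ is the set of bounded self-dual $X$ for which $PX(1-P)$ and $(1-P)XP$ are Hilbert–Schmidt. On the Fock space $\mathcal F=\mathcal F_B(P_{\bar 0}\tilde h)\otimes\mathcal F_F(P_{\bar 1}\tilde h)$ with vacuum $\Omega$, let $a^\dagger(f)$, $f\in\tilde h$, be the creation operators (bosonic for $f$ even, fermionic for $f$ odd), $a(f)=a^\dagger(f)^*$, and let $\mathcal D(\tilde h)$ be the linear span of the vectors $a^\dagger(f_1)\cdots a^\dagger(f_N)\Omega$,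 $N\ge 0$, $f_j\in\tilde h$. On $\mathcal D(\tilde h)$ define, for $f\in h$ and $X\in g_2$, $$B^\dagger(f)=a^\dagger(Pf)-a(\gamma J(1-P)f),$$ $$d\hat\Gamma(X)=\sum_i a^\dagger(PXe_i)\,a(e_i)+\tfrac12\sum_i a^\dagger(PXJe_i)\,a^\dagger(e_i)-\tfrac12\sum_i a(\gamma PJXe_i)\,a(e_i),$$ where $(e_i)$ is an orthonormal basis of $\tilde h$ consisting of homogeneous vectors. Let $$c(X,Y)=\mathrm{Tr}\,\gamma\big((1-P)XPY-(-1)^{\deg X\deg Y}(1-P)YPX\big),$$ extended bilinearly to non-homogeneous $X,Y\in g_2$, with the trace taken in the orthonormal basis $\{e_i\}\cup\{Je_i\}$ of $h$, and $$b(X,Y)=i\int_0^1 c\big(X,e^{isX}Ye^{-isX}\big)\,ds .$$ Operators on $\mathcal D(\tilde h)$, when applied to a vector outside $\mathcal D(\tilde h)$, and when exponentiated, are replaced by their closures. **Proposition 2.** Let $X\in g_2$ be even with $X^*=qXq$. Then the closure of $d\hat\Gamma(X)$ generates a strongly continuous unitary group $e^{itd\hat\Gamma(X)}$, $t\in\mathbb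 R$. For all $t\in\mathbb R$, $f\in h$ and $Y\in g_2$ one has $e^{itX}Ye^{-itX}\in g_2$, and on $\mathcal D(\tilde h)$ (both sides being defined there) $$e^{itd\hat\Gamma(X)}B^\dagger(f)e^{-itd\hat\Gamma(X)}=B^\dagger(e^{itX}f),$$ $$e^{itd\hat\Gamma(X)}d\hat\Gamma(Y)e^{-itd\hat\Gamma(X)}=d\hat\Gamma(e^{itX}Ye^{-itX})-\tfrac12 b(tX,Y).$$ If moreover $Y$ is even with $Y^*=qYq$, then the closures of $d\hat\Gamma(Y)$ and of $d\hat\Gamma(e^{isX}Ye^{-isX})$, $s\in\mathbb R$, also generate unitary groups, and for all $s,t\in\mathbb R$ $$e^{isd\hat\Gamma(X)}e^{itd\hat\Gamma(Y)}e^{-isd\hat\Gamma(X)}=e^{-\frac i2\,t\,b(sX,Y)}\,e^{itd\hat\Gamma(e^{isX}Ye^{-isX})}.$$ -/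

import Mathlib

open scoped InnerProductSpace ComplexConjugate

noncomputable section

/-! ### Unbounded operators -/

section Operators

variable {E : Type*} [NormedAddCommGroup E] [InnerProductSpace ℂ E]

/-- The product `A B` of two unbounded operators, on its natural domain
`{x ∈ dom B | B x ∈ dom A}`. -/
def opMul (A B : E →ₗ.[ℂ] E) : E →ₗ.[ℂ] E where
  domain :=
    { carrier := {x | ∃ h : x ∈ B.domain, B ⟨x, h⟩ ∈ A.domain}
      zero_mem' := ⟨B.domain.zero_mem, by
        have h : B ⟨0, B.domain.zero_mem⟩ = 0 := B.map_zero
        rw [h]; exact A.domain.zero_mem⟩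
      add_mem' := by
        rintro x y ⟨hx, hx'⟩ ⟨hy, hy'⟩
        refine ⟨B.domain.add_mem hx hy, ?_⟩
        have h : B ⟨x + y, B.domain.add_mem hx hy⟩ = B ⟨x, hx⟩ + B ⟨y, hy⟩ :=
          B.map_add ⟨x, hx⟩ ⟨y, hy⟩
        rw [h]; exact A.domain.add_mem hx' hy'
      smul_mem' := by
        rintro c x ⟨hx, hx'⟩
        refine ⟨B.domain.smul_mem c hx, ?_⟩
        have h : B ⟨c • x, B.domain.smul_mem c hx⟩ = c • B ⟨x, hx⟩ :=
          B.map_smul c ⟨x, hx⟩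
        rw [h]; exact A.domain.smul_mem c hx' }
  toFun :=
    { toFun := fun x => A ⟨B ⟨x.1, x.2.choose⟩, x.2.choose_spec⟩
      map_add' := by
        intro x y
        rw [← A.map_add]
        congr 1
        apply Subtype.ext
        exact B.map_add ⟨x.1, x.2.choose⟩ ⟨y.1, y.2.choose⟩
      map_smul' := by
        intro c x
        rw [RingHom.id_apply, ← A.map_smul]
        congr 1
        apply Subtype.ext
        exact B.map_smul c ⟨x.1, x.2.choose⟩ }

/-- The sum `∑ i, A i` of a family of unbounded operators, on its natural domain: the vectors that
lie in the domain of each `A i` and for which `∑ i, A i x` converges (unconditionally) in norm. -/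
def opSum {ι : Type*} (A : ι → E →ₗ.[ℂ] E) : E →ₗ.[ℂ] E where
  domain :=
    { carrier := {x | ∃ h : ∀ i, x ∈ (A i).domain, Summable fun i => A i ⟨x, h i⟩}
      zero_mem' := by
        refine ⟨fun i => (A i).domain.zero_mem, ?_⟩
        have h : (fun i => A i ⟨0, (A i).domain.zero_mem⟩) = fun _ => (0 : E) :=
          funext fun i => (A i).map_zero
        rw [h]; exact summable_zero
      add_mem' := by
        rintro x y ⟨hx, hx'⟩ ⟨hy, hy'⟩
        refine ⟨fun i => (A i).domain.add_mem (hx i) (hy i), ?_⟩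
        have h : (fun i => A i ⟨x + y, (A i).domain.add_mem (hx i) (hy i)⟩) =
            fun i => A i ⟨x, hx i⟩ + A i ⟨y, hy i⟩ :=
          funext fun i => (A i).map_add ⟨x, hx i⟩ ⟨y, hy i⟩
        rw [h]; exact hx'.add hy'
      smul_mem' := by
        rintro c x ⟨hx, hx'⟩
        refine ⟨fun i => (A i).domain.smul_mem c (hx i), ?_⟩
        have h : (fun i => A i ⟨c • x, (A i).domain.smul_mem c (hx i)⟩) =
            fun i => c • A i ⟨x, hx i⟩ :=
          funext fun i => (A i).map_smul c ⟨x, hx i⟩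
        rw [h]; exact hx'.const_smul c }
  toFun :=
    { toFun := fun x => ∑' i, A i ⟨x.1, x.2.choose i⟩
      map_add' := by
        intro x y
        rw [← x.2.choose_spec.tsum_add y.2.choose_spec]
        exact tsum_congr fun i => (A i).map_add ⟨x.1, x.2.choose i⟩ ⟨y.1, y.2.choose i⟩
      map_smul' := by
        intro c x
        rw [RingHom.id_apply, ← x.2.choose_spec.tsum_const_smul c]
        exact tsum_congr fun i => (A i).map_smul c ⟨x.1, x.2.choose i⟩ }

/-- `U` is the strongly continuous one-parameter group of unitaries `t ↦ e^{itA}`: its generator,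
domain included, is `A`. (By Stone's theorem this forces `A` to be self-adjoint, and it
determines `U`.) -/
structure IsUnitaryGroupOf [CompleteSpace E] (A : E →ₗ.[ℂ] E) (U : ℝ → E →L[ℂ] E) : Prop where
  unitary : ∀ t, U t ∈ unitary (E →L[ℂ] E)
  zero : U 0 = 1
  add : ∀ s t, U (s + t) = U s * U t
  continuous : ∀ ψ, Continuous fun t => U t ψ
  generator : ∀ ψ φ : E, (∃ h : ψ ∈ A.domain, A ⟨ψ, h⟩ = φ) ↔
    HasDerivAt (fun t => U t ψ) (Complex.I • φ) 0

open Classical in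
/-- `expI A t = e^{itA}`, the unitary group generated by `A` (and `0` if there is none). -/
def expI [CompleteSpace E] (A : E →ₗ.[ℂ] E) : ℝ → E →L[ℂ] E :=
  if h : ∃ U, IsUnitaryGroupOf A U then h.choose else 0

/-- Hilbert-Schmidt operators: `∑ ‖T bᵢ‖² < ∞` for some (equivalently, every) orthonormal basis. -/
def IsHilbertSchmidt [CompleteSpace E] (T : E →L[ℂ] E) : Prop :=
  ∃ (s : Set E) (b : HilbertBasis s ℂ E), Summable fun i => ‖T (b i)‖ ^ 2

/-- `e^{itX} Y e^{-itX}` for bounded operators `X`, `Y`. -/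
def evolve (X Y : E →L[ℂ] E) (t : ℝ) : E →L[ℂ] E :=
  NormedSpace.exp ((Complex.I * t) • X) * Y * NormedSpace.exp (-(Complex.I * t) • X)

end Operators

/-! ### The one-particle space -/

/-- The one-particle data on a complex Hilbert space `H`: the Klein operator `γ` of a
`ℤ₂`-grading `H = H₀ ⊕ H₁` (so that `H₀`, `H₁` are its eigenspaces for `1`, `-1`), an even
orthogonal projection `P` and an even conjugation `J` with `J P = (1 - P) J`. -/
structure NeutralSpace (H : Type*) [NormedAddCommGroup H] [InnerProductSpace ℂ H]
    [CompleteSpace H] where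
  γ : H →L[ℂ] H
  γ_selfAdjoint : IsSelfAdjoint γ
  γ_sq : γ * γ = 1
  P : H →L[ℂ] H
  P_selfAdjoint : IsSelfAdjoint P
  P_idem : P * P = P
  P_even : P * γ = γ * P
  J : H ≃ₗᵢ⋆[ℂ] H
  J_invol : ∀ f, J (J f) = f
  J_even : ∀ f, J (γ f) = γ (J f)
  J_P : ∀ f, J (P f) = J f - P (J f)

namespace NeutralSpace

variable {H : Type*} [NormedAddCommGroup H] [InnerProductSpace ℂ H] [CompleteSpace H]
variable (S : NeutralSpace H)

/-- `q = P - γ (1 - P)`. -/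
def q : H →L[ℂ] H := S.P - S.γ * (1 - S.P)

/-- `X` is even: it preserves the grading. -/
def IsEven (X : H →L[ℂ] H) : Prop := X * S.γ = S.γ * X

/-- The even part of an operator. -/
def evenPart (X : H →L[ℂ] H) : H →L[ℂ] H := (1 / 2 : ℂ) • (X + S.γ * X * S.γ)

/-- The odd part of an operator. -/
def oddPart (X : H →L[ℂ] H) : H →L[ℂ] H := (1 / 2 : ℂ) • (X - S.γ * X * S.γ)

/-- The orthogonal projection onto the fermion space `H₁`. -/
def oddProj : H →L[ℂ] H := (1 / 2 : ℂ) • (1 - S.γ)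

/-- `ε(X)`: linear in `X`, with `ε(f (g, ·)) = (-1)^{deg f deg g} f (g, ·)` for homogeneous `f`,
`g`. So it changes the sign of the block `H₁ → H₁` and leaves the other three blocks alone. -/
def eps (X : H →L[ℂ] H) : H →L[ℂ] H := X - (2 : ℂ) • (S.oddProj * X * S.oddProj)

/-- The self-duality condition `X = q J ε(X)* q J`. -/
def SelfDual (X : H →L[ℂ] H) : Prop :=
  ∀ f, X f = S.q (S.J (ContinuousLinearMap.adjoint (S.eps X) (S.q (S.J f))))

/-- `g₂`: the bounded self-dual operators `X` such that `P X (1 - P)` and `(1 - P) X P` are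
Hilbert-Schmidt. -/
structure IsG2 (X : H →L[ℂ] H) : Prop where
  selfDual : S.SelfDual X
  hs₁ : IsHilbertSchmidt (S.P * X * (1 - S.P))
  hs₂ : IsHilbertSchmidt ((1 - S.P) * X * S.P)

/-- The boson part of the half space `P H`. -/
def bosonHalf : Submodule ℂ H where
  carrier := {f | S.P f = f ∧ S.γ f = f}
  zero_mem' := by simp
  add_mem' := by
    rintro f g ⟨h₁, h₂⟩ ⟨h₃, h₄⟩
    simp [h₁, h₂, h₃, h₄]
  smul_mem' := by
    rintro c f ⟨h₁, h₂⟩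
    simp [h₁, h₂]

/-- The fermion part of the half space `P H`. -/
def fermionHalf : Submodule ℂ H where
  carrier := {f | S.P f = f ∧ S.γ f = -f}
  zero_mem' := by simp
  add_mem' := by
    rintro f g ⟨h₁, h₂⟩ ⟨h₃, h₄⟩
    simp [h₁, h₂, h₃, h₄, add_comm]
  smul_mem' := by
    rintro c f ⟨h₁, h₂⟩
    simp [h₁, h₂]

end NeutralSpace

/-- Orthonormal bases of the boson part and of the fermion part of the half space `P H`. -/
structure ModeBasis {H : Type*} [NormedAddCommGroup H] [InnerProductSpace ℂ H] [CompleteSpace H]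
    (S : NeutralSpace H) (I K : Type*) where
  boson : HilbertBasis I ℂ S.bosonHalf
  fermion : HilbertBasis K ℂ S.fermionHalf

/-! ### The Fock space -/

/-- Occupation numbers: finitely many bosons in the modes `I`, and a finite set of occupied
fermion modes in `K`. -/
abbrev Config (I K : Type*) : Type _ := (I →₀ ℕ) × Finset K

/-- The Fock space `F_B(P H₀) ⊗ F_F(P H₁)` in occupation number representation, where
`F_B = ℓ²(I →₀ ℕ)`, `F_F = ℓ²(Finset K)` and so `F_B ⊗ F_F = ℓ²((I →₀ ℕ) × Finset K)`. -/
abbrev Fock (I K : Type*) : Type _ := lp (fun _ : Config I K => ℂ) 2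

namespace ModeBasis

variable {H : Type*} [NormedAddCommGroup H] [InnerProductSpace ℂ H] [CompleteSpace H]
variable {S : NeutralSpace H} {I K : Type*}

/-- The homogeneous orthonormal basis of `P H` obtained by joining the two bases. -/
def vec (e : ModeBasis S I K) : I ⊕ K → H :=
  Sum.elim (fun i => (e.boson i : H)) (fun k => (e.fermion k : H))

/-- The trace on `H`, computed in the homogeneous orthonormal basis `{eᵢ} ∪ {J eᵢ}`, which is
adapted to the decomposition of `H` into `P H` and `(1 - P) H`. -/
def trace (e : ModeBasis S I K) (T : H →L[ℂ] H) : ℂ :=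
  ∑' i, (⟪e.vec i, T (e.vec i)⟫_ℂ + ⟪S.J (e.vec i), T (S.J (e.vec i))⟫_ℂ)

/-- The Schwinger term `c(X, Y) = Str((1 - P) X P Y - (-1)^{deg X deg Y} (1 - P) Y P X)`, where
`Str(T) = Tr(γ T)`. It is extended bilinearly to operators that are not homogeneous: for odd `X`,
the factor `(-1)^{deg X deg Y}` turns `Y` into `γ Y γ`. -/
def schwinger (e : ModeBasis S I K) (X Y : H →L[ℂ] H) : ℂ :=
  e.trace (S.γ * ((1 - S.P) * X * S.P * Y -
    ((1 - S.P) * Y * S.P * S.evenPart X + (1 - S.P) * (S.γ * Y * S.γ) * S.P * S.oddPart X)))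

/-- `b(X, Y) = i ∫₀¹ c(X, e^{isX} Y e^{-isX}) ds`. -/
def bTerm (e : ModeBasis S I K) (X Y : H →L[ℂ] H) : ℂ :=
  Complex.I * ∫ s in (0 : ℝ)..1, e.schwinger X (evolve X Y s)

/-! ### Creation and annihilation operators -/

open Classical in
/-- The vacuum vector. -/
def vacuum (I K : Type*) : Fock I K := lp.single 2 ((0, ∅) : Config I K) (1 : ℂ)

variable [LinearOrder K]

/-- The coordinates of `a†(f) ψ`. For a basis vector, `a†(eᵢ)` maps the state `(n, s)` to
`√(nᵢ + 1) (n + δᵢ, s)` in the boson case; in the fermion case `a†(eₖ)` maps `(n, s)` to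
`± (n, s ∪ {k})` if `k ∉ s`, where the sign is the parity of the number of elements of `s` that
are less than `k`, and to `0` if `k ∈ s`. -/
def createFun (e : ModeBasis S I K) (f : H) (ψ : Config I K → ℂ) : Config I K → ℂ := fun c =>
  (∑ i ∈ c.1.support,
      ⟪(e.boson i : H), f⟫_ℂ * (Real.sqrt (c.1 i) : ℂ) * ψ (c.1 - Finsupp.single i 1, c.2)) +
    ∑ k ∈ c.2, ⟪(e.fermion k : H), f⟫_ℂ * (-1) ^ (c.2.filter (· < k)).card * ψ (c.1, c.2.erase k)

theorem createFun_add (e : ModeBasis S I K) (f : H) (ψ φ : Config I K → ℂ) :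
    e.createFun f (ψ + φ) = e.createFun f ψ + e.createFun f φ := by
  funext c
  simp only [createFun, Pi.add_apply, mul_add, Finset.sum_add_distrib]
  ring

theorem createFun_smul (e : ModeBasis S I K) (f : H) (a : ℂ) (ψ : Config I K → ℂ) :
    e.createFun f (a • ψ) = a • e.createFun f ψ := by
  funext c
  simp only [createFun, Pi.smul_apply, smul_eq_mul, mul_add, Finset.mul_sum]
  congr 1 <;> exact Finset.sum_congr rfl fun _ _ => by ring

/-- The creation operator `a†(f)` for `f ∈ P H`, as a closed operator on the Fock space (its domain
consists of all `ψ` for which `a†(f) ψ` is square summable). It depends on `P f` only. -/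
def create (e : ModeBasis S I K) (f : H) : Fock I K →ₗ.[ℂ] Fock I K where
  domain :=
    { carrier := {ψ | Memℓp (e.createFun f ψ) 2}
      zero_mem' := by
        have h : e.createFun f ((0 : Fock I K) : Config I K → ℂ) = 0 := by
          funext c
          simp [createFun]
        simp only [Set.mem_ofPred_eq, h]
        exact zero_memℓp
      add_mem' := by
        intro ψ φ hψ hφ
        simp only [Set.mem_ofPred_eq, lp.coeFn_add, createFun_add] at *
        exact hψ.add hφ
      smul_mem' := by
        intro a ψ hψ
        simp only [Set.mem_ofPred_eq, lp.coeFn_smul, createFun_smul] at *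
        exact hψ.const_smul a }
  toFun :=
    { toFun := fun ψ => ⟨e.createFun f ψ.1, ψ.2⟩
      map_add' := fun ψ φ => Subtype.ext (e.createFun_add f ψ.1 φ.1)
      map_smul' := fun a ψ => Subtype.ext (e.createFun_smul f a ψ.1) }

/-- The annihilation operator `a(f) = a†(f)*`. -/
def annihilate (e : ModeBasis S I K) (f : H) : Fock I K →ₗ.[ℂ] Fock I K :=
  LinearPMap.adjoint (e.create f)

/-- The vectors `a†(f₁) ⋯ a†(f_N) Ω` with `N ≥ 0` and `f₁, …, f_N ∈ P H`. -/
inductive IsMonomial (e : ModeBasis S I K) : Fock I K → Prop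
  | vacuum : IsMonomial e (vacuum I K)
  | create (f : H) (hf : S.P f = f) (ψ : Fock I K) (hψ : ψ ∈ (e.create f).domain)
      (h : IsMonomial e ψ) : IsMonomial e (e.create f ⟨ψ, hψ⟩)

/-- The dense subspace `D(P H)`: the linear span of the vectors `a†(f₁) ⋯ a†(f_N) Ω`. -/
def finiteDomain (e : ModeBasis S I K) : Submodule ℂ (Fock I K) :=
  Submodule.span ℂ {ψ | e.IsMonomial ψ}

/-- The operator `B†(f) = a†(P f) - a(γ J (1 - P) f)` on `D(P H)`. -/
def field (e : ModeBasis S I K) (f : H) : Fock I K →ₗ.[ℂ] Fock I K :=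
  (e.create (S.P f) - e.annihilate (S.γ (S.J (f - S.P f)))).domRestrict e.finiteDomain

/-- The operator
`dΓ(X) = (P X P) a†a + ½ (P X J J' P) a†a† - ½ (γ P J' J X P) aa` on `D(P H)`.
For an operator `T` on `P H`, an orthonormal basis `(eᵢ)` of `P H` and a conjugation `J'` of `P H`,
`T a†a = ∑ a†(T eᵢ) a(eᵢ)`, `T a†a† = ∑ a†(T eᵢ) a†(J' eᵢ)` and `T aa = ∑ a(J' T eᵢ) a(eᵢ)`.
Here `(eᵢ)` is the given homogeneous basis and `J'` the (even) conjugation which fixes it, so that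
`P X J J' P eᵢ = P X J eᵢ` and `J' γ P J' J X P eᵢ = γ P J X eᵢ`. Vectors at which one of the three
series diverges are not in the domain. -/
def dGamma (e : ModeBasis S I K) (X : H →L[ℂ] H) : Fock I K →ₗ.[ℂ] Fock I K :=
  (opSum (fun i => opMul (e.create (S.P (X (e.vec i)))) (e.annihilate (e.vec i))) +
    (1 / 2 : ℂ) • opSum (fun i => opMul (e.create (S.P (X (S.J (e.vec i))))) (e.create (e.vec i))) -
    (1 / 2 : ℂ) • opSum (fun i =>
      opMul (e.annihilate (S.γ (S.P (S.J (X (e.vec i)))))) (e.annihilate (e.vec i)))).domRestrict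
    e.finiteDomain

end ModeBasis

end

/-! The proof separates algebra on the vectors with a bounded number of particles, where every
operator is defined, from one analytic principle that exponentiates it.

Algebra. Write `dG Y` for dΓ(Y) and `fld f` for B†(f) on those vectors. For `f` of parity `p` one
has dΓ(Y) B†(f) = B†(f) dΓ(γ^p Y γ^p) + B†(Y f) (`dG_fld`). The formal adjoint of dΓ(Y) is dΓ(q Y*
q) (`inner_dG`), so dΓ(X) is symmetric when X* = q X q. For even X the Jacobi identity shows that
[dΓ(X), dΓ(Y)] - dΓ([X, Y]) can be moved past every B†(f) at the price of conjugating Y with γ^p.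
Hence it maps the vacuum to a vector killed by all annihilation operators, that is, to a multiple of
the vacuum; and since the basis states are created from the vacuum, it is the same scalar on all of
them. A vacuum expectation value identifies the scalar as -c(X, Y)/2 (`schwinger_eq`, `defect_eq`).

Analysis. dΓ(X) changes the particle number N by at most two and has norm O(n + 2) on the n-particle
sector (`Banded`). Its compressions to N ≤ m are bounded and self-adjoint and generate unitary
groups. Their commutators with (N + 2)³ are bounded relative to (N + 2)³ uniformly in m, so by
Gronwall the groups preserve cubic decay in N. A truncation error involving dΓ(X) once is then
O(m⁻²), and the groups converge strongly (`uniformCauchySeqOn_flow`); an error involving a product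
of two such operators is O(m⁻¹) and still vanishes. Consequently, if A is the symmetric operator, T
a linear family of operators and y a curve with T(y') = i[A, T(y)], then the limit group carries
T(y(t)) into the closure of T(y(0)) (`IsFlowLimit.mem_clGraph`).

This principle is used three times. With the constant solution T(y) = A it shows that the generator
is exactly the closure of A (`IsFlowLimit.mem_clGraph_iff`). With B†(e^{isX} f) it gives the
covariance of the fields. With dΓ(Y_s) - b(sX, Y)/2, where Y_s = e^{isX} Y e^{-isX} and d/ds b(sX,
Y) = i c(X, Y_s), it gives the transformation law of dΓ(Y). The projective relation follows because
two unitary groups with the same generator coincide.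

The curve Y_s has to be differentiable in a norm that controls dΓ. This is the norm ‖Y‖ + ‖[P, Y]‖₂
of the Banach algebra `HSAlg`: its second part bounds the pair creation and pair annihilation terms.
-/

noncomputable section

/-! ### Graded `ℓ²` spaces -/

/-- The Hilbert space `ℓ²(C)`. -/
abbrev EllTwo (C : Type*) : Type _ := lp (fun _ : C => ℂ) 2

namespace EllTwo

variable {C : Type*}

theorem memℓp_two_iff {E : Type*} [NormedAddCommGroup E] {f : C → E} :
    Memℓp f 2 ↔ Summable fun c => ‖f c‖ ^ 2 := by
  rw [memℓp_gen_iff (by norm_num)]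
  simp

theorem hasSum_norm_sq (ψ : EllTwo C) : HasSum (fun c => ‖ψ c‖ ^ 2) (‖ψ‖ ^ 2) := by
  have := lp.hasSum_norm (p := 2) (by norm_num) ψ
  simpa using this

theorem norm_sq_le_of_summable {ψ : EllTwo C} {g : C → ℝ} (hg : Summable g)
    (h : ∀ c, ‖ψ c‖ ^ 2 ≤ g c) : ‖ψ‖ ^ 2 ≤ ∑' c, g c := by
  rw [← (hasSum_norm_sq ψ).tsum_eq]
  exact (hasSum_norm_sq ψ).summable.tsum_le_tsum h hg

theorem norm_le_of_coord_le {ψ φ : EllTwo C} {B : ℝ} (hB : 0 ≤ B)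
    (h : ∀ c, ‖φ c‖ ≤ B * ‖ψ c‖) : ‖φ‖ ≤ B * ‖ψ‖ := by
  have h2 : ‖φ‖ ^ 2 ≤ (B * ‖ψ‖) ^ 2 := by
    have hs := (hasSum_norm_sq ψ).mul_left (B ^ 2)
    refine (norm_sq_le_of_summable hs.summable fun c => ?_).trans ?_
    · rw [← mul_pow]
      gcongr
      exact h c
    · rw [hs.tsum_eq, mul_pow]
  exact le_of_sq_le_sq h2 (by positivity)
where
  le_of_sq_le_sq {a b : ℝ} (h : a ^ 2 ≤ b ^ 2) (hb : 0 ≤ b) : a ≤ b :=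
    le_of_abs_le (by simpa [abs_of_nonneg hb] using sq_le_sq.mp h)

variable (num : C → ℕ)

/-- Multiplication by `w (num c)` on `num c ≤ m`, and by zero elsewhere. -/
def cut (w : ℕ → ℝ) (m : ℕ) : EllTwo C →L[ℂ] EllTwo C :=
  LinearMap.mkContinuous
    { toFun := fun ψ => ⟨fun c => if num c ≤ m then (w (num c) : ℂ) * ψ c else 0, by
        refine memℓp_two_iff.mpr ?_
        refine Summable.of_nonneg_of_le (fun _ => by positivity) (fun c => ?_)
          ((hasSum_norm_sq ψ).summable.mul_left ((∑ k ∈ Finset.range (m + 1), |w k|) ^ 2))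
        rw [← mul_pow]
        gcongr
        split_ifs with h
        · rw [norm_mul, Complex.norm_real]
          gcongr
          exact Finset.single_le_sum (f := fun k => |w k|) (fun _ _ => abs_nonneg _)
            (Finset.mem_range.mpr (by omega))
        · rw [norm_zero]
          positivity⟩
      map_add' := fun ψ φ => by
        ext c
        simp only [lp.coeFn_add, Pi.add_apply]
        split_ifs <;> simp [mul_add]
      map_smul' := fun a ψ => by
        ext c
        simp only [lp.coeFn_smul, Pi.smul_apply, smul_eq_mul, RingHom.id_apply]
        split_ifs
        · ring
        · simp }
    (∑ k ∈ Finset.range (m + 1), |w k|) (fun ψ => by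
      refine norm_le_of_coord_le (Finset.sum_nonneg fun _ _ => abs_nonneg _) fun c => ?_
      simp only [LinearMap.coe_mk, AddHom.coe_mk]
      split_ifs with h
      · rw [norm_mul, Complex.norm_real]
        gcongr
        exact Finset.single_le_sum (f := fun k => |w k|) (fun _ _ => abs_nonneg _)
          (Finset.mem_range.mpr (by omega))
      · rw [norm_zero]
        exact mul_nonneg (Finset.sum_nonneg fun _ _ => abs_nonneg _) (norm_nonneg _))

theorem cut_apply (w : ℕ → ℝ) (m : ℕ) (ψ : EllTwo C) (c : C) :
    cut num w m ψ c = if num c ≤ m then (w (num c) : ℂ) * ψ c else 0 := rfl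

theorem inner_cut (w : ℕ → ℝ) (m : ℕ) (ψ φ : EllTwo C) :
    ⟪cut num w m ψ, φ⟫_ℂ = ⟪ψ, cut num w m φ⟫_ℂ := by
  rw [lp.inner_eq_tsum, lp.inner_eq_tsum]
  refine tsum_congr fun c => ?_
  simp only [cut_apply, RCLike.inner_apply]
  split_ifs <;> simp; ring

/-- The vectors supported on `num c ≤ m`. -/
def lev (m : ℕ) : Submodule ℂ (EllTwo C) where
  carrier := {ψ | ∀ c, m < num c → ψ c = 0}
  zero_mem' := fun _ _ => rfl
  add_mem' := fun {ψ φ} h₁ h₂ c hc => by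
    rw [lp.coeFn_add, Pi.add_apply, h₁ c hc, h₂ c hc, add_zero]
  smul_mem' := fun a ψ h c hc => by
    rw [lp.coeFn_smul, Pi.smul_apply, h c hc, smul_zero]

/-- The vectors supported on `num c = n`. -/
def sec (n : ℕ) : Submodule ℂ (EllTwo C) where
  carrier := {ψ | ∀ c, num c ≠ n → ψ c = 0}
  zero_mem' := fun _ _ => rfl
  add_mem' := fun {ψ φ} h₁ h₂ c hc => by
    rw [lp.coeFn_add, Pi.add_apply, h₁ c hc, h₂ c hc, add_zero]
  smul_mem' := fun a ψ h c hc => by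
    rw [lp.coeFn_smul, Pi.smul_apply, h c hc, smul_zero]

variable {num}

theorem lev_mono {m n : ℕ} (h : m ≤ n) : lev num m ≤ lev num n :=
  fun _ hψ c hc => hψ c (by omega)

theorem sec_le_lev (n : ℕ) : sec num n ≤ lev num n := fun _ hψ c hc => hψ c (by omega)

variable (num)

/-- The vectors on which `num` is bounded. -/
def fin : Submodule ℂ (EllTwo C) where
  carrier := {ψ | ∃ m, ψ ∈ lev num m}
  zero_mem' := ⟨0, Submodule.zero_mem _⟩
  add_mem' := by
    rintro ψ φ ⟨m, hm⟩ ⟨n, hn⟩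
    exact ⟨max m n, Submodule.add_mem _ (lev_mono (le_max_left _ _) hm)
      (lev_mono (le_max_right _ _) hn)⟩
  smul_mem' := by
    rintro a ψ ⟨m, hm⟩
    exact ⟨m, Submodule.smul_mem _ _ hm⟩

variable {num}

theorem cut_mem_lev (w : ℕ → ℝ) (m : ℕ) (ψ : EllTwo C) : cut num w m ψ ∈ lev num m :=
  fun c hc => by rw [cut_apply, if_neg (by omega)]

theorem cut_one_of_mem {m : ℕ} {ψ : EllTwo C} (h : ψ ∈ lev num m) : cut num 1 m ψ = ψ := by
  ext c
  rw [cut_apply]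
  split_ifs with hc
  · simp
  · rw [h c (by omega)]

theorem isClosed_lev (m : ℕ) : IsClosed (lev num m : Set (EllTwo C)) := by
  have : (lev num m : Set (EllTwo C)) = ⋂ c, ⋂ (_ : m < num c), {ψ | lp.evalCLM ℂ _ 2 c ψ = 0} := by
    ext ψ
    simp only [Set.mem_iInter]
    rfl
  rw [this]
  exact isClosed_iInter fun c => isClosed_iInter fun _ =>
    isClosed_eq (lp.evalCLM ℂ (fun _ : C => ℂ) 2 c).continuous continuous_const

theorem norm_cut_one_le (m : ℕ) (ψ : EllTwo C) : ‖cut num 1 m ψ‖ ≤ ‖ψ‖ := by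
  have := norm_le_of_coord_le (φ := cut num 1 m ψ) (ψ := ψ) zero_le_one fun c => by
    rw [cut_apply]
    split_ifs <;> simp
  simpa using this

theorem norm_sub_cut_one_le (m : ℕ) (ψ : EllTwo C) : ‖ψ - cut num 1 m ψ‖ ≤ ‖ψ‖ := by
  have := norm_le_of_coord_le (φ := ψ - cut num 1 m ψ) (ψ := ψ) zero_le_one fun c => by
    rw [lp.coeFn_sub, Pi.sub_apply, cut_apply]
    split_ifs <;> simp
  simpa using this

/-- A finite partial sum of the basis expansion lies in some level, and `1 - cut` is a contraction
that kills it. -/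
theorem tendsto_cut_one (ψ : EllTwo C) :
    Filter.Tendsto (fun m => cut num 1 m ψ) Filter.atTop (nhds ψ) := by
  classical
  rw [Metric.tendsto_atTop]
  intro ε hε
  have h := lp.hasSum_single (p := 2) (by norm_num) ψ
  obtain ⟨F, hF⟩ := ((Metric.tendsto_nhds.mp h) ε hε).exists
  refine ⟨F.sup num, fun m hm => ?_⟩
  have hmem : ∑ c ∈ F, lp.single 2 c (ψ c) ∈ lev num m := by
    refine Submodule.sum_mem _ fun c hc c' hc' => ?_
    rw [lp.single_apply, Pi.single_eq_of_ne]
    rintro rfl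
    have := Finset.le_sup (f := num) hc
    omega
  set φ := ∑ c ∈ F, lp.single 2 c (ψ c)
  have h1 : cut num 1 m ψ - ψ = -((ψ - φ) - cut num 1 m (ψ - φ)) := by
    rw [map_sub, cut_one_of_mem hmem]
    abel
  rw [dist_eq_norm, h1, norm_neg]
  refine (norm_sub_cut_one_le m _).trans_lt ?_
  rwa [← dist_eq_norm, dist_comm]

theorem dense_fin : Dense (fin num : Set (EllTwo C)) := fun ψ =>
  mem_closure_of_tendsto (tendsto_cut_one (num := num) ψ)
    (Filter.Eventually.of_forall fun m => ⟨m, cut_mem_lev 1 m ψ⟩)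

variable (num) in
/-- The component of `ψ` in the sector `num c = n`. -/
def proj (n : ℕ) : EllTwo C →L[ℂ] EllTwo C := cut num (Pi.single n 1) n

theorem proj_apply (n : ℕ) (ψ : EllTwo C) (c : C) :
    proj num n ψ c = if num c = n then ψ c else 0 := by
  rw [proj, cut_apply]
  by_cases h : num c = n
  · simp [h]
  · simp [h]

theorem proj_mem_sec (n : ℕ) (ψ : EllTwo C) : proj num n ψ ∈ sec num n :=
  fun c hc => by rw [proj_apply, if_neg hc]

theorem sum_proj {m : ℕ} {ψ : EllTwo C} (h : ψ ∈ lev num m) :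
    ∑ n ∈ Finset.range (m + 1), proj num n ψ = ψ := by
  ext c
  rw [lp.coeFn_sum, Finset.sum_apply]
  simp only [proj_apply, Finset.sum_ite_eq, Finset.mem_range]
  split_ifs with hc
  · rfl
  · rw [h c (by omega)]

theorem sum_norm_proj_sq (m : ℕ) (ψ : EllTwo C) :
    ∑ n ∈ Finset.range (m + 1), ‖proj num n ψ‖ ^ 2 ≤ ‖ψ‖ ^ 2 := by
  have h := hasSum_sum (s := Finset.range (m + 1))
    fun n _ => hasSum_norm_sq (proj num n ψ)
  refine hasSum_le (fun c => ?_) h (hasSum_norm_sq ψ)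
  have : ∀ n, ‖proj num n ψ c‖ ^ 2 = if num c = n then ‖ψ c‖ ^ 2 else 0 := fun n => by
    rw [proj_apply]
    split_ifs <;> simp
  simp only [this, Finset.sum_ite_eq]
  split_ifs
  · exact le_rfl
  · positivity

theorem inner_eq_zero_of_lev {m : ℕ} {ψ φ : EllTwo C} (h : ψ ∈ lev num m)
    (h' : ∀ c, num c ≤ m → φ c = 0) : ⟪ψ, φ⟫_ℂ = 0 := by
  rw [lp.inner_eq_tsum]
  refine (tsum_congr fun c => ?_).trans tsum_zero
  rcases le_or_gt (num c) m with hc | hc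
  · rw [h' c hc, inner_zero_right]
  · rw [h c hc, inner_zero_left]

/-- If `T` maps each sector `n` into the sectors `n - 2, …, n + 2`, then the images of the sectors
overlap at most five-fold. -/
theorem norm_sq_le_of_band {T : fin num →ₗ[ℂ] fin num}
    (hT : ∀ n (ψ : fin num), (ψ : EllTwo C) ∈ sec num n → ∀ c, (T ψ : EllTwo C) c ≠ 0 →
      num c ≤ n + 2 ∧ n ≤ num c + 2)
    {m : ℕ} (ψ : fin num) (hψ : (ψ : EllTwo C) ∈ lev num m) :
    ‖T ψ‖ ^ 2 ≤ 5 * ∑ n ∈ Finset.range (m + 1),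
      ‖T ⟨proj num n ψ, n, sec_le_lev n (proj_mem_sec n _)⟩‖ ^ 2 := by
  set φ : ℕ → fin num := fun n => ⟨proj num n ψ, n, sec_le_lev n (proj_mem_sec n _)⟩
  have hsum : ψ = ∑ n ∈ Finset.range (m + 1), φ n := by
    apply Subtype.ext
    rw [AddSubmonoidClass.coe_finsetSum, sum_proj hψ]
  have hcoord : ∀ c, (T ψ : EllTwo C) c = ∑ n ∈ Finset.range (m + 1), (T (φ n) : EllTwo C) c := by
    intro c
    conv_lhs => rw [hsum, map_sum, AddSubmonoidClass.coe_finsetSum, lp.coeFn_sum,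
      Finset.sum_apply]
  have h := hasSum_sum (s := Finset.range (m + 1))
    fun n _ => (hasSum_norm_sq (T (φ n) : EllTwo C)).mul_left 5
  rw [← Finset.mul_sum] at h
  refine hasSum_le (fun c => ?_) (hasSum_norm_sq (T ψ : EllTwo C)) h
  rw [hcoord c]
  set B := (Finset.range (m + 1)).filter fun n => num c ≤ n + 2 ∧ n ≤ num c + 2
  have hB : ∑ n ∈ Finset.range (m + 1), (T (φ n) : EllTwo C) c =
      ∑ n ∈ B, (T (φ n) : EllTwo C) c := by
    symm
    apply Finset.sum_subset (Finset.filter_subset _ _)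
    intro n hn hnB
    by_contra hne
    exact hnB (Finset.mem_filter.mpr ⟨hn, hT n (φ n) (proj_mem_sec n _) c hne⟩)
  have hcard : (B.card : ℝ) ≤ 5 := by
    have : B ⊆ Finset.Icc (num c - 2) (num c + 2) := fun n hn => by
      have := (Finset.mem_filter.mp hn).2
      rw [Finset.mem_Icc]
      omega
    have := Finset.card_le_card this
    rw [Nat.card_Icc] at this
    exact_mod_cast (by omega : B.card ≤ 5)
  calc ‖∑ n ∈ Finset.range (m + 1), (T (φ n) : EllTwo C) c‖ ^ 2
      ≤ (∑ n ∈ B, ‖(T (φ n) : EllTwo C) c‖) ^ 2 := by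
        rw [hB]
        gcongr
        exact norm_sum_le _ _
    _ ≤ B.card * ∑ n ∈ B, ‖(T (φ n) : EllTwo C) c‖ ^ 2 := sq_sum_le_card_mul_sum_sq
    _ ≤ 5 * ∑ n ∈ Finset.range (m + 1), ‖(T (φ n) : EllTwo C) c‖ ^ 2 := by
        gcongr
        exact Finset.filter_subset _ _
    _ = _ := by rw [Finset.mul_sum]

end EllTwo
end

/-! ### Operators that change the particle number by at most two -/

noncomputable section
namespace EllTwo
variable {C : Type*} {num : C → ℕ}

/-- `T` changes `num` by at most `2`, and its norm on the sector `n` is at most `B (n + 2)`. -/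
structure Banded (T : fin num →ₗ[ℂ] fin num) (B : ℝ) : Prop where
  nonneg : 0 ≤ B
  band : ∀ n (ψ : fin num), (ψ : EllTwo C) ∈ sec num n → ∀ c, (T ψ : EllTwo C) c ≠ 0 →
    num c ≤ n + 2 ∧ n ≤ num c + 2
  bound : ∀ n (ψ : fin num), (ψ : EllTwo C) ∈ sec num n → ‖T ψ‖ ≤ B * (n + 2) * ‖ψ‖

/-- The sectors are mutually orthogonal, so the sectorwise bounds add up in square; the overlap
factor 5 ≤ 3² gives the constant. The weight is left general: it is linear in `Banded.norm_le` and
cubic in the commutator estimate. -/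
theorem norm_le_of_band {T : fin num →ₗ[ℂ] fin num}
    (hT : ∀ n (ψ : fin num), (ψ : EllTwo C) ∈ sec num n → ∀ c, (T ψ : EllTwo C) c ≠ 0 →
      num c ≤ n + 2 ∧ n ≤ num c + 2)
    {m : ℕ} {b : ℝ} (hb : 0 ≤ b) {w : ℕ → ℝ}
    (hw : ∀ n ≤ m, ∀ ψ : fin num, (ψ : EllTwo C) ∈ sec num n → ‖T ψ‖ ≤ b * |w n| * ‖ψ‖)
    (ψ : fin num) (hψ : (ψ : EllTwo C) ∈ lev num m) :
    ‖T ψ‖ ≤ 3 * b * ‖cut num w m (ψ : EllTwo C)‖ := by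
  have h1 := norm_sq_le_of_band hT ψ hψ
  have h2 : ∑ n ∈ Finset.range (m + 1),
      ‖T ⟨proj num n ψ, n, sec_le_lev n (proj_mem_sec n _)⟩‖ ^ 2 ≤
      ∑ n ∈ Finset.range (m + 1), b ^ 2 * ‖proj num n (cut num w m (ψ : EllTwo C))‖ ^ 2 := by
    refine Finset.sum_le_sum fun n hn => ?_
    have hnm : n ≤ m := by
      rw [Finset.mem_range] at hn
      omega
    have h3 : proj num n (cut num w m (ψ : EllTwo C)) = (w n : ℂ) • proj num n (ψ : EllTwo C) := by
      ext c
      rw [proj_apply, lp.coeFn_smul, Pi.smul_apply, proj_apply, cut_apply]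
      by_cases hc : num c = n
      · simp [hc, hnm]
      · simp [hc]
    rw [h3, norm_smul, Complex.norm_real, ← mul_pow]
    refine pow_le_pow_left₀ (norm_nonneg _) ?_ 2
    refine (hw n hnm _ (proj_mem_sec n _)).trans (le_of_eq ?_)
    rw [Real.norm_eq_abs, Submodule.coe_norm]
    ring
  rw [← Finset.mul_sum] at h2
  have h4 := sum_norm_proj_sq (num := num) m (cut num w m (ψ : EllTwo C))
  have h5 : ‖T ψ‖ ^ 2 ≤ (3 * b * ‖cut num w m (ψ : EllTwo C)‖) ^ 2 := by
    have h6 : b ^ 2 * ∑ n ∈ Finset.range (m + 1), ‖proj num n (cut num w m (ψ : EllTwo C))‖ ^ 2 ≤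
        b ^ 2 * ‖cut num w m (ψ : EllTwo C)‖ ^ 2 := by gcongr
    nlinarith [sq_nonneg (b * ‖cut num w m (ψ : EllTwo C)‖)]
  exact le_of_sq_le_sq h5 (by positivity)
where
  le_of_sq_le_sq {a b : ℝ} (h : a ^ 2 ≤ b ^ 2) (hb : 0 ≤ b) : a ≤ b :=
    le_of_abs_le (by simpa [abs_of_nonneg hb] using sq_le_sq.mp h)

theorem norm_cut_le {w : ℕ → ℝ} {m : ℕ} {B : ℝ} (hB : 0 ≤ B) (h : ∀ n ≤ m, |w n| ≤ B)
    (ψ : EllTwo C) : ‖cut num w m ψ‖ ≤ B * ‖ψ‖ :=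
  norm_le_of_coord_le hB fun c => by
    rw [cut_apply]
    split_ifs with hc
    · rw [norm_mul, Complex.norm_real]
      exact mul_le_mul_of_nonneg_right (h _ hc) (norm_nonneg _)
    · rw [norm_zero]
      positivity

namespace Banded

variable {T : fin num →ₗ[ℂ] fin num} {B : ℝ}

theorem norm_le (hT : Banded T B) {m : ℕ} (ψ : fin num) (hψ : (ψ : EllTwo C) ∈ lev num m) :
    ‖T ψ‖ ≤ 3 * B * (m + 2) * ‖ψ‖ := by
  have h := norm_le_of_band hT.band hT.nonneg (w := fun n => (n : ℝ) + 2) (m := m)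
    (fun n _ φ hφ => by
      rw [abs_of_nonneg (by positivity)]
      exact hT.bound n φ hφ) ψ hψ
  refine h.trans ?_
  have h2 := norm_cut_le (num := num) (w := fun n => (n : ℝ) + 2) (m := m) (B := m + 2)
    (by positivity) (fun n hn => by
      rw [abs_of_nonneg (by positivity)]
      have : (n : ℝ) ≤ m := by exact_mod_cast hn
      linarith) (ψ : EllTwo C)
  have := mul_le_mul_of_nonneg_left h2 (mul_nonneg (by norm_num : (0 : ℝ) ≤ 3) hT.nonneg)
  rw [Submodule.coe_norm ψ]
  linarith

theorem mem_lev (hT : Banded T B) {m : ℕ} (ψ : fin num) (hψ : (ψ : EllTwo C) ∈ lev num m) :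
    (T ψ : EllTwo C) ∈ lev num (m + 2) := by
  have hsum : ψ = ∑ n ∈ Finset.range (m + 1),
      (⟨proj num n ψ, n, sec_le_lev n (proj_mem_sec n _)⟩ : fin num) := by
    apply Subtype.ext
    rw [AddSubmonoidClass.coe_finsetSum, sum_proj hψ]
  rw [hsum, map_sum, AddSubmonoidClass.coe_finsetSum]
  refine Submodule.sum_mem _ fun n hn c hc => ?_
  by_contra hne
  have := hT.band n _ (proj_mem_sec n _) c hne
  rw [Finset.mem_range] at hn
  omega

end Banded

variable (num) in
/-- The truncation of a vector to `num c ≤ m`. -/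
def cutFin (w : ℕ → ℝ) (m : ℕ) : EllTwo C →ₗ[ℂ] fin num :=
  (cut num w m).toLinearMap.codRestrict (fin num) fun ψ => ⟨m, cut_mem_lev w m ψ⟩

theorem coe_cutFin (w : ℕ → ℝ) (m : ℕ) (ψ : EllTwo C) :
    (cutFin num w m ψ : EllTwo C) = cut num w m ψ := rfl

open Classical in
/-- The truncation of an operator to `num c ≤ m`, as a bounded operator. -/
def trunc (T : fin num →ₗ[ℂ] fin num) (m : ℕ) : EllTwo C →L[ℂ] EllTwo C :=
  if h : ∃ B : ℝ, ∀ ψ, ‖((cut num 1 m).toLinearMap ∘ₗ (fin num).subtype ∘ₗ T ∘ₗ cutFin num 1 m) ψ‖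
      ≤ B * ‖ψ‖ then
    LinearMap.mkContinuousOfExistsBound _ h
  else 0

/-! ### Truncated operators and the cubic weight -/

section Trunc

variable {T : fin num →ₗ[ℂ] fin num} {B : ℝ}

theorem norm_cut_apply_cutFin_le (hT : Banded T B) (m : ℕ) (ψ : EllTwo C) :
    ‖cut num 1 m (T (cutFin num 1 m ψ) : EllTwo C)‖ ≤ 3 * B * (m + 2) * ‖ψ‖ := by
  refine (norm_cut_one_le m _).trans ?_
  refine (hT.norm_le _ (cut_mem_lev 1 m ψ)).trans ?_
  have := hT.nonneg
  gcongr
  exact norm_cut_one_le m ψ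

theorem trunc_apply (hT : Banded T B) (m : ℕ) (ψ : EllTwo C) :
    trunc T m ψ = cut num 1 m (T (cutFin num 1 m ψ) : EllTwo C) := by
  rw [trunc, dif_pos ⟨_, norm_cut_apply_cutFin_le hT m⟩]
  rfl

theorem norm_trunc_le (hT : Banded T B) (m : ℕ) : ‖trunc T m‖ ≤ 3 * B * (m + 2) :=
  ContinuousLinearMap.opNorm_le_bound _ (by have := hT.nonneg; positivity) fun ψ => by
    rw [trunc_apply hT]
    exact norm_cut_apply_cutFin_le hT m ψ

theorem trunc_mem_lev (hT : Banded T B) (m : ℕ) (ψ : EllTwo C) : trunc T m ψ ∈ lev num m := by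
  rw [trunc_apply hT]
  exact cut_mem_lev _ _ _

theorem cutFin_one_of_mem {m : ℕ} (ψ : fin num) (h : (ψ : EllTwo C) ∈ lev num m) :
    cutFin num 1 m ψ = ψ := Subtype.ext (cut_one_of_mem h)

theorem trunc_apply_of_mem (hT : Banded T B) {m : ℕ} (ψ : fin num)
    (hψ : (ψ : EllTwo C) ∈ lev num m) :
    trunc T m ψ = cut num 1 m (T ψ : EllTwo C) := by
  rw [trunc_apply hT, cutFin_one_of_mem ψ hψ]

theorem trunc_apply_eq (hT : Banded T B) {m n : ℕ} (ψ : fin num) (hψ : (ψ : EllTwo C) ∈ lev num n)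
    (hmn : n + 2 ≤ m) : trunc T m ψ = T ψ := by
  rw [trunc_apply_of_mem hT ψ (lev_mono (by omega) hψ),
    cut_one_of_mem (lev_mono hmn (hT.mem_lev ψ hψ))]

theorem cut_comp_trunc (hT : Banded T B) (m : ℕ) : cut num 1 m * trunc T m = trunc T m :=
  ContinuousLinearMap.ext fun ψ => cut_one_of_mem (trunc_mem_lev hT m ψ)

theorem trunc_comp_cut (hT : Banded T B) (m : ℕ) : trunc T m * cut num 1 m = trunc T m :=
  ContinuousLinearMap.ext fun ψ => by
    rw [mul_apply_eq_comp, trunc_apply hT, trunc_apply hT]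
    congr 3
    exact Subtype.ext (cut_one_of_mem (cut_mem_lev _ _ _))

/-- `T` is symmetric. -/
def Symm (T : fin num →ₗ[ℂ] fin num) : Prop :=
  ∀ ψ φ : fin num, ⟪(T ψ : EllTwo C), (φ : EllTwo C)⟫_ℂ = ⟪(ψ : EllTwo C), (T φ : EllTwo C)⟫_ℂ

theorem adjoint_trunc (hT : Banded T B) (hs : Symm T) (m : ℕ) :
    ContinuousLinearMap.adjoint (trunc T m) = trunc T m := by
  symm
  rw [ContinuousLinearMap.eq_adjoint_iff]
  intro ψ φ
  rw [trunc_apply hT, trunc_apply hT]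
  exact (inner_cut _ _ _ _ _).trans
    ((hs (cutFin num 1 m ψ) (cutFin num 1 m φ)).trans (inner_cut _ _ _ _ _))

/-- The cubic weight. -/
def wt (n : ℕ) : ℝ := (n + 2) ^ 3

theorem wt_nonneg (n : ℕ) : 0 ≤ wt n := by
  unfold wt
  positivity

/-- A difference of cubes is `p - n`, at most 2 in absolute value, times a quadratic expression. As
`p + 2 ≤ 2 (n + 2)`, the latter is at most `12 (n + 2)²`, with room to spare. -/
theorem abs_wt_sub_le {p n : ℕ} (h₁ : p ≤ n + 2) (h₂ : n ≤ p + 2) :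
    |wt p - wt n| * (n + 2) ≤ 24 * wt n := by
  have h3 : (p : ℝ) ≤ n + 2 := by exact_mod_cast h₁
  have h4 : (n : ℝ) ≤ p + 2 := by exact_mod_cast h₂
  have hn : (0 : ℝ) ≤ n := by positivity
  have hp : (0 : ℝ) ≤ p := by positivity
  have h5 : wt p - wt n = ((p : ℝ) - n) * ((p + 2) ^ 2 + (p + 2) * (n + 2) + (n + 2) ^ 2) := by
    unfold wt
    ring
  have h6 : |(p : ℝ) - n| ≤ 2 := abs_le.mpr ⟨by linarith, by linarith⟩
  have h7 : ((p : ℝ) + 2) ^ 2 + (p + 2) * (n + 2) + (n + 2) ^ 2 ≤ 12 * (n + 2) ^ 2 := by nlinarith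
  rw [h5, abs_mul, abs_of_nonneg (by positivity : (0 : ℝ) ≤ (p + 2) ^ 2 + (p + 2) * (n + 2) +
    (n + 2) ^ 2)]
  have h8 : |(p : ℝ) - n| * ((p + 2) ^ 2 + (p + 2) * (n + 2) + (n + 2) ^ 2) ≤
      2 * (12 * (n + 2) ^ 2) := by gcongr
  calc _ ≤ 2 * (12 * ((n : ℝ) + 2) ^ 2) * (n + 2) := by gcongr
    _ = _ := by
      unfold wt
      ring

/-- Between neighbouring sectors the weight varies by one power less than its size, and `T` grows by
one power; the commutator is therefore no larger than the weight itself. The bound does not involve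
`m`. -/
theorem norm_cut_wt_commutator_le (hT : Banded T B) (m : ℕ) (φ : EllTwo C) :
    ‖cut num wt m (trunc T m φ) - trunc T m (cut num wt m φ)‖ ≤
      3 * (24 * B) * ‖cut num wt m φ‖ := by
  -- The weight is cut at `m + 2` because `T` may raise level `m` by two; on vectors of level `m`,
  -- `R` is thus the full commutator, with no cut-off error.
  set R : fin num →ₗ[ℂ] fin num :=
    (cutFin num wt (m + 2) ∘ₗ (fin num).subtype) ∘ₗ T -
      T ∘ₗ (cutFin num wt (m + 2) ∘ₗ (fin num).subtype) with hR
  have hsec : ∀ n ≤ m, ∀ ψ : fin num, (ψ : EllTwo C) ∈ sec num n → ∀ c, (R ψ : EllTwo C) c =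
      ((wt (num c) - wt n : ℝ) : ℂ) * (T ψ : EllTwo C) c := by
    intro n hn ψ hψ c
    have h1 : cutFin num wt (m + 2) (ψ : EllTwo C) = ((wt n : ℝ) : ℂ) • ψ := by
      apply Subtype.ext
      ext c
      rw [coe_cutFin, cut_apply, Submodule.coe_smul, lp.coeFn_smul, Pi.smul_apply]
      by_cases hc : num c = n
      · rw [if_pos (by omega), hc, smul_eq_mul]
      · rw [hψ c hc]
        simp
    have h2 : (R ψ : EllTwo C) c = cut num wt (m + 2) (T ψ : EllTwo C) c -
        (((wt n : ℝ) : ℂ) • (T ψ : EllTwo C)) c := by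
      rw [hR]
      simp only [LinearMap.sub_apply, LinearMap.comp_apply, Submodule.coe_subtype, h1, map_smul]
      rfl
    rw [h2, cut_apply, lp.coeFn_smul, Pi.smul_apply, smul_eq_mul]
    by_cases hc : (T ψ : EllTwo C) c = 0
    · simp [hc]
    · have := hT.band n ψ hψ c hc
      rw [if_pos (by omega)]
      push_cast
      ring
  have hband : ∀ n (ψ : fin num), (ψ : EllTwo C) ∈ sec num n → ∀ c, (R ψ : EllTwo C) c ≠ 0 →
      num c ≤ n + 2 ∧ n ≤ num c + 2 := by
    intro n ψ hψ c hc
    have h2 : (R ψ : EllTwo C) c = cut num wt (m + 2) (T ψ : EllTwo C) c -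
        (T (cutFin num wt (m + 2) ψ) : EllTwo C) c := by
      rw [hR]
      rfl
    by_contra hne
    apply hc
    have h3 : (T ψ : EllTwo C) c = 0 := by
      by_contra h
      exact hne (hT.band n ψ hψ c h)
    have h4 : (T (cutFin num wt (m + 2) ψ) : EllTwo C) c = 0 := by
      by_contra h
      refine hne (hT.band n _ (fun c' hc' => ?_) c h)
      rw [coe_cutFin, cut_apply, hψ c' hc']
      simp
    rw [h2, h4, cut_apply, h3]
    simp
  have hB := hT.nonneg
  have key := norm_le_of_band hband (m := m) (b := 24 * B) (by positivity) (w := wt)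
    (fun n hn ψ hψ => by
      rw [abs_of_nonneg (wt_nonneg n)]
      have h1 : ‖(R ψ : EllTwo C)‖ ≤ (24 * wt n / (n + 2)) * ‖(T ψ : EllTwo C)‖ := by
        refine norm_le_of_coord_le (div_nonneg (mul_nonneg (by norm_num) (wt_nonneg n))
          (by positivity)) fun c => ?_
        rw [hsec n hn ψ hψ c, norm_mul, Complex.norm_real]
        by_cases hc : (T ψ : EllTwo C) c = 0
        · simp [hc]
        · gcongr
          rw [le_div_iff₀ (by positivity)]
          obtain ⟨h₁, h₂⟩ := hT.band n ψ hψ c hc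
          exact abs_wt_sub_le h₁ h₂
      have h2 := hT.bound n ψ hψ
      calc ‖R ψ‖ ≤ (24 * wt n / (n + 2)) * ‖T ψ‖ := h1
        _ ≤ (24 * wt n / (n + 2)) * (B * (n + 2) * ‖ψ‖) := by
          have := wt_nonneg n
          gcongr
        _ = _ := by
          field_simp) (cutFin num 1 m φ) (cut_mem_lev 1 m φ)
  -- The weight is diagonal and commutes with the projection onto `num c ≤ m`, so the truncated
  -- commutator is the compression of `R`.
  have e1 : cut num wt m (trunc T m φ) - trunc T m (cut num wt m φ) =
      cut num 1 m (R (cutFin num 1 m φ) : EllTwo C) := by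
    have h2 : (R (cutFin num 1 m φ) : EllTwo C) =
        cut num wt (m + 2) (T (cutFin num 1 m φ) : EllTwo C) -
        (T (cutFin num wt (m + 2) (cut num 1 m φ)) : EllTwo C) := by
      rw [hR]
      rfl
    have h3 : cutFin num wt (m + 2) (cut num 1 m φ) = cutFin num 1 m (cut num wt m φ) := by
      apply Subtype.ext
      ext c
      simp only [coe_cutFin, cut_apply]
      by_cases hc : num c ≤ m
      · simp [hc, show num c ≤ m + 2 by omega]
      · simp [hc]
    rw [h2, map_sub, h3, trunc_apply hT, trunc_apply hT]
    congr 1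
    ext c
    simp only [cut_apply]
    by_cases hc : num c ≤ m
    · simp [hc, show num c ≤ m + 2 by omega]
    · simp [hc]
  rw [e1]
  refine (norm_cut_one_le m _).trans (key.trans (le_of_eq ?_))
  congr 2
  ext c
  simp only [coe_cutFin, cut_apply]
  by_cases hc : num c ≤ m <;> simp [hc]

end Trunc
end EllTwo
end

noncomputable section

/-! ### One-parameter groups in Banach algebras -/

section OneParam

variable {𝔸 : Type*} [NormedRing 𝔸] [NormedAlgebra ℂ 𝔸]

/-- `e^{itx}`. -/
def oneParam (x : 𝔸) (t : ℝ) : 𝔸 := NormedSpace.exp ((Complex.I * t) • x)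

theorem oneParam_zero (x : 𝔸) : oneParam x 0 = 1 := by
  simp [oneParam, NormedSpace.exp_zero]

theorem commute_oneParam {x y : 𝔸} (h : Commute y x) (t : ℝ) : Commute y (oneParam x t) :=
  (h.smul_right _).exp_right

variable [CompleteSpace 𝔸]

theorem oneParam_add (x : 𝔸) (s t : ℝ) : oneParam x (s + t) = oneParam x s * oneParam x t := by
  let _ : NormedAlgebra ℚ 𝔸 := NormedAlgebra.restrictScalars ℚ ℂ 𝔸
  rw [oneParam, oneParam, oneParam, ← NormedSpace.exp_add_of_commute]
  · rw [← add_smul]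
    push_cast
    ring_nf
  · exact ((Commute.refl x).smul_left _).smul_right _

theorem oneParam_neg_mul (x : 𝔸) (t : ℝ) : oneParam x (-t) * oneParam x t = 1 := by
  rw [← oneParam_add, neg_add_cancel, oneParam_zero]

theorem hasDerivAt_oneParam (x : 𝔸) (t : ℝ) :
    HasDerivAt (oneParam x) (oneParam x t * (Complex.I • x)) t := by
  have h := (hasDerivAt_exp_smul_const (𝕂 := ℂ) (Complex.I • x) (t : ℂ)).scomp t
    Complex.ofRealCLM.hasDerivAt
  simp only [Complex.ofRealCLM_apply, Complex.ofReal_one, one_smul, smul_smul,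
    Function.comp_def, mul_comm _ Complex.I] at h
  exact h

theorem hasDerivAt_oneParam_neg (x : 𝔸) (t : ℝ) :
    HasDerivAt (fun t => oneParam x (-t)) (-((Complex.I • x) * oneParam x (-t))) t := by
  have h := (hasDerivAt_oneParam x (-t)).scomp t (hasDerivAt_neg t)
  have hc : Commute (Complex.I • x) (oneParam x (-t)) :=
    commute_oneParam ((Commute.refl x).smul_left _) _
  rw [← hc.eq] at h
  simpa [Function.comp_def] using h

theorem continuous_oneParam (x : 𝔸) : Continuous (oneParam x) :=
  continuous_iff_continuousAt.mpr fun t => (hasDerivAt_oneParam x t).continuousAt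

end OneParam

/-! ### The unitary groups of the truncated operators -/

namespace EllTwo
variable {C : Type*} {num : C → ℕ}

section Truncated

variable {A : fin num →ₗ[ℂ] fin num} {B : ℝ}

theorem norm_oneParam_apply {E : Type*} [NormedAddCommGroup E] [InnerProductSpace ℂ E]
    [CompleteSpace E] {a : E →L[ℂ] E} (ha : ContinuousLinearMap.adjoint a = a) (t : ℝ) (ψ : E) :
    ‖oneParam a t ψ‖ = ‖ψ‖ := by
  have h : ContinuousLinearMap.adjoint (oneParam a t) = oneParam a (-t) := by
    rw [← ContinuousLinearMap.star_eq_adjoint, oneParam, NormedSpace.star_exp, oneParam,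
      star_smul, ContinuousLinearMap.star_eq_adjoint, ha]
    congr 2
    simp
  have h2 : ⟪oneParam a t ψ, oneParam a t ψ⟫_ℂ = ⟪ψ, ψ⟫_ℂ := by
    rw [← ContinuousLinearMap.adjoint_inner_right, h, ← mul_apply_eq_comp, oneParam_neg_mul]
    rfl
  rw [inner_self_eq_norm_sq_to_K, inner_self_eq_norm_sq_to_K] at h2
  have h3 : ‖oneParam a t ψ‖ ^ 2 = ‖ψ‖ ^ 2 := by exact_mod_cast h2
  exact (pow_left_inj₀ (norm_nonneg _) (norm_nonneg _) two_ne_zero).mp h3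

theorem adjoint_oneParam {E : Type*} [NormedAddCommGroup E] [InnerProductSpace ℂ E]
    [CompleteSpace E] {a : E →L[ℂ] E} (ha : ContinuousLinearMap.adjoint a = a) (t : ℝ) :
    ContinuousLinearMap.adjoint (oneParam a t) = oneParam a (-t) := by
  rw [← ContinuousLinearMap.star_eq_adjoint, oneParam, NormedSpace.star_exp, oneParam,
    star_smul, ContinuousLinearMap.star_eq_adjoint, ha]
  congr 2
  simp

variable (A) in
/-- The unitary group generated by the truncation of `A`. -/
def flow (m : ℕ) (t : ℝ) : EllTwo C →L[ℂ] EllTwo C := oneParam (trunc A m) t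

theorem norm_flow (hA : Banded A B) (hs : Symm A) (m : ℕ) (t : ℝ) (ψ : EllTwo C) :
    ‖flow A m t ψ‖ = ‖ψ‖ := norm_oneParam_apply (adjoint_trunc hA hs m) t ψ

/-- The truncation commutes with the projection onto the level, hence so does its exponential. -/
theorem flow_mem_lev (hA : Banded A B) (m : ℕ) (t : ℝ) {ψ : EllTwo C} (hψ : ψ ∈ lev num m) :
    flow A m t ψ ∈ lev num m := by
  have hc : Commute (cut num 1 m) (flow A m t) :=
    commute_oneParam ((cut_comp_trunc hA m).trans (trunc_comp_cut hA m).symm) t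
  have := congrArg (fun T : EllTwo C →L[ℂ] EllTwo C => T ψ) hc.eq
  simp only [mul_apply_eq_comp] at this
  rw [cut_one_of_mem hψ] at this
  rw [← this]
  exact cut_mem_lev _ _ _

/-- Gronwall for the conjugated operator `e^{-isa} G e^{isa}` applied to `ψ`: its derivative has the
norm of `[G, a]` on the orbit, which is at most `κ` times the norm of the function itself. The sign
`σ` covers both time directions with one argument on `[0, t]`. -/
theorem norm_apply_oneParam_le {E : Type*} [NormedAddCommGroup E] [InnerProductSpace ℂ E]
    [CompleteSpace E] {a G : E →L[ℂ] E} (ha : ContinuousLinearMap.adjoint a = a) {κ : ℝ}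
    (h : ∀ φ, ‖G (a φ) - a (G φ)‖ ≤ κ * ‖G φ‖) (ψ : E) {t : ℝ} (ht : 0 ≤ t) (σ : ℝ)
    (hσ : σ = 1 ∨ σ = -1) :
    ‖G (oneParam a (σ * t) ψ)‖ ≤ ‖G ψ‖ * Real.exp (κ * t) := by
  set f : ℝ → E := fun s => oneParam a (-(σ * s)) (G (oneParam a (σ * s) ψ)) with hf
  have hfn : ∀ s, ‖f s‖ = ‖G (oneParam a (σ * s) ψ)‖ := fun s => norm_oneParam_apply ha _ _
  have hd : ∀ s, HasDerivAt f (σ • oneParam a (-(σ * s))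
      (Complex.I • (G (a (oneParam a (σ * s) ψ)) - a (G (oneParam a (σ * s) ψ))))) s := by
    intro s
    have h1 : HasDerivAt (fun s => oneParam a (-s) * G * oneParam a s)
        (oneParam a (-(σ * s)) * (Complex.I • (G * a - a * G)) * oneParam a (σ * s)) (σ * s) := by
      have := ((hasDerivAt_oneParam_neg a (σ * s)).mul_const G).mul (hasDerivAt_oneParam a (σ * s))
      refine this.congr_deriv ?_
      have hc : Commute a (oneParam a (σ * s)) := commute_oneParam (Commute.refl a) _
      have hc' : Commute a (oneParam a (-(σ * s))) := commute_oneParam (Commute.refl a) _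
      simp only [mul_smul_comm, smul_mul_assoc, mul_sub, sub_mul, smul_sub, mul_assoc, neg_mul]
      rw [← hc.eq, ← mul_assoc a, hc'.eq]
      simp only [mul_assoc]
      abel
    have h2 := h1.scomp s ((hasDerivAt_id s).const_mul σ)
    have h3 := ((ContinuousLinearMap.apply ℂ E ψ).restrictScalars ℝ).hasFDerivAt.comp_hasDerivAt s h2
    refine h3.congr_deriv ?_
    simp
  have hb : ∀ s, ‖σ • oneParam a (-(σ * s))
      (Complex.I • (G (a (oneParam a (σ * s) ψ)) - a (G (oneParam a (σ * s) ψ))))‖ ≤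
      κ * ‖f s‖ + 0 := by
    intro s
    have hσ' : ‖σ‖ = 1 := by rcases hσ with rfl | rfl <;> simp
    rw [norm_smul, hσ', one_mul, norm_oneParam_apply ha, norm_smul, Complex.norm_I, one_mul, hfn,
      add_zero]
    exact h _
  have := norm_le_gronwallBound_of_norm_deriv_right_le (f := f) (a := 0) (b := t) (δ := ‖G ψ‖)
    (fun s _ => (hd s).continuousAt.continuousWithinAt) (fun s _ => (hd s).hasDerivWithinAt)
    (by rw [hfn, mul_zero, oneParam_zero]; exact le_rfl) (fun s _ => hb s) t ⟨ht, le_rfl⟩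
  rwa [hfn, gronwallBound_ε0, sub_zero] at this

/-- The exponent is independent of `m`: cubic decay in the particle number is propagated uniformly
by all truncated groups. Here `72 = 3 · 24`, from the commutator bound. -/
theorem norm_cut_wt_flow_le (hA : Banded A B) (hs : Symm A) (m : ℕ) (t : ℝ) (ψ : EllTwo C) :
    ‖cut num wt m (flow A m t ψ)‖ ≤ ‖cut num wt m ψ‖ * Real.exp (72 * B * |t|) := by
  have h := fun σ hσ => norm_apply_oneParam_le (adjoint_trunc hA hs m) (G := cut num wt m)
    (κ := 72 * B) (fun φ => (norm_cut_wt_commutator_le hA m φ).trans (le_of_eq (by ring))) ψ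
    (abs_nonneg t) σ hσ
  rcases le_total 0 t with ht | ht
  · have := h 1 (Or.inl rfl)
    rw [one_mul, abs_of_nonneg ht] at this
    rwa [abs_of_nonneg ht]
  · have := h (-1) (Or.inr rfl)
    rw [abs_of_nonpos ht, neg_one_mul, neg_neg] at this
    rwa [abs_of_nonpos ht]

/-- Chebyshev: what remains lives on `num c ≥ k + 1`, where the weight is at least `(k + 3)³`. -/
theorem norm_sub_cut_le (k : ℕ) {φ : EllTwo C} (hφ : φ ∈ lev num (k + 4)) :
    ‖φ - cut num 1 k φ‖ ≤ 1 / ((k : ℝ) + 3) ^ 3 * ‖cut num wt (k + 4) φ‖ := by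
  refine norm_le_of_coord_le (by positivity) fun c => ?_
  rw [lp.coeFn_sub, Pi.sub_apply, cut_apply, cut_apply]
  by_cases h1 : num c ≤ k
  · simp [h1, show num c ≤ k + 4 by omega]
    positivity
  · by_cases h2 : num c ≤ k + 4
    · rw [if_neg h1, if_pos h2, sub_zero, norm_mul, Complex.norm_real, Real.norm_eq_abs,
        abs_of_nonneg (wt_nonneg _), ← mul_assoc]
      refine le_mul_of_one_le_left (norm_nonneg _) ?_
      rw [one_div, inv_mul_eq_div, one_le_div (by positivity)]
      have : (k : ℝ) + 1 ≤ num c := by exact_mod_cast (by omega : k + 1 ≤ num c)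
      exact pow_le_pow_left₀ (by positivity) (by linarith) 3
    · rw [if_neg h1, if_neg h2, hφ c (by omega)]
      simp

/-- Truncating `T φ` only loses what `T` does to the top sectors of `φ`. -/
theorem norm_sub_cut_apply_le {T : fin num →ₗ[ℂ] fin num} {B' : ℝ} (hT : Banded T B') (k : ℕ)
    (φ : fin num) (hφ : (φ : EllTwo C) ∈ lev num (k + 4)) :
    ‖(T φ : EllTwo C) - cut num 1 (k + 4) (T φ : EllTwo C)‖ ≤
      3 * B' * (k + 6) * (1 / ((k : ℝ) + 3) ^ 3 * ‖cut num wt (k + 4) (φ : EllTwo C)‖) := by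
  -- `T χ` already lies in level `k + 2`, so it is untouched by the cut at `k + 4`; only `φ - χ`
  -- contributes.
  set χ : fin num := cutFin num 1 k (φ : EllTwo C)
  have h1 : (T χ : EllTwo C) ∈ lev num (k + 4) :=
    lev_mono (by omega) (hT.mem_lev χ (cut_mem_lev 1 k _))
  have h2 : (T φ : EllTwo C) - cut num 1 (k + 4) (T φ : EllTwo C) =
      (T (φ - χ) : EllTwo C) - cut num 1 (k + 4) (T (φ - χ) : EllTwo C) := by
    rw [map_sub, Submodule.coe_sub, map_sub, cut_one_of_mem h1]
    abel
  rw [h2]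
  refine (norm_sub_cut_one_le _ _).trans ?_
  have h3 : ((φ - χ : fin num) : EllTwo C) ∈ lev num (k + 4) :=
    Submodule.sub_mem _ hφ (lev_mono (by omega) (cut_mem_lev 1 k _))
  have h4 := hT.norm_le _ h3
  have h5 := norm_sub_cut_le k hφ
  have := hT.nonneg
  refine h4.trans ?_
  push_cast
  rw [show (k : ℝ) + 4 + 2 = k + 6 by ring]
  gcongr
  exact h5

theorem cut_wt_of_mem {m n : ℕ} {ψ : EllTwo C} (hψ : ψ ∈ lev num n) (h : n ≤ m) :
    cut num wt m ψ = cut num wt n ψ := by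
  ext c
  simp only [cut_apply]
  by_cases hc : num c ≤ n
  · simp [hc, show num c ≤ m by omega]
  · rw [hψ c (by omega)]
    simp

end Truncated
end EllTwo
end

noncomputable section

/-! ### Strongly continuous unitary groups -/

section UnitaryGroup

variable {E : Type*} [NormedAddCommGroup E] [InnerProductSpace ℂ E] [CompleteSpace E]

/-- A strongly continuous one-parameter group of unitaries. -/
structure IsUnitaryGroup (U : ℝ → E →L[ℂ] E) : Prop where
  unitary : ∀ t, U t ∈ unitary (E →L[ℂ] E)
  zero : U 0 = 1
  add : ∀ s t, U (s + t) = U s * U t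
  continuous : ∀ ψ, Continuous fun t => U t ψ

namespace IsUnitaryGroup

variable {U V : ℝ → E →L[ℂ] E}

theorem norm_apply (hU : IsUnitaryGroup U) (t : ℝ) (x : E) : ‖U t x‖ = ‖x‖ := by
  have h := (Unitary.mem_iff.mp (hU.unitary t)).1
  have h2 : ⟪U t x, U t x⟫_ℂ = ⟪x, x⟫_ℂ := by
    rw [← ContinuousLinearMap.adjoint_inner_right, ← ContinuousLinearMap.star_eq_adjoint,
      ← mul_apply_eq_comp, h]
    rfl
  rw [inner_self_eq_norm_sq_to_K, inner_self_eq_norm_sq_to_K] at h2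
  have h3 : ‖U t x‖ ^ 2 = ‖x‖ ^ 2 := by exact_mod_cast h2
  exact (pow_left_inj₀ (norm_nonneg _) (norm_nonneg _) two_ne_zero).mp h3

theorem apply_neg_apply (hU : IsUnitaryGroup U) (t : ℝ) (x : E) : U t (U (-t) x) = x := by
  rw [← mul_apply_eq_comp, ← hU.add, add_neg_cancel, hU.zero]
  rfl

theorem inner_apply_left (hU : IsUnitaryGroup U) (t : ℝ) (x y : E) :
    ⟪U t x, y⟫_ℂ = ⟪x, U (-t) y⟫_ℂ := by
  have h := (Unitary.mem_iff.mp (hU.unitary t)).1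
  conv_lhs => rw [← hU.apply_neg_apply t y]
  rw [← ContinuousLinearMap.adjoint_inner_right, ← ContinuousLinearMap.star_eq_adjoint,
    ← mul_apply_eq_comp, h]
  rfl

theorem hasDerivAt_of_zero (hU : IsUnitaryGroup U) {x v : E}
    (h : HasDerivAt (fun t => U t x) v 0) (t : ℝ) : HasDerivAt (fun t => U t x) (U t v) t := by
  have h1 : HasDerivAt (fun s => U (s - t) x) v t := by
    simpa [Function.comp_def] using
      HasDerivAt.scomp_of_eq t h ((hasDerivAt_id t).sub_const t) (by simp)
  have h2 := ((U t).restrictScalars ℝ).hasFDerivAt.comp_hasDerivAt t h1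
  refine h2.congr_of_eventuallyEq (Filter.Eventually.of_forall fun s => ?_)
  simp only [Function.comp_apply, ContinuousLinearMap.coe_restrictScalars']
  rw [← mul_apply_eq_comp, ← hU.add, add_sub_cancel]

/-- Since each `U t` is isometric, the derivatives converge uniformly in `t`. This passes
differentiability from a core to the closure. -/
theorem hasDerivAt_of_tendsto (hU : IsUnitaryGroup U) {u v : ℕ → E} {x y : E}
    (h : ∀ n t, HasDerivAt (fun t => U t (u n)) (U t (v n)) t)
    (hu : Filter.Tendsto u Filter.atTop (nhds x)) (hv : Filter.Tendsto v Filter.atTop (nhds y))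
    (t : ℝ) : HasDerivAt (fun t => U t x) (U t y) t := by
  refine hasDerivAt_of_tendstoUniformly (l := Filter.atTop) (f := fun n t => U t (u n))
    (f' := fun n t => U t (v n)) (g := fun t => U t x) (g' := fun t => U t y) ?_
    (Filter.Eventually.of_forall h) (fun s => ?_) t
  · rw [Metric.tendstoUniformly_iff]
    intro ε hε
    filter_upwards [(Metric.tendsto_nhds.mp hv) ε hε] with n hn s
    rwa [dist_eq_norm, ← map_sub, hU.norm_apply, ← dist_eq_norm, dist_comm]
  · exact ((U s).continuous.tendsto x).comp hu

/-- A unitary group is determined by its generator. -/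
theorem eq_of_generator (hU : IsUnitaryGroup U) (hV : IsUnitaryGroup V) {D : Set E} (hD : Dense D)
    (hdU : ∀ x ∈ D, ∃ v, HasDerivAt (fun t => U t x) v 0 ∧ HasDerivAt (fun t => V t x) v 0)
    (hinv : ∀ t, ∀ x ∈ D, U t x ∈ D) : U = V := by
  have key : ∀ x ∈ D, ∀ y ∈ D, ∀ t, ⟪V t x, U t y⟫_ℂ = ⟪x, y⟫_ℂ := by
    intro x hx y hy t
    obtain ⟨v, hvU, hvV⟩ := hdU x hx
    obtain ⟨w, hwU, hwV⟩ := hdU y hy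
    -- The overlap of the two orbits is constant. Only the orbits of `U` need to stay in `D`; for
    -- `V` its group property suffices.
    have hd : ∀ t, HasDerivAt (fun t => ⟪V t x, U t y⟫_ℂ) 0 t := by
      intro t
      have h1 := (hV.hasDerivAt_of_zero hvV t).inner ℂ (hU.hasDerivAt_of_zero hwU t)
      refine h1.congr_deriv ?_
      obtain ⟨z, hzU, hzV⟩ := hdU _ (hinv t y hy)
      have hz : z = U t w := by
        have h2 : HasDerivAt (fun s => U (s + t) y) z 0 := by
          refine hzU.congr_of_eventuallyEq (Filter.Eventually.of_forall fun s => ?_)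
          simp only [hU.add, mul_apply_eq_comp]
        have h3 : HasDerivAt (fun s => U (s + t) y) (U t w) 0 := by
          have h' : HasDerivAt (fun t => U t y) (U t w) (0 + t) := by
            rw [zero_add]
            exact hU.hasDerivAt_of_zero hwU t
          simpa [Function.comp_def] using h'.scomp 0 ((hasDerivAt_id (0 : ℝ)).add_const t)
        exact h2.unique h3
      -- Skew-symmetry of the generator of `V`: the same function is differentiated once with `V s`
      -- on the left and once with `V (-s)` on the right.
      have h4 : HasDerivAt (fun s => ⟪V s x, U t y⟫_ℂ) ⟪V t v, U t y⟫_ℂ t := by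
        have := (hV.hasDerivAt_of_zero hvV t).inner ℂ (hasDerivAt_const t (U t y))
        simpa using this
      have h5 : HasDerivAt (fun s => ⟪V s x, U t y⟫_ℂ) (-⟪V t x, z⟫_ℂ) t := by
        have h6 : HasDerivAt (fun s => V (-s) (U t y)) (-V (-t) z) t := by
          have := (hV.hasDerivAt_of_zero hzV (-t)).scomp t (hasDerivAt_neg t)
          simpa [Function.comp_def] using this
        have := (hasDerivAt_const t x).inner ℂ h6
        simp only [inner_neg_right, map_zero, inner_zero_left, add_zero,
            ← hV.inner_apply_left] at this
        exact this
      rw [h4.unique h5, ← hz]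
      ring
    have h0 := is_const_of_deriv_eq_zero (fun t => (hd t).differentiableAt)
      (fun t => (hd t).deriv) t 0
    simp only [hU.zero, hV.zero] at h0
    exact h0
  have key2 : ∀ x y t, ⟪V t x, U t y⟫_ℂ = ⟪x, y⟫_ℂ := by
    intro x y t
    have h1 : ∀ y ∈ D, ⟪V t x, U t y⟫_ℂ = ⟪x, y⟫_ℂ := fun y hy => by
      have := hD.induction (P := fun x => ⟪V t x, U t y⟫_ℂ = ⟪x, y⟫_ℂ) (fun x hx => key x hx y hy t)
        (isClosed_eq (by fun_prop) (by fun_prop))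
      exact this x
    exact hD.induction (P := fun y => ⟪V t x, U t y⟫_ℂ = ⟪x, y⟫_ℂ) h1
      (isClosed_eq (by fun_prop) (by fun_prop)) y
  funext t
  ext y
  have h : V (-t) (U t y) = y := by
    refine ext_inner_left ℂ fun x => ?_
    rw [← hV.inner_apply_left, key2]
  rw [← hV.apply_neg_apply t (U t y), h]

end IsUnitaryGroup

theorem norm_sub_le_of_hasDerivAt {F : Type*} [NormedAddCommGroup F] [NormedSpace ℝ F]
    {f f' : ℝ → F} (hf : ∀ s, HasDerivAt f (f' s) s) {K t : ℝ} (hK : ∀ s, |s| ≤ |t| → ‖f' s‖ ≤ K) :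
    ‖f t - f 0‖ ≤ K * |t| := by
  have := (convex_Icc (-|t|) |t|).norm_image_sub_le_of_norm_hasDerivWithin_le
    (fun s _ => (hf s).hasDerivWithinAt) (fun s hs => hK s (abs_le.mpr hs))
    (show (0 : ℝ) ∈ Set.Icc (-|t|) |t| by simp) (show t ∈ Set.Icc (-|t|) |t| from
      ⟨neg_abs_le t, le_abs_self t⟩)
  simpa using this

end UnitaryGroup

/-! ### The strong limit of the truncated groups -/

namespace EllTwo
variable {C : Type*} {num : C → ℕ} {A : fin num →ₗ[ℂ] fin num} {B : ℝ}

/-- Linear growth against cubic decay: `3 B' (k + 6) ≤ 6 B' (k + 3)` leaves two negative powers. -/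
theorem norm_sub_cut_apply_le' {T : fin num →ₗ[ℂ] fin num} {B' : ℝ} (hT : Banded T B') (k : ℕ)
    (φ : fin num) (hφ : (φ : EllTwo C) ∈ lev num (k + 4)) {W : ℝ}
    (hW : ‖cut num wt (k + 4) (φ : EllTwo C)‖ ≤ W) :
    ‖(T φ : EllTwo C) - cut num 1 (k + 4) (T φ : EllTwo C)‖ ≤ 6 * B' * W / ((k : ℝ) + 3) ^ 2 := by
  refine (norm_sub_cut_apply_le hT k φ hφ).trans ?_
  have hB := hT.nonneg
  have hW0 : 0 ≤ W := (norm_nonneg _).trans hW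
  have h1 : 3 * B' * (k + 6) * (1 / ((k : ℝ) + 3) ^ 3 * ‖cut num wt (k + 4) (φ : EllTwo C)‖) ≤
      3 * B' * (2 * (k + 3)) * (1 / ((k : ℝ) + 3) ^ 3 * W) := by
    gcongr
    linarith
  refine h1.trans (le_of_eq ?_)
  field_simp
  ring

/-- Duhamel: the function `flow_l(-s) flow_k(s) ψ` changes only through the difference of the two
truncations on `flow_k(s) ψ`, that is, through what `A` sends beyond level `k + 4`. This is small by
the propagated cubic weight. -/
theorem norm_flow_sub_le (hA : Banded A B) (hs : Symm A) {m₀ k l : ℕ} {ψ : EllTwo C}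
    (hψ : ψ ∈ lev num m₀) (hk : m₀ ≤ k + 4) (hkl : k ≤ l) (t : ℝ) :
    ‖flow A (l + 4) t ψ - flow A (k + 4) t ψ‖ ≤
      6 * B * (‖cut num wt m₀ ψ‖ * Real.exp (72 * B * |t|)) / ((k : ℝ) + 3) ^ 2 * |t| := by
  have hB := hA.nonneg
  set f : ℝ → EllTwo C := fun s => flow A (l + 4) (-s) (flow A (k + 4) s ψ) with hf
  have hd : ∀ s, HasDerivAt f (flow A (l + 4) (-s) (Complex.I •
      (trunc A (k + 4) (flow A (k + 4) s ψ) - trunc A (l + 4) (flow A (k + 4) s ψ)))) s := by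
    intro s
    have h1 := (hasDerivAt_oneParam_neg (trunc A (l + 4)) s).mul
      (hasDerivAt_oneParam (trunc A (k + 4)) s)
    have h3 := ((ContinuousLinearMap.apply ℂ (EllTwo C) ψ).restrictScalars ℝ).hasFDerivAt.comp_hasDerivAt s h1
    refine h3.congr_deriv ?_
    have hc : Commute (trunc A (k + 4)) (oneParam (trunc A (k + 4)) s) :=
      commute_oneParam (Commute.refl _) _
    have hc' : Commute (trunc A (l + 4)) (oneParam (trunc A (l + 4)) (-s)) :=
      commute_oneParam (Commute.refl _) _
    rw [smul_mul_assoc, mul_smul_comm, hc'.eq, ← hc.eq]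
    simp [flow, smul_sub]
    abel
  have h := norm_sub_le_of_hasDerivAt hd (t := t)
    (K := 6 * B * (‖cut num wt m₀ ψ‖ * Real.exp (72 * B * |t|)) / ((k : ℝ) + 3) ^ 2)
    (fun s hs' => by
      have hmem := flow_mem_lev hA (k + 4) s (lev_mono hk hψ)
      set φ : fin num := ⟨flow A (k + 4) s ψ, k + 4, hmem⟩
      have e1 : trunc A (k + 4) (flow A (k + 4) s ψ) = cut num 1 (k + 4) (A φ : EllTwo C) :=
        trunc_apply_of_mem hA φ hmem
      have e2 : trunc A (l + 4) (flow A (k + 4) s ψ) = cut num 1 (l + 4) (A φ : EllTwo C) :=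
        trunc_apply_of_mem hA φ (lev_mono (by omega) hmem)
      have e3 : cut num 1 (k + 4) (A φ : EllTwo C) - cut num 1 (l + 4) (A φ : EllTwo C) =
          -cut num 1 (l + 4) ((A φ : EllTwo C) - cut num 1 (k + 4) (A φ : EllTwo C)) := by
        rw [map_sub, cut_one_of_mem (m := l + 4) (lev_mono (by omega)
          (cut_mem_lev 1 (k + 4) (A φ : EllTwo C)))]
        abel
      rw [norm_flow hA hs, norm_smul, Complex.norm_I, one_mul, e1, e2, e3, norm_neg]
      refine (norm_cut_one_le _ _).trans (norm_sub_cut_apply_le' hA k φ hmem ?_)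
      refine (norm_cut_wt_flow_le hA hs _ _ _).trans ?_
      rw [cut_wt_of_mem hψ hk]
      gcongr)
  rw [← norm_flow hA hs (l + 4) (-t), map_sub, ← norm_neg]
  refine le_trans (le_of_eq ?_) h
  congr 1
  simp only [hf, flow, neg_zero, oneParam_zero]
  rw [← mul_apply_eq_comp (oneParam _ (-t)) (oneParam (trunc A (l + 4)) t), oneParam_neg_mul]
  simp

/-- `U t` is the strong limit of the truncated groups, uniformly for bounded `t`. -/
def IsFlowLimit (A : fin num →ₗ[ℂ] fin num) (U : ℝ → EllTwo C →L[ℂ] EllTwo C) : Prop :=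
  ∀ (R : ℝ) (x : EllTwo C), TendstoUniformlyOn (fun k t => flow A (k + 4) t x)
    (fun t => U t x) Filter.atTop (Set.Icc (-R) R)

/-- On vectors of bounded level the Duhamel bound is uniform for bounded `t`; density and the
isometry of the truncated groups extend the convergence to every vector. -/
theorem uniformCauchySeqOn_flow (hA : Banded A B) (hs : Symm A) (R : ℝ) (x : EllTwo C) :
    UniformCauchySeqOn (fun k t => flow A (k + 4) t x) Filter.atTop (Set.Icc (-R) R) := by
  rw [Metric.uniformCauchySeqOn_iff]
  intro ε hε
  obtain ⟨ψ, ⟨m₀, hψ⟩, hxψ⟩ := Metric.mem_closure_iff.mp (dense_fin (num := num) x) (ε / 6)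
    (by positivity)
  have hB := hA.nonneg
  set c := 6 * B * (‖cut num wt m₀ ψ‖ * Real.exp (72 * B * |R|)) * |R|
  obtain ⟨N₀, hN₀⟩ := exists_nat_gt (c / (ε / 6))
  set N := max N₀ m₀
  have hN : c / (ε / 6) < N := hN₀.trans_le (by exact_mod_cast le_max_left _ _)
  have key : ∀ n ≥ N, ∀ t ∈ Set.Icc (-R) R, ‖flow A (n + 4) t x - flow A (N + 4) t x‖ < ε / 2 := by
    intro n hn t ht
    have htR : |t| ≤ |R| := (abs_le.mpr ht).trans (le_abs_self R)
    have h1 := norm_flow_sub_le hA hs hψ (k := N) (l := n)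
      (by have := le_max_right N₀ m₀; omega) hn t
    have h2 : 6 * B * (‖cut num wt m₀ ψ‖ * Real.exp (72 * B * |t|)) / ((N : ℝ) + 3) ^ 2 * |t| <
        ε / 6 := by
      calc _ ≤ 6 * B * (‖cut num wt m₀ ψ‖ * Real.exp (72 * B * |R|)) / ((N : ℝ) + 3) ^ 2 * |R| := by
            gcongr
        _ = c / ((N : ℝ) + 3) ^ 2 := by
            simp only [c]
            ring
        _ < ε / 6 := by
            rw [div_lt_iff₀ (by positivity)] at hN ⊢
            have hN0 : (N : ℝ) ≤ (N + 3) ^ 2 := by nlinarith [(N.cast_nonneg : (0 : ℝ) ≤ N)]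
            rw [mul_comm]
            exact hN.trans_le (by gcongr)
    have h3 : flow A (n + 4) t x - flow A (N + 4) t x =
        flow A (n + 4) t (x - ψ) + (flow A (n + 4) t ψ - flow A (N + 4) t ψ) -
          flow A (N + 4) t (x - ψ) := by
      simp only [map_sub]
      abel
    rw [h3]
    have h4 := norm_sub_le (flow A (n + 4) t (x - ψ) + (flow A (n + 4) t ψ - flow A (N + 4) t ψ))
      (flow A (N + 4) t (x - ψ))
    have h5 := norm_add_le (flow A (n + 4) t (x - ψ)) (flow A (n + 4) t ψ - flow A (N + 4) t ψ)
    rw [norm_flow hA hs] at h4 h5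
    rw [dist_eq_norm] at hxψ
    linarith
  refine ⟨N, fun m hm n hn t ht => ?_⟩
  rw [dist_eq_norm]
  have h1 := key m hm t ht
  have h2 := key n hn t ht
  have h3 := norm_sub_le (flow A (m + 4) t x - flow A (N + 4) t x)
    (flow A (n + 4) t x - flow A (N + 4) t x)
  rw [sub_sub_sub_cancel_right] at h3
  linarith

theorem exists_isFlowLimit (hA : Banded A B) (hs : Symm A) : ∃ U, IsFlowLimit A U := by
  have h : ∀ (t : ℝ) (x : EllTwo C), ∃ y,
      Filter.Tendsto (fun k => flow A (k + 4) t x) Filter.atTop (nhds y) := by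
    intro t x
    refine cauchySeq_tendsto_of_complete
      ((uniformCauchySeqOn_flow hA hs |t| x).cauchySeq ?_)
    exact ⟨neg_abs_le t, le_abs_self t⟩
  choose u hu using h
  refine ⟨fun t => continuousLinearMapOfTendsto (fun k => flow A (k + 4) t)
    (tendsto_pi_nhds.mpr (hu t)), fun R x => ?_⟩
  exact (uniformCauchySeqOn_flow hA hs R x).tendstoUniformlyOn_of_tendsto fun t _ => hu t x

namespace IsFlowLimit

variable {U : ℝ → EllTwo C →L[ℂ] EllTwo C}

theorem tendsto (hU : IsFlowLimit A U) (t : ℝ) (x : EllTwo C) :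
    Filter.Tendsto (fun k => flow A (k + 4) t x) Filter.atTop (nhds (U t x)) :=
  (hU |t| x).tendsto_at ⟨neg_abs_le t, le_abs_self t⟩

theorem tendsto_apply (hA : Banded A B) (hs : Symm A) (hU : IsFlowLimit A U) (t : ℝ)
    {y : ℕ → EllTwo C} {x : EllTwo C} (hy : Filter.Tendsto y Filter.atTop (nhds x)) :
    Filter.Tendsto (fun k => flow A (k + 4) t (y k)) Filter.atTop (nhds (U t x)) := by
  have h1 : Filter.Tendsto (fun k => flow A (k + 4) t (y k - x)) Filter.atTop (nhds 0) := by
    rw [tendsto_zero_iff_norm_tendsto_zero]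
    simp only [norm_flow hA hs]
    exact (tendsto_iff_norm_sub_tendsto_zero.mp hy)
  have := h1.add (hU.tendsto t x)
  simpa using this

theorem isUnitaryGroup (hA : Banded A B) (hs : Symm A) (hU : IsFlowLimit A U) :
    IsUnitaryGroup U := by
  have hz : U 0 = 1 := by
    ext x : 1
    refine tendsto_nhds_unique (hU.tendsto 0 x) ?_
    simp [flow, oneParam_zero]
  have hadd : ∀ s t, U (s + t) = U s * U t := by
    intro s t
    ext x : 1
    refine tendsto_nhds_unique (hU.tendsto (s + t) x) ?_
    have := hU.tendsto_apply hA hs s (hU.tendsto t x)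
    refine this.congr fun k => ?_
    rw [flow, flow, flow, oneParam_add]
    rfl
  have hadj : ∀ t, ContinuousLinearMap.adjoint (U t) = U (-t) := by
    intro t
    symm
    rw [ContinuousLinearMap.eq_adjoint_iff]
    intro x y
    refine tendsto_nhds_unique ((hU.tendsto (-t) x).inner (tendsto_const_nhds (x := y))) ?_
    refine ((tendsto_const_nhds (x := x)).inner (hU.tendsto t y)).congr fun k => ?_
    rw [flow, flow, ← adjoint_oneParam (adjoint_trunc hA hs _),
      ContinuousLinearMap.adjoint_inner_left]
  refine ⟨fun t => ?_, hz, hadd, fun x => ?_⟩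
  · rw [Unitary.mem_iff, ContinuousLinearMap.star_eq_adjoint, hadj, ← hadd, ← hadd]
    simp [hz]
  · rw [continuous_iff_continuousAt]
    intro t
    have h1 : ContinuousOn (fun t => U t x) (Set.Icc (-(|t| + 1)) (|t| + 1)) :=
      (hU (|t| + 1) x).continuousOn (Filter.Frequently.of_forall fun k =>
        ((continuous_oneParam _).clm_apply continuous_const).continuousOn)
    refine h1.continuousAt (Icc_mem_nhds ?_ ?_)
    · linarith [neg_abs_le t]
    · linarith [le_abs_self t]

/-- For large `k` the truncation acts on `ψ` exactly as `A`, so the derivatives of the truncated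
orbits are truncated orbits of `i A ψ` and converge uniformly on bounded intervals. -/
theorem hasDerivAt (hA : Banded A B) (hU : IsFlowLimit A U) (ψ : fin num)
    (t : ℝ) : HasDerivAt (fun t => U t ψ) (U t (Complex.I • (A ψ : EllTwo C))) t := by
  obtain ⟨m₀, hψ⟩ := ψ.2
  refine hasDerivAt_of_tendstoLocallyUniformlyOn (l := Filter.atTop)
    (s := Set.Ioo (-(|t| + 1)) (|t| + 1)) (f := fun k t => flow A (k + 4) t ψ)
    (f' := fun k t => flow A (k + 4) t (Complex.I • (A ψ : EllTwo C))) isOpen_Ioo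
    ((hU (|t| + 1) _).mono Set.Ioo_subset_Icc_self).tendstoLocallyUniformlyOn ?_
    (fun s _ => hU.tendsto s _) ⟨by linarith [neg_abs_le t], by linarith [le_abs_self t]⟩
  filter_upwards [Filter.eventually_ge_atTop m₀] with k hk s _
  have h1 := hasDerivAt_oneParam (trunc A (k + 4)) s
  have h3 := ((ContinuousLinearMap.apply ℂ (EllTwo C) (ψ : EllTwo C)).restrictScalars
    ℝ).hasFDerivAt.comp_hasDerivAt s h1
  refine h3.congr_deriv ?_
  simp [flow, trunc_apply_eq hA ψ hψ (show m₀ + 2 ≤ k + 4 by omega)]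

end IsFlowLimit
end EllTwo
end

/-! ### The Heisenberg equation and the closed generator -/

noncomputable section
namespace EllTwo
variable {C : Type*} {num : C → ℕ} {A : fin num →ₗ[ℂ] fin num} {B : ℝ}

theorem Banded.mono {T : fin num →ₗ[ℂ] fin num} {B' : ℝ} (hT : Banded T B) (h : B ≤ B') :
    Banded T B' where
  nonneg := hT.nonneg.trans h
  band := hT.band
  bound n ψ hψ := (hT.bound n ψ hψ).trans (by gcongr)

theorem Banded.smul {T : fin num →ₗ[ℂ] fin num} (hT : Banded T B) (z : ℂ) :
    Banded (z • T) (B * ‖z‖) where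
  nonneg := mul_nonneg hT.nonneg (norm_nonneg z)
  band n ψ hψ c hc := hT.band n ψ hψ c fun h => hc (by
    rw [LinearMap.smul_apply, Submodule.coe_smul, lp.coeFn_smul, Pi.smul_apply, h, smul_zero])
  bound n ψ hψ := by
    rw [LinearMap.smul_apply, norm_smul]
    calc ‖z‖ * ‖T ψ‖ ≤ ‖z‖ * (B * (n + 2) * ‖ψ‖) := by gcongr; exact hT.bound n ψ hψ
      _ = _ := by ring

/-- The closure of the graph of `T`. -/
def clGraph (T : fin num →ₗ[ℂ] fin num) : Submodule ℂ (EllTwo C × EllTwo C) :=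
  (LinearMap.range ((fin num).subtype.prod ((fin num).subtype ∘ₗ T))).topologicalClosure

theorem mem_clGraph_of_tendsto {T : fin num →ₗ[ℂ] fin num} {ψ : ℕ → fin num} {x y : EllTwo C}
    (h₁ : Filter.Tendsto (fun k => (ψ k : EllTwo C)) Filter.atTop (nhds x))
    (h₂ : Filter.Tendsto (fun k => (T (ψ k) : EllTwo C)) Filter.atTop (nhds y)) :
    (x, y) ∈ clGraph T :=
  mem_closure_of_tendsto (h₁.prodMk_nhds h₂) (Filter.Eventually.of_forall fun k => ⟨ψ k, rfl⟩)

theorem exists_tendsto_of_mem_clGraph {T : fin num →ₗ[ℂ] fin num} {x y : EllTwo C}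
    (h : (x, y) ∈ clGraph T) : ∃ ψ : ℕ → fin num,
      Filter.Tendsto (fun k => (ψ k : EllTwo C)) Filter.atTop (nhds x) ∧
      Filter.Tendsto (fun k => (T (ψ k) : EllTwo C)) Filter.atTop (nhds y) := by
  obtain ⟨u, hu, hlim⟩ := mem_closure_iff_seq_limit.mp h
  choose ψ hψ using hu
  have e : u = fun k => ((ψ k : EllTwo C), (T (ψ k) : EllTwo C)) := funext fun k => (hψ k).symm
  rw [e] at hlim
  exact ⟨ψ, hlim.fst_nhds, hlim.snd_nhds⟩

section Family

variable {V : Type*} [NormedAddCommGroup V] [NormedSpace ℂ V]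
  {T : V →ₗ[ℂ] (fin num →ₗ[ℂ] fin num)} {K : ℝ}

/-- The truncations of a family of operators, as a bounded linear map. -/
def truncFamily (hT : ∀ v, Banded (T v) (K * ‖v‖)) (m : ℕ) : V →L[ℂ] EllTwo C →L[ℂ] EllTwo C :=
  LinearMap.mkContinuous
    { toFun := fun v => trunc (T v) m
      map_add' := fun v w => by
        ext1 ψ
        rw [add_apply, trunc_apply (hT _), trunc_apply (hT _),
          trunc_apply (hT _), map_add, LinearMap.add_apply, Submodule.coe_add, map_add]
      map_smul' := fun a v => by
        ext1 ψ
        rw [RingHom.id_apply, smul_apply, trunc_apply (hT _),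
          trunc_apply (hT _), map_smul, LinearMap.smul_apply, Submodule.coe_smul, map_smul] }
    (3 * K * (m + 2)) fun v => (norm_trunc_le (hT v) m).trans (le_of_eq (by ring))

theorem truncFamily_apply (hT : ∀ v, Banded (T v) (K * ‖v‖)) (m : ℕ) (v : V) :
    truncFamily hT m v = trunc (T v) m := rfl

/-- Truncation destroys the commutation relation only by dropping the part of the inner product of
operators beyond level `k + 4`. That part is `O(k⁻²)`, and the outer operator costs one more power
of `k`. This second loss is why the weight is cubic: a quadratic one would leave no decay. -/
theorem commutator_trunc_le (hA : Banded A B) {S D : fin num →ₗ[ℂ] fin num} {B' B'' : ℝ}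
    (hS : Banded S B') (hD : Banded D B'')
    (hcomm : ∀ ψ, D ψ = Complex.I • (A (S ψ) - S (A ψ))) (k : ℕ) (φ : fin num)
    (hφ : (φ : EllTwo C) ∈ lev num (k + 4)) {W : ℝ}
    (hW : ‖cut num wt (k + 4) (φ : EllTwo C)‖ ≤ W) :
    ‖Complex.I • (trunc A (k + 4) (trunc S (k + 4) (φ : EllTwo C)) -
      trunc S (k + 4) (trunc A (k + 4) (φ : EllTwo C))) - trunc D (k + 4) (φ : EllTwo C)‖ ≤
      108 * B * B' * W / ((k : ℝ) + 3) := by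
  have h1 : ∀ {R : fin num →ₗ[ℂ] fin num} {b : ℝ} (hR : Banded R b),
      trunc R (k + 4) (φ : EllTwo C) = (cutFin num 1 (k + 4) (R φ : EllTwo C) : EllTwo C) :=
    fun hR => trunc_apply_of_mem hR φ hφ
  have h2 : ∀ {R : fin num →ₗ[ℂ] fin num} {b : ℝ} (hR : Banded R b) (χ : EllTwo C),
      trunc R (k + 4) (cutFin num 1 (k + 4) χ : EllTwo C) =
        cut num 1 (k + 4) (R (cutFin num 1 (k + 4) χ) : EllTwo C) :=
    fun hR χ => trunc_apply_of_mem hR _ (cut_mem_lev _ _ _)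
  have h3 : ∀ {R R' : fin num →ₗ[ℂ] fin num} {b b' : ℝ} (_ : Banded R b) (_ : Banded R' b'),
      ‖(R (cutFin num 1 (k + 4) (R' φ : EllTwo C) - R' φ) : EllTwo C)‖ ≤
        54 * b * b' * W / ((k : ℝ) + 3) := by
    intro R R' b b' hR hR'
    have hb := hR.nonneg
    have hb' := hR'.nonneg
    have hW0 : 0 ≤ W := (norm_nonneg _).trans hW
    have hmem : ((cutFin num 1 (k + 4) (R' φ : EllTwo C) - R' φ : fin num) : EllTwo C) ∈
        lev num (k + 4 + 2) :=
      Submodule.sub_mem _ (lev_mono (by omega) (cut_mem_lev _ _ _)) (hR'.mem_lev φ hφ)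
    refine (hR.norm_le _ hmem).trans ?_
    have h4 := norm_sub_cut_apply_le' hR' k φ hφ hW
    have h5 : ‖cutFin num 1 (k + 4) (R' φ : EllTwo C) - R' φ‖ ≤
        6 * b' * W / ((k : ℝ) + 3) ^ 2 := by
      rw [norm_sub_rev]
      exact h4
    -- The vector has level `k + 6`, so the outer operator has norm at most `3 b (k + 8)`. The
    -- constant is `54 = 3 · 3 · 6`, and the two orders of the product give `108`.
    calc _ ≤ 3 * b * (3 * (k + 3)) * (6 * b' * W / ((k : ℝ) + 3) ^ 2) := by
          gcongr
          push_cast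
          linarith
      _ = _ := by
          field_simp
          ring
  have e : Complex.I • (trunc A (k + 4) (trunc S (k + 4) (φ : EllTwo C)) -
      trunc S (k + 4) (trunc A (k + 4) (φ : EllTwo C))) - trunc D (k + 4) (φ : EllTwo C) =
      cut num 1 (k + 4) (Complex.I •
        ((A (cutFin num 1 (k + 4) (S φ : EllTwo C) - S φ) : EllTwo C) -
        (S (cutFin num 1 (k + 4) (A φ : EllTwo C) - A φ) : EllTwo C))) := by
    rw [h1 hS, h1 hA, h2 hA, h2 hS, h1 hD, hcomm, coe_cutFin, map_sub A, map_sub S]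
    simp only [Submodule.coe_smul, Submodule.coe_sub, map_smul, map_sub, ← smul_sub]
    congr 1
    abel
  rw [e]
  refine (norm_cut_one_le _ _).trans ?_
  rw [norm_smul, Complex.norm_I, one_mul]
  refine (norm_sub_le _ _).trans ((add_le_add (h3 hA hS) (h3 hS hA)).trans (le_of_eq ?_))
  ring

/-- If `T (y s)` solves the Heisenberg equation for `A`, then it is implemented by the unitary
group generated by `A`. -/
theorem IsFlowLimit.mem_clGraph {U : ℝ → EllTwo C →L[ℂ] EllTwo C} (hA : Banded A B) (hs : Symm A)
    (hU : IsFlowLimit A U) (hT : ∀ v, Banded (T v) (K * ‖v‖)) (hK : 0 ≤ K) {y y' : ℝ → V}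
    (hy : ∀ s, HasDerivAt y (y' s) s)
    (hcomm : ∀ s ψ, T (y' s) ψ = Complex.I • (A (T (y s) ψ) - T (y s) (A ψ))) (t : ℝ)
    (ψ : fin num) : (U (-t) ψ, U (-t) (T (y t) ψ : EllTwo C)) ∈ clGraph (T (y 0)) := by
  obtain ⟨m₀, hψ⟩ := ψ.2
  -- The curve is evaluated at `t - s` with `|s| ≤ |t|`.
  obtain ⟨M, hM⟩ : ∃ M, ∀ s ∈ Set.Icc (-(2 * |t|)) (2 * |t|), ‖y s‖ ≤ M :=
    isCompact_Icc.exists_bound_of_continuousOn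
      fun s _ => (hy s).continuousAt.continuousWithinAt
  have hM0 : 0 ≤ M := (norm_nonneg _).trans (hM 0 (by simp))
  have hTs : ∀ s, |s| ≤ |t| → Banded (T (y (t - s))) (K * M) := fun s hs' =>
    (hT _).mono (mul_le_mul_of_nonneg_left (hM _ (abs_le.mp (by
      have := abs_sub t s
      linarith))) hK)
  set W := ‖cut num wt m₀ (ψ : EllTwo C)‖ * Real.exp (72 * B * |t|)
  have hB := hA.nonneg
  have hW : ∀ k, m₀ ≤ k + 4 → ∀ s, |s| ≤ |t| →
      ‖cut num wt (k + 4) (flow A (k + 4) (-s) ψ)‖ ≤ W := by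
    intro k hk s hs'
    refine (norm_cut_wt_flow_le hA hs _ _ _).trans ?_
    rw [cut_wt_of_mem hψ hk, abs_neg]
    change _ ≤ ‖cut num wt m₀ (ψ : EllTwo C)‖ * Real.exp (72 * B * |t|)
    gcongr
  -- An interpolation from `T (y t) ψ` at `s = 0` to `e^{itA} T (y 0) e^{-itA} ψ` at `s = t`,
  -- everything truncated. Its derivative is the failure of the Heisenberg equation for the
  -- truncations, which is `O(1/k)`.
  set F : ℕ → ℝ → EllTwo C := fun k s => flow A (k + 4) s
    (trunc (T (y (t - s))) (k + 4) (flow A (k + 4) (-s) ψ)) with hF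
  have hFd : ∀ k s, HasDerivAt (F k) (flow A (k + 4) s
      (Complex.I • (trunc A (k + 4) (trunc (T (y (t - s))) (k + 4) (flow A (k + 4) (-s) ψ)) -
        trunc (T (y (t - s))) (k + 4) (trunc A (k + 4) (flow A (k + 4) (-s) ψ))) -
        trunc (T (y' (t - s))) (k + 4) (flow A (k + 4) (-s) ψ))) s := by
    intro k s
    have h0 : HasDerivAt (fun s => y (t - s)) (-y' (t - s)) s := by
      have := (hy (t - s)).scomp_of_eq s ((hasDerivAt_id s).const_sub t) rfl
      simpa [Function.comp_def] using this
    have h1 := ((truncFamily hT (k + 4)).restrictScalars ℝ).hasFDerivAt.comp_hasDerivAt s h0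
    rw [map_neg] at h1
    have h2 := ((hasDerivAt_oneParam (trunc A (k + 4)) s).mul h1).mul
      (hasDerivAt_oneParam_neg (trunc A (k + 4)) s)
    have h3 := ((ContinuousLinearMap.apply ℂ (EllTwo C) (ψ : EllTwo C)).restrictScalars
      ℝ).hasFDerivAt.comp_hasDerivAt s h2
    refine h3.congr_deriv ?_
    simp [flow, smul_sub, truncFamily_apply]
    abel
  have hFsub : ∀ k, m₀ ≤ k + 4 → ‖F k t - F k 0‖ ≤
      108 * B * (K * M) * W / ((k : ℝ) + 3) * |t| := by
    intro k hk
    refine norm_sub_le_of_hasDerivAt (hFd k) fun s hs' => ?_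
    rw [norm_flow hA hs]
    exact commutator_trunc_le hA (hTs s hs') (hT (y' (t - s))) (hcomm (t - s)) k
      ⟨_, k + 4, flow_mem_lev hA (k + 4) (-s) (lev_mono hk hψ)⟩
      (flow_mem_lev hA (k + 4) (-s) (lev_mono hk hψ)) (hW k hk s hs')
  have hk3 : Filter.Tendsto (fun k : ℕ => (k : ℝ) + 3) Filter.atTop Filter.atTop :=
    Filter.tendsto_atTop_add_const_right _ _ tendsto_natCast_atTop_atTop
  have hFlim : Filter.Tendsto (fun k => F k t) Filter.atTop
      (nhds (T (y t) ψ : EllTwo C)) := by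
    rw [tendsto_iff_norm_sub_tendsto_zero]
    have hz : Filter.Tendsto (fun k : ℕ => 108 * B * (K * M) * W / ((k : ℝ) + 3) * |t|)
        Filter.atTop (nhds 0) := by
      simpa using (hk3.const_div_atTop (108 * B * (K * M) * W)).mul_const |t|
    refine squeeze_zero' (Filter.Eventually.of_forall fun _ => norm_nonneg _) ?_ hz
    filter_upwards [Filter.eventually_ge_atTop m₀] with k hk
    have h0 : F k 0 = T (y t) ψ := by
      simp only [hF, flow, neg_zero, oneParam_zero, sub_zero, one_apply_eq_self]
      exact trunc_apply_eq (hT _) ψ hψ (by omega)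
    rw [← h0]
    exact hFsub k (by omega)
  have hφ : ∀ k, m₀ ≤ k → (cutFin num 1 (k + 4) (flow A (k + 4) (-t) ψ) : EllTwo C) =
      flow A (k + 4) (-t) ψ := fun k hk =>
    cut_one_of_mem (flow_mem_lev hA (k + 4) (-t) (lev_mono (by omega) hψ))
  -- The truncated orbits stay in a level, so for large `k` they are admissible arguments of `T (y
  -- 0)`; they and their images converge. The cut only makes the sequence well-typed for small `k`.
  refine mem_clGraph_of_tendsto (ψ := fun k => cutFin num 1 (k + 4) (flow A (k + 4) (-t) ψ)) ?_ ?_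
  · refine (hU.tendsto (-t) ψ).congr' ?_
    filter_upwards [Filter.eventually_ge_atTop m₀] with k hk
    exact (hφ k hk).symm
  · have h1 := hU.tendsto_apply hA hs (-t) hFlim
    have hz : Filter.Tendsto (fun k : ℕ => 6 * (K * M) * W / ((k : ℝ) + 3) ^ 2)
        Filter.atTop (nhds 0) :=
      ((Filter.tendsto_pow_atTop two_ne_zero).comp hk3).const_div_atTop _
    refine tendsto_of_tendsto_of_dist h1 (squeeze_zero' (Filter.Eventually.of_forall
      fun _ => dist_nonneg) ?_ hz)
    filter_upwards [Filter.eventually_ge_atTop m₀] with k hk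
    have hmem := flow_mem_lev hA (k + 4) (-t) (lev_mono (by omega : m₀ ≤ k + 4) hψ)
    have hT0 : Banded (T (y 0)) (K * M) := by simpa using hTs t le_rfl
    have h2 := norm_sub_cut_apply_le' hT0 k ⟨_, k + 4, hmem⟩ hmem (hW k (by omega) t le_rfl)
    have e : cutFin num 1 (k + 4) (flow A (k + 4) (-t) ψ) = ⟨_, k + 4, hmem⟩ :=
      Subtype.ext (hφ k hk)
    have e2 : flow A (k + 4) (-t) (F k t) = trunc (T (y 0)) (k + 4) (flow A (k + 4) (-t) ψ) := by
      simp only [hF, flow, sub_self]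
      rw [← mul_apply_eq_comp (oneParam _ (-t)), oneParam_neg_mul, one_apply_eq_self]
    rw [dist_comm, dist_eq_norm, e, e2]
    have e3 : trunc (T (y 0)) (k + 4) (flow A (k + 4) (-t) ψ) =
      cut num 1 (k + 4) (T (y 0) ⟨_, k + 4, hmem⟩ : EllTwo C) :=
        trunc_apply_of_mem hT0 ⟨_, k + 4, hmem⟩ hmem
    rw [e3]
    exact h2

end Family

theorem IsFlowLimit.hasDerivAt_of_mem {U : ℝ → EllTwo C →L[ℂ] EllTwo C} (hA : Banded A B)
    (hs : Symm A) (hU : IsFlowLimit A U) {x y : EllTwo C} (h : (x, y) ∈ clGraph A) (t : ℝ) :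
    HasDerivAt (fun t => U t x) (U t (Complex.I • y)) t := by
  obtain ⟨ψ, h₁, h₂⟩ := exists_tendsto_of_mem_clGraph h
  exact (hU.isUnitaryGroup hA hs).hasDerivAt_of_tendsto (fun n t => hU.hasDerivAt hA (ψ n) t) h₁
    (h₂.const_smul Complex.I) t

theorem isClosed_clGraph (T : fin num →ₗ[ℂ] fin num) :
    IsClosed (clGraph T : Set (EllTwo C × EllTwo C)) := Submodule.isClosed_topologicalClosure _

/-- The generator of the group is the closure of `A`. -/
theorem IsFlowLimit.mem_clGraph_iff {U : ℝ → EllTwo C →L[ℂ] EllTwo C} (hA : Banded A B)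
    (hs : Symm A) (hU : IsFlowLimit A U) (x y : EllTwo C) :
    (x, y) ∈ clGraph A ↔ HasDerivAt (fun t => U t x) (Complex.I • y) 0 := by
  have hG := hU.isUnitaryGroup hA hs
  constructor
  · intro h
    simpa [hG.zero] using hU.hasDerivAt_of_mem hA hs h 0
  intro h
  -- `A` commutes with itself, so it is a constant solution of its own Heisenberg equation.
  have hinv : ∀ (t : ℝ) (ψ : fin num), (U t ψ, U t (A ψ : EllTwo C)) ∈ clGraph A := by
    intro t ψ
    have := hU.mem_clGraph hA hs (T := LinearMap.toSpanSingleton ℂ _ A) (K := B)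
      (fun v => hA.smul v) hA.nonneg (y := fun _ => 1) (y' := fun _ => 0)
      (fun s => hasDerivAt_const s 1) (fun s ψ => by simp) (-t) ψ
    simpa using this
  have hcl : IsClosed (clGraph A : Set (EllTwo C × EllTwo C)) := isClosed_clGraph A
  -- Modulo the closed graph, `[(0, A φ)] = -[(φ, 0)]`. Hence `[(0, U t ψ)]` has the derivative `-i
  -- [(U t ψ, 0)]`, which no longer mentions `A ψ` and so makes sense for every vector.
  set π : EllTwo C × EllTwo C →L[ℂ] (EllTwo C × EllTwo C) ⧸ clGraph A := (clGraph A).mkQL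
  set ℓ₁ := π ∘L ContinuousLinearMap.inl ℂ (EllTwo C) (EllTwo C)
  set ℓ₂ := π ∘L ContinuousLinearMap.inr ℂ (EllTwo C) (EllTwo C)
  have hπ : ∀ u v, ℓ₁ u + ℓ₂ v = π (u, v) := fun u v => by
    simp only [ℓ₁, ℓ₂, ContinuousLinearMap.comp_apply, ← map_add]
    simp
  obtain ⟨ψ, hψ, hlim⟩ := mem_closure_iff_seq_limit.mp (dense_fin (num := num) x)
  set χ : ℕ → fin num := fun n => ⟨ψ n, hψ n⟩
  have hd1 : ∀ n t, HasDerivAt (fun t => ℓ₂ (U t (ψ n))) (-(Complex.I • ℓ₁ (U t (ψ n)))) t := by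
    intro n t
    have h1 := (ℓ₂.restrictScalars ℝ).hasFDerivAt.comp_hasDerivAt t (hU.hasDerivAt hA (χ n) t)
    refine h1.congr_deriv ?_
    have h2 : ℓ₁ (U t (ψ n)) + ℓ₂ (U t (A (χ n) : EllTwo C)) = 0 := by
      rw [hπ]
      exact (Submodule.Quotient.mk_eq_zero _).mpr (hinv t (χ n))
    rw [eq_neg_of_add_eq_zero_left h2]
    simp
  -- The formula extends from bounded levels to all `x` by density. If `x` has the derivative `i y`,
  -- comparing the two derivatives gives `[(x, y)] = 0`.
  have hd2 : HasDerivAt (fun t => ℓ₂ (U t x)) (-(Complex.I • ℓ₁ (U 0 x))) 0 := by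
    refine hasDerivAt_of_tendstoUniformly (l := Filter.atTop) (f := fun n t => ℓ₂ (U t (ψ n)))
      (f' := fun n t => -(Complex.I • ℓ₁ (U t (ψ n)))) (g := fun t => ℓ₂ (U t x))
      (g' := fun t => -(Complex.I • ℓ₁ (U t x))) ?_ (Filter.Eventually.of_forall hd1)
      (fun s => ((ℓ₂ ∘L U s).continuous.tendsto x).comp hlim) 0
    rw [Metric.tendstoUniformly_iff]
    intro ε hε
    have hz : Filter.Tendsto (fun n => ‖ℓ₁‖ * ‖x - ψ n‖) Filter.atTop (nhds 0) := by
      have := (tendsto_const_nhds (x := x)).sub hlim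
      simpa using this.norm.const_mul ‖ℓ₁‖
    filter_upwards [(tendsto_order.mp hz).2 ε hε] with n hn t
    rw [dist_neg_neg, dist_eq_norm, ← smul_sub, ← map_sub, ← map_sub, norm_smul, Complex.norm_I,
      one_mul]
    refine (ℓ₁.le_opNorm _).trans_lt ?_
    rwa [hG.norm_apply]
  have hd3 : HasDerivAt (fun t => ℓ₂ (U t x)) (ℓ₂ (Complex.I • y)) 0 :=
    (ℓ₂.restrictScalars ℝ).hasFDerivAt.comp_hasDerivAt 0 h
  have h4 := hd2.unique hd3
  rw [hG.zero, one_apply_eq_self, map_smul, ← smul_neg] at h4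
  have h5 := smul_right_injective _ Complex.I_ne_zero h4
  have h6 : π (x, y) = 0 := by
    rw [← hπ, ← h5]
    simp
  exact (Submodule.Quotient.mk_eq_zero _).mp h6

end EllTwo
end

noncomputable section

/-! ### Occupation numbers -/

namespace Config

variable {I K : Type*}

/-- The total number of particles. -/
def num (c : Config I K) : ℕ := c.1.degree + c.2.card

/-- The occupied modes. -/
def occ (c : Config I K) : Finset (I ⊕ K) := c.1.support.disjSum c.2

variable [LinearOrder K]

/-- The sign picked up when the mode `k` is moved to its place. -/
def sgn (s : Finset K) (k : K) : ℝ := (-1) ^ (s.filter (· < k)).card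

theorem sgn_mul_self (s : Finset K) (k : K) : sgn s k * sgn s k = 1 := by
  rw [sgn, ← mul_pow]
  simp

theorem sgn_ne_zero (s : Finset K) (k : K) : sgn s k ≠ 0 := by simp [sgn]

theorem sgn_insert {s : Finset K} {k : K} (hk : k ∉ s) (l : K) :
    sgn (insert k s) l = if k < l then -sgn s l else sgn s l := by
  unfold sgn
  rw [Finset.filter_insert]
  split_ifs with h
  · rw [Finset.card_insert_of_notMem (by simp [hk]), pow_succ]
    ring
  · rfl

theorem sgn_erase {s : Finset K} {k : K} (hk : k ∈ s) (l : K) :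
    sgn (s.erase k) l = if k < l then -sgn s l else sgn s l := by
  have := sgn_insert (Finset.notMem_erase k s) l
  rw [Finset.insert_erase hk] at this
  rw [this]
  split_ifs <;> simp

/-- Remove a particle in the mode `j`. -/
def low (c : Config I K) : I ⊕ K → Config I K
  | .inl i => (c.1 - Finsupp.single i 1, c.2)
  | .inr k => (c.1, c.2.erase k)

/-- Add a particle in the mode `j`. -/
def up (c : Config I K) : I ⊕ K → Config I K
  | .inl i => (c.1 + Finsupp.single i 1, c.2)
  | .inr k => (c.1, insert k c.2)

/-- The amplitude of `c` in `a†_j` applied to the state `low c j`. -/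
def amp (c : Config I K) : I ⊕ K → ℝ
  | .inl i => √(c.1 i)
  | .inr k => if k ∈ c.2 then sgn c.2 k else 0

/-- The amplitude of `c` in `a_j` applied to the state `up c j`. -/
def uamp (c : Config I K) : I ⊕ K → ℝ
  | .inl i => √(c.1 i + 1)
  | .inr k => if k ∈ c.2 then 0 else sgn c.2 k

/-- The sign `(-1)^{deg i deg j}`. -/
def sg : I ⊕ K → I ⊕ K → ℝ
  | .inr _, .inr _ => -1
  | _, _ => 1

theorem amp_ne_zero_iff (c : Config I K) (j : I ⊕ K) : amp c j ≠ 0 ↔ j ∈ occ c := by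
  rcases j with i | k
  · simp [amp, occ]
  · simp [amp, occ, sgn_ne_zero]

theorem sub_single_add_single {f : I →₀ ℕ} {i : I} (h : f i ≠ 0) :
    f - Finsupp.single i 1 + Finsupp.single i 1 = f :=
  tsub_add_cancel_of_le (Finsupp.single_le_iff.mpr (by omega))

theorem low_up {c : Config I K} {j : I ⊕ K} (h : uamp c j ≠ 0) : low (up c j) j = c := by
  rcases j with i | k
  · simp [low, up]
  · simp only [uamp, ne_eq, ite_eq_left_iff, not_forall] at h
    simp [low, up, Finset.erase_insert h.1]

theorem amp_up {c : Config I K} {j : I ⊕ K} (h : uamp c j ≠ 0) : amp (up c j) j = uamp c j := by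
  rcases j with i | k
  · simp [amp, up, uamp]
  · simp only [uamp, ne_eq, ite_eq_left_iff, not_forall] at h
    simp [amp, up, uamp, h.1, sgn_insert]

theorem num_up {c : Config I K} {j : I ⊕ K} (h : uamp c j ≠ 0) : num (up c j) = num c + 1 := by
  rcases j with i | k
  · simp [num, up]
    ring
  · simp only [uamp, ne_eq, ite_eq_left_iff, not_forall] at h
    simp [num, up, h.1]
    ring

theorem up_low {c : Config I K} {j : I ⊕ K} (h : amp c j ≠ 0) : up (low c j) j = c := by
  rw [amp_ne_zero_iff] at h
  rcases j with i | k
  · simp only [occ, Finset.inl_mem_disjSum, Finsupp.mem_support_iff] at h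
    simp [low, up, sub_single_add_single h]
  · simp only [occ, Finset.inr_mem_disjSum] at h
    simp [low, up, Finset.insert_erase h]

theorem uamp_low {c : Config I K} {j : I ⊕ K} (h : amp c j ≠ 0) : uamp (low c j) j = amp c j := by
  rw [amp_ne_zero_iff] at h
  rcases j with i | k
  · simp only [occ, Finset.inl_mem_disjSum, Finsupp.mem_support_iff] at h
    simp only [uamp, low, amp, Finsupp.coe_tsub, Pi.sub_apply, Finsupp.single_eq_same]
    rw [Nat.cast_sub (by omega)]
    simp
  · simp only [occ, Finset.inr_mem_disjSum] at h
    simp [low, uamp, amp, h, sgn_erase h]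

theorem num_low {c : Config I K} {j : I ⊕ K} (h : amp c j ≠ 0) : num c = num (low c j) + 1 := by
  conv_lhs => rw [← up_low h]
  exact num_up (by rwa [uamp_low h])

/-- Reindexing along `up c j ↔ c`. -/
theorem hasSum_reindex {M : Type*} [AddCommMonoid M] [TopologicalSpace M] (j : I ⊕ K)
    {f g : Config I K → M} (hf : ∀ c, amp c j = 0 → f c = 0) (hg : ∀ c, uamp c j = 0 → g c = 0)
    (h : ∀ c, uamp c j ≠ 0 → f (up c j) = g c) (a : M) : HasSum f a ↔ HasSum g a := by
  have h1 : Function.Injective fun c : {c : Config I K // uamp c j ≠ 0} => up c.1 j := by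
    intro c d hcd
    apply Subtype.ext
    rw [← low_up c.2, ← low_up d.2]
    exact congrArg (low · j) hcd
  have h2 : Function.Injective (Subtype.val : {c : Config I K // uamp c j ≠ 0} → Config I K) :=
    Subtype.val_injective
  rw [← h1.hasSum_iff (f := f), ← h2.hasSum_iff (f := g)]
  · have e : f ∘ (fun c : {c : Config I K // uamp c j ≠ 0} => up c.1 j) = g ∘ Subtype.val :=
      funext fun c => h c.1 c.2
    rw [e]
  · intro c hc
    by_contra hne
    exact hc ⟨⟨c, fun h0 => hne (hg c h0)⟩, rfl⟩
  · intro c hc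
    by_contra hne
    have ha : amp c j ≠ 0 := fun h0 => hne (hf c h0)
    exact hc ⟨⟨low c j, by rwa [uamp_low ha]⟩, up_low ha⟩

theorem tsum_reindex {M : Type*} [AddCommMonoid M] [TopologicalSpace M] [T2Space M] (j : I ⊕ K)
    {f g : Config I K → M} (hf : ∀ c, amp c j = 0 → f c = 0) (hg : ∀ c, uamp c j = 0 → g c = 0)
    (h : ∀ c, uamp c j ≠ 0 → f (up c j) = g c) : ∑' c, f c = ∑' c, g c := by
  by_cases hs : Summable f
  · exact (((hasSum_reindex j hf hg h _).mp hs.hasSum).tsum_eq).symm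
  · have hs' : ¬ Summable g := fun ⟨a, ha⟩ => hs ⟨a, (hasSum_reindex j hf hg h a).mpr ha⟩
    rw [tsum_eq_zero_of_not_summable hs, tsum_eq_zero_of_not_summable hs']

/-- The identity `∑ a†ⱼ aⱼ = N` on a basis state: a boson mode contributes its occupation number and
an occupied fermion mode contributes 1. -/
theorem sum_amp_sq (c : Config I K) : ∑ j ∈ occ c, amp c j ^ 2 = num c := by
  rw [occ, Finset.sum_disjSum, num, Finsupp.degree_apply]
  push_cast
  congr 1
  · exact Finset.sum_congr rfl fun i _ => Real.sq_sqrt (by positivity)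
  · rw [Finset.card_eq_sum_ones, Nat.cast_sum]
    refine Finset.sum_congr rfl fun k hk => ?_
    simp [amp, hk, sq, sgn_mul_self]

theorem low_low_comm (c : Config I K) (i j : I ⊕ K) : low (low c i) j = low (low c j) i := by
  rcases i with i | k <;> rcases j with j | l
  · simp [low, tsub_right_comm]
  · rfl
  · rfl
  · simp [low, Finset.erase_right_comm]

/-- The exchange of two creation operators, in amplitudes. For two distinct fermion modes, removing
the smaller one flips the sign attached to the larger one but not conversely, so the two orders
differ by one sign. -/
theorem amp_amp_low (c : Config I K) (i j : I ⊕ K) :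
    amp c i * amp (low c i) j = sg i j * (amp c j * amp (low c j) i) := by
  rcases i with i | k <;> rcases j with j | l
  · by_cases h : i = j
    · simp [h, sg]
    · simp only [amp, low, sg, Finsupp.coe_tsub, Pi.sub_apply, Finsupp.single_eq_of_ne h,
        Finsupp.single_eq_of_ne (Ne.symm h)]
      simp [mul_comm]
  · by_cases hl : l ∈ c.2 <;> simp [amp, low, sg, hl, mul_comm]
  · by_cases hk : k ∈ c.2 <;> simp [amp, low, sg, hk, mul_comm]
  · by_cases h : k = l
    · simp [h, amp, low]
    · by_cases hk : k ∈ c.2 <;> by_cases hl : l ∈ c.2 <;>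
        simp [amp, low, sg, hk, hl, h, Ne.symm h, sgn_erase]
      rcases lt_or_gt_of_ne h with h' | h'
      · simp [h', h'.not_gt, mul_comm]
      · simp [h', h'.not_gt, mul_comm]

/-- The canonical (anti)commutation relation `aᵢ a†ⱼ = ± a†ⱼ aᵢ + δᵢⱼ`, evaluated on the coordinates
of an arbitrary function `X`. For equal boson modes it is `(n + 1) - n = 1`; for equal fermion modes
exactly one of the two products is nonzero. -/
theorem uamp_amp_up [DecidableEq (I ⊕ K)] (c : Config I K) (i j : I ⊕ K) (X : Config I K → ℂ) :
    (uamp c i : ℂ) * (amp (up c i) j * X (low (up c i) j)) =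
      sg i j * (amp c j * (uamp (low c j) i * X (up (low c j) i))) + if i = j then X c else 0 := by
  rcases i with i | k <;> rcases j with j | l
  · by_cases h : i = j
    · subst h
      have h1 : low (up c (.inl i)) (.inl i) = c := by simp [low, up]
      rw [h1, if_pos rfl]
      by_cases hc : c.1 i = 0
      · simp [amp, uamp, up, hc]
      · have h2 : amp c (.inl i) ≠ 0 := by simp [amp, hc]
        rw [up_low h2, uamp_low h2]
        simp only [uamp, amp, up, sg, Finsupp.coe_add, Pi.add_apply, Finsupp.single_eq_same]
        push_cast
        rw [← mul_assoc, ← mul_assoc (√(c.1 i) : ℂ), ← Complex.ofReal_mul, ← Complex.ofReal_mul,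
          Real.mul_self_sqrt (by positivity), Real.mul_self_sqrt (by positivity)]
        push_cast
        ring
    · rw [if_neg (by simpa using h)]
      by_cases hc : c.1 j = 0
      · simp [amp, up, hc, Finsupp.single_eq_of_ne (Ne.symm h)]
      · have h1 : low (up c (.inl i)) (.inl j) = up (low c (.inl j)) (.inl i) := by
          simp only [low, up, Prod.mk.injEq, and_true]
          ext a
          by_cases ha : a = j
          · subst ha
            simp [Finsupp.single_eq_of_ne (Ne.symm h)]
          · simp [Finsupp.single_eq_of_ne ha]
        rw [h1]
        simp only [amp, uamp, low, up, sg, Finsupp.coe_add, Pi.add_apply, Finsupp.coe_tsub,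
          Pi.sub_apply, Finsupp.single_eq_of_ne h, Finsupp.single_eq_of_ne (Ne.symm h)]
        push_cast
        simp
        ring
  · by_cases hl : l ∈ c.2
    · simp only [amp, uamp, low, up, sg, hl, if_true, if_false, reduceCtorEq]
      push_cast
      ring
    · simp [amp, low, up, hl]
  · by_cases hk : k ∈ c.2
    · simp [uamp, low, hk]
    · simp only [amp, uamp, low, up, sg, hk, if_false, reduceCtorEq]
      push_cast
      ring
  · by_cases h : k = l
    · subst h
      by_cases hk : k ∈ c.2
      · have h1 : up (low c (.inr k)) (.inr k) = c := by simp [low, up, Finset.insert_erase hk]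
        rw [h1]
        simp [amp, uamp, low, hk, sg, sgn_erase hk]
        rw [← mul_assoc, ← Complex.ofReal_mul, sgn_mul_self]
        simp
      · have h1 : low (up c (.inr k)) (.inr k) = c := by simp [low, up, Finset.erase_insert hk]
        rw [h1]
        simp [amp, uamp, up, hk, sgn_insert hk]
        rw [← mul_assoc, ← Complex.ofReal_mul, sgn_mul_self]
        simp
    · rw [if_neg (by simpa using h)]
      have h1 : low (up c (.inr k)) (.inr l) = up (low c (.inr l)) (.inr k) := by
        simp [low, up, Finset.erase_insert_of_ne h]
      rw [h1]
      by_cases hk : k ∈ c.2 <;> by_cases hl : l ∈ c.2 <;>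
        simp [amp, uamp, low, up, sg, hk, hl, h, Ne.symm h, sgn_erase, sgn_insert]
      rcases lt_or_gt_of_ne h with h' | h'
      · simp [h', h'.not_gt]
        ring
      · simp [h', h'.not_gt]
        ring

end Config
end

/-! ### The one-particle basis adapted to `γ`, `P` and `J` -/

noncomputable section

namespace NeutralSpace

variable {H : Type*} [NormedAddCommGroup H] [InnerProductSpace ℂ H] [CompleteSpace H]
variable (S : NeutralSpace H)

/-- Polarisation: `J` preserves norms and conjugates the coefficients `±1`, `±i`. -/
theorem inner_J_J (f g : H) : ⟪S.J f, S.J g⟫_ℂ = ⟪g, f⟫_ℂ := by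
  have h1 : ∀ z : ℂ, ‖S.J f + z • S.J g‖ = ‖f + conj z • g‖ := fun z => by
    rw [← S.J.norm_map (f + conj z • g), map_add, map_smulₛₗ]
    simp
  have h2 := h1 1
  have h3 := h1 (-1)
  have h4 := h1 Complex.I
  have h5 := h1 (-Complex.I)
  simp only [map_one, one_smul, map_neg, Complex.conj_I, neg_smul, ← sub_eq_add_neg, neg_neg]
    at h2 h3 h4 h5
  rw [← inner_conj_symm g f, inner_eq_sum_norm_sq_div_four (S.J f), inner_eq_sum_norm_sq_div_four f]
  simp only [RCLike.I_to_complex, h2, h3, h4, h5]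
  simp only [map_div₀, map_add, map_sub, map_mul, map_pow, Complex.conj_I, map_ofNat]
  simp only [Complex.coe_algebraMap, Complex.conj_ofReal]
  ring

theorem inner_J_right (f g : H) : ⟪f, S.J g⟫_ℂ = ⟪g, S.J f⟫_ℂ := by
  conv_lhs => rw [← S.J_invol f]
  exact S.inner_J_J _ _

theorem inner_J_left (f g : H) : ⟪S.J f, g⟫_ℂ = ⟪S.J g, f⟫_ℂ := by
  rw [← inner_conj_symm, S.inner_J_right, inner_conj_symm]

theorem inner_γ (f g : H) : ⟪S.γ f, g⟫_ℂ = ⟪f, S.γ g⟫_ℂ := by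
  conv_rhs => rw [← ContinuousLinearMap.adjoint_inner_left, ← ContinuousLinearMap.star_eq_adjoint,
    S.γ_selfAdjoint.star_eq]

theorem inner_P (f g : H) : ⟪S.P f, g⟫_ℂ = ⟪f, S.P g⟫_ℂ := by
  conv_rhs => rw [← ContinuousLinearMap.adjoint_inner_left, ← ContinuousLinearMap.star_eq_adjoint,
    S.P_selfAdjoint.star_eq]

theorem γ_γ (f : H) : S.γ (S.γ f) = f := by
  rw [← mul_apply_eq_comp, S.γ_sq, one_apply_eq_self]

theorem P_P (f : H) : S.P (S.P f) = S.P f := by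
  rw [← mul_apply_eq_comp, S.P_idem]

theorem P_γ (f : H) : S.P (S.γ f) = S.γ (S.P f) := by
  rw [← mul_apply_eq_comp, S.P_even, mul_apply_eq_comp]

theorem P_J (f : H) : S.P (S.J f) = S.J f - S.J (S.P f) := by
  rw [S.J_P]
  abel

end NeutralSpace

namespace ModeBasis

variable {H : Type*} [NormedAddCommGroup H] [InnerProductSpace ℂ H] [CompleteSpace H]
variable {S : NeutralSpace H} {I K : Type*} (e : ModeBasis S I K)

/-- The parity of a mode, as an eigenvalue of `γ`. -/
def par : I ⊕ K → ℂ := Sum.elim (fun _ => 1) (fun _ => -1)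

theorem P_vec (j : I ⊕ K) : S.P (e.vec j) = e.vec j := by
  rcases j with i | k
  · exact (e.boson i).2.1
  · exact (e.fermion k).2.1

theorem γ_vec (j : I ⊕ K) : S.γ (e.vec j) = par j • e.vec j := by
  rcases j with i | k
  · simp only [par, Sum.elim_inl, one_smul]
    exact (e.boson i).2.2
  · simp only [par, Sum.elim_inr, neg_smul, one_smul]
    exact (e.fermion k).2.2

theorem orthonormal_vec : Orthonormal ℂ e.vec := by
  classical
  have hbf : ∀ i k, ⟪e.vec (.inl i), e.vec (.inr k)⟫_ℂ = 0 := by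
    intro i k
    have h := S.inner_γ (e.vec (.inl i)) (e.vec (.inr k))
    rw [e.γ_vec, e.γ_vec, inner_smul_left, inner_smul_right] at h
    simp only [par, Sum.elim_inl, Sum.elim_inr, map_one, one_mul, neg_mul] at h
    exact self_eq_neg.mp h
  rw [orthonormal_iff_ite]
  rintro (i | k) (j | l)
  · have := orthonormal_iff_ite.mp e.boson.orthonormal i j
    rw [Submodule.coe_inner] at this
    simpa [vec] using this
  · simpa using hbf i l
  · rw [← inner_conj_symm, hbf]
    simp
  · have := orthonormal_iff_ite.mp e.fermion.orthonormal k l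
    rw [Submodule.coe_inner] at this
    simpa [vec] using this

theorem eq_zero_of_inner_vec {g : H} (hg : S.P g = g) (h : ∀ j, ⟪e.vec j, g⟫_ℂ = 0) : g = 0 := by
  have h1 : (⟨g + S.γ g, by simp [S.P_γ, hg], by simp [S.γ_γ, add_comm]⟩ : S.bosonHalf) = 0 := by
    apply e.boson.repr.injective
    ext i
    rw [map_zero, e.boson.repr_apply_apply, Submodule.coe_inner]
    change ⟪e.vec (.inl i), g + S.γ g⟫_ℂ = 0
    rw [inner_add_right, ← S.inner_γ, e.γ_vec, inner_smul_left, h]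
    simp
  have h2 : (⟨g - S.γ g, by simp [S.P_γ, hg], by simp [S.γ_γ]⟩ : S.fermionHalf) = 0 := by
    apply e.fermion.repr.injective
    ext k
    rw [map_zero, e.fermion.repr_apply_apply, Submodule.coe_inner]
    change ⟪e.vec (.inr k), g - S.γ g⟫_ℂ = 0
    rw [inner_sub_right, ← S.inner_γ, e.γ_vec, inner_smul_left, h]
    simp
  have h3 : g + S.γ g = 0 := congrArg Subtype.val h1
  have h4 : g - S.γ g = 0 := congrArg Subtype.val h2
  have h5 : (2 : ℂ) • g = 0 := by
    rw [two_smul]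
    calc g + g = (g + S.γ g) + (g - S.γ g) := by abel
      _ = 0 := by rw [h3, h4, add_zero]
  exact (smul_eq_zero.mp h5).resolve_left two_ne_zero

/-- The basis vectors `{eⱼ} ∪ {J eⱼ}` of `H`. -/
def dvec : (I ⊕ K) ⊕ (I ⊕ K) → H := Sum.elim e.vec fun j => S.J (e.vec j)

theorem P_J_vec (j : I ⊕ K) : S.P (S.J (e.vec j)) = 0 := by
  rw [S.P_J, e.P_vec, sub_self]

theorem inner_vec_J_vec (i j : I ⊕ K) : ⟪e.vec i, S.J (e.vec j)⟫_ℂ = 0 := by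
  rw [← e.P_vec i, S.inner_P, e.P_J_vec, inner_zero_right]

theorem orthonormal_dvec : Orthonormal ℂ e.dvec := by
  classical
  have hv := orthonormal_iff_ite.mp e.orthonormal_vec
  rw [orthonormal_iff_ite]
  rintro (i | i) (j | j)
  · simpa [dvec] using hv i j
  · simpa [dvec] using e.inner_vec_J_vec i j
  · simp only [dvec, Sum.elim_inr, Sum.elim_inl]
    rw [← inner_conj_symm, e.inner_vec_J_vec]
    simp
  · simp only [dvec, Sum.elim_inr, S.inner_J_J, hv, Sum.inr.injEq]
    exact if_congr eq_comm rfl rfl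

/-- The orthonormal basis `{eⱼ} ∪ {J eⱼ}` of `H`. -/
def basis : HilbertBasis ((I ⊕ K) ⊕ (I ⊕ K)) ℂ H :=
  HilbertBasis.mkOfOrthogonalEqBot e.orthonormal_dvec (by
    rw [Submodule.eq_bot_iff]
    intro f hf
    have h : ∀ j, ⟪e.dvec j, f⟫_ℂ = 0 := fun j =>
      (Submodule.mem_orthogonal _ _).mp hf _ (Submodule.subset_span ⟨j, rfl⟩)
    -- The vectors `eⱼ` detect `P f` and the vectors `J eⱼ` detect `P J f = J (1 - P) f`; together
    -- these determine `f`.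
    have h1 : S.P f = 0 := e.eq_zero_of_inner_vec (S.P_P f) fun j => by
      rw [← S.inner_P, e.P_vec]
      exact h (.inl j)
    have h2 : S.P (S.J f) = 0 := e.eq_zero_of_inner_vec (S.P_P _) fun j => by
      rw [← S.inner_P, e.P_vec, S.inner_J_right, ← inner_conj_symm]
      have := h (.inr j)
      simp only [dvec, Sum.elim_inr] at this
      rw [this, map_zero]
    rw [S.P_J, h1, map_zero, sub_zero] at h2
    simpa using h2)

theorem coe_basis : ⇑e.basis = e.dvec := HilbertBasis.coe_mkOfOrthogonalEqBot _ _

theorem hasSum_vec (f : H) : HasSum (fun j => ⟪e.vec j, f⟫_ℂ • e.vec j) (S.P f) := by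
  have h := (e.basis.hasSum_repr (S.P f))
  rw [← (Sum.inl_injective (α := I ⊕ K) (β := I ⊕ K)).hasSum_iff] at h
  · refine h.congr_fun fun j => ?_
    simp only [Function.comp_apply, e.basis.repr_apply_apply, coe_basis, dvec, Sum.elim_inl]
    rw [← S.inner_P, e.P_vec]
  · rintro (j | j) hj
    · exact (hj ⟨j, rfl⟩).elim
    · rw [e.basis.repr_apply_apply, coe_basis]
      simp only [dvec, Sum.elim_inr]
      rw [← S.inner_P, e.P_J_vec, inner_zero_left, zero_smul]

theorem sum_inner_vec_sq_le (f : H) (F : Finset (I ⊕ K)) :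
    ∑ j ∈ F, ‖⟪e.vec j, f⟫_ℂ‖ ^ 2 ≤ ‖f‖ ^ 2 := e.orthonormal_vec.sum_inner_products_le f

theorem norm_sum_smul_vec_sq (F : Finset (I ⊕ K)) (a : I ⊕ K → ℂ) :
    ‖∑ j ∈ F, a j • e.vec j‖ ^ 2 = ∑ j ∈ F, ‖a j‖ ^ 2 := by
  have h : ⟪∑ j ∈ F, a j • e.vec j, ∑ j ∈ F, a j • e.vec j⟫_ℂ =
      ((∑ j ∈ F, ‖a j‖ ^ 2 : ℝ) : ℂ) := by
    rw [e.orthonormal_vec.inner_sum]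
    push_cast
    refine Finset.sum_congr rfl fun j _ => ?_
    rw [Complex.conj_mul']
  rw [inner_self_eq_norm_sq_to_K] at h
  exact Complex.ofReal_injective ((Complex.ofReal_pow _ _).trans h)

end ModeBasis
end

/-! ### Number estimates for creation operators -/

noncomputable section

namespace EllTwo

variable {C : Type*}

theorem enorm_sq_eq_tsum (ψ : EllTwo C) : ‖ψ‖ₑ ^ 2 = ∑' c, ‖ψ c‖ₑ ^ 2 := by
  have h := hasSum_norm_sq ψ
  have h1 : ∀ x : ℝ, 0 ≤ x → ENNReal.ofReal (x ^ 2) = ENNReal.ofReal x ^ 2 :=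
    fun x hx => ENNReal.ofReal_pow hx 2
  rw [← ofReal_norm, ← h1 _ (norm_nonneg _), ← h.tsum_eq,
    ENNReal.ofReal_tsum_of_nonneg (fun _ => by positivity) h.summable]
  exact tsum_congr fun c => by rw [h1 _ (norm_nonneg _), ofReal_norm]

theorem memℓp_two_of_tsum_ne_top {f : C → ℂ} (h : ∑' c, ‖f c‖ₑ ^ 2 ≠ ⊤) : Memℓp f 2 := by
  rw [memℓp_two_iff]
  have h1 : ∑' c, ((‖f c‖₊ ^ 2 : NNReal) : ENNReal) ≠ ⊤ := by
    simpa [enorm] using h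
  simpa using NNReal.summable_coe.mpr (ENNReal.tsum_coe_ne_top_iff_summable.mp h1)

theorem norm_sq_le_of_enorm {E F : Type*} [NormedAddCommGroup E] [NormedAddCommGroup F] {x : E}
    {y : F} {B : ℝ} (hB : 0 ≤ B) (h : ‖x‖ₑ ^ 2 ≤ ENNReal.ofReal B * ‖y‖ₑ ^ 2) :
    ‖x‖ ^ 2 ≤ B * ‖y‖ ^ 2 := by
  rw [← ofReal_norm, ← ofReal_norm, ← ENNReal.ofReal_pow (norm_nonneg _),
    ← ENNReal.ofReal_pow (norm_nonneg _), ← ENNReal.ofReal_mul hB] at h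
  exact (ENNReal.ofReal_le_ofReal_iff (by positivity)).mp h

open Classical in
/-- The standard basis vectors. -/
def delta (c : C) : EllTwo C := lp.single 2 c 1

theorem delta_apply (c d : C) [Decidable (d = c)] : delta c d = if d = c then 1 else 0 := by
  classical
  rw [delta, lp.single_apply, Pi.single_apply]
  split_ifs <;> rfl

theorem inner_delta_left (c : C) (ψ : EllTwo C) : ⟪delta c, ψ⟫_ℂ = ψ c := by
  classical
  rw [delta, lp.inner_single_left]
  simp

theorem hasSum_delta (ψ : EllTwo C) : HasSum (fun c => ψ c • delta c) ψ := by
  classical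
  refine (lp.hasSum_single (p := 2) (by norm_num) ψ).congr_fun fun c => ?_
  rw [delta, ← lp.single_smul]
  simp

theorem delta_mem_sec {num : C → ℕ} (c : C) : delta c ∈ sec num (num c) := fun d hd => by
  classical
  rw [delta_apply, if_neg (by rintro rfl; exact hd rfl)]

variable {num : C → ℕ}

/-- `T` is bounded on the vectors with `num c ≤ m`, for each `m`. -/
def LevBdd (T : fin num →ₗ[ℂ] fin num) : Prop :=
  ∀ m, ∃ B : ℝ, ∀ ψ : fin num, (ψ : EllTwo C) ∈ lev num m → ‖T ψ‖ ≤ B * ‖ψ‖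

theorem Banded.levBdd {T : fin num →ₗ[ℂ] fin num} {B : ℝ} (h : Banded T B) : LevBdd T :=
  fun _ => ⟨_, fun ψ hψ => h.norm_le ψ hψ⟩

/-- All partial sums lie in one level, on which `T` is bounded; there unbounded operators may be
applied term by term. -/
theorem LevBdd.hasSum {T : fin num →ₗ[ℂ] fin num} (hT : LevBdd T) {ι : Type*} {x : ι → fin num}
    {a : fin num} {m : ℕ} (hx : ∀ i, (x i : EllTwo C) ∈ lev num m)
    (h : HasSum (fun i => (x i : EllTwo C)) a) :
    HasSum (fun i => (T (x i) : EllTwo C)) (T a : EllTwo C) := by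
  obtain ⟨B, hB⟩ := hT m
  have ha : (a : EllTwo C) ∈ lev num m := (isClosed_lev m).mem_of_tendsto h
    (Filter.Eventually.of_forall fun F => Submodule.sum_mem _ fun i _ => hx i)
  have h1 := tendsto_iff_norm_sub_tendsto_zero.mp h
  have h2 := h1.const_mul B
  rw [mul_zero] at h2
  refine tendsto_iff_norm_sub_tendsto_zero.mpr (squeeze_zero (fun _ => norm_nonneg _)
    (fun F => ?_) h2)
  have hmem : ((∑ i ∈ F, x i - a : fin num) : EllTwo C) ∈ lev num m := by
    rw [Submodule.coe_sub, AddSubmonoidClass.coe_finsetSum]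
    exact Submodule.sub_mem _ (Submodule.sum_mem _ fun i _ => hx i) ha
  have h3 := hB _ hmem
  rw [map_sub, map_sum, Submodule.coe_norm, Submodule.coe_norm, Submodule.coe_sub,
    Submodule.coe_sub, AddSubmonoidClass.coe_finsetSum, AddSubmonoidClass.coe_finsetSum] at h3
  exact h3

/-- The standard basis vectors, as elements of `fin num`. -/
def finDelta (c : C) : fin num := ⟨delta c, _, sec_le_lev _ (delta_mem_sec c)⟩

theorem LevBdd.hasSum_finDelta {T : fin num →ₗ[ℂ] fin num} (hT : LevBdd T) (ψ : fin num) :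
    HasSum (fun c => (ψ : EllTwo C) c • (T (finDelta c) : EllTwo C)) (T ψ : EllTwo C) := by
  obtain ⟨m, hm⟩ := ψ.2
  set x : C → fin num := fun c => (ψ : EllTwo C) c • finDelta c
  have hx : ∀ c, (x c : EllTwo C) ∈ lev num m := by
    intro c
    by_cases hc : num c ≤ m
    · exact Submodule.smul_mem _ _ (lev_mono hc (sec_le_lev _ (delta_mem_sec c)))
    · have : x c = 0 := by simp only [x, hm c (by omega), zero_smul]
      rw [this]
      exact Submodule.zero_mem _
  have hs : HasSum (fun c => (x c : EllTwo C)) ψ := hasSum_delta (ψ : EllTwo C)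
  refine (hT.hasSum hx hs).congr_fun fun c => ?_
  simp only [x, map_smul, Submodule.coe_smul]

/-- Operators that agree on the standard basis agree. -/
theorem LevBdd.ext {T T' : fin num →ₗ[ℂ] fin num} (hT : LevBdd T) (hT' : LevBdd T')
    (h : ∀ c, T (finDelta c) = T' (finDelta c)) : T = T' :=
  LinearMap.ext fun ψ => Subtype.ext ((hT.hasSum_finDelta ψ).unique
    ((hT'.hasSum_finDelta ψ).congr_fun fun c => by rw [h]))

end EllTwo

open EllTwo Config

namespace ModeBasis

variable {H : Type*} [NormedAddCommGroup H] [InnerProductSpace ℂ H] [CompleteSpace H]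
variable {S : NeutralSpace H} {I K : Type*} [LinearOrder K] (e : ModeBasis S I K)

/-- The creation part of a vector-valued function of the occupation numbers. -/
def createVec (G : Config I K → H) (c : Config I K) : ℂ :=
  ∑ j ∈ occ c, ⟪e.vec j, G (low c j)⟫_ℂ * (amp c j : ℂ)

theorem createFun_eq (f : H) (ψ : Config I K → ℂ) :
    e.createFun f ψ = e.createVec fun c => ψ c • f := by
  funext c
  rw [createFun, createVec, occ, Finset.sum_disjSum]
  congr 1
  · refine Finset.sum_congr rfl fun i _ => ?_
    simp only [inner_smul_right, vec, Sum.elim_inl, amp, low]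
    ring
  · refine Finset.sum_congr rfl fun k hk => ?_
    simp only [inner_smul_right, vec, Sum.elim_inr, amp, low, hk, if_true, sgn]
    push_cast
    ring

theorem norm_createVec_sq_le (G : Config I K → H) (c : Config I K) :
    ‖e.createVec G c‖ ^ 2 ≤ num c * ∑ j ∈ occ c, ‖⟪e.vec j, G (low c j)⟫_ℂ‖ ^ 2 := by
  rw [← sum_amp_sq, mul_comm]
  calc ‖e.createVec G c‖ ^ 2
      ≤ (∑ j ∈ occ c, ‖⟪e.vec j, G (low c j)⟫_ℂ‖ * |amp c j|) ^ 2 := by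
        gcongr
        refine (norm_sum_le _ _).trans (le_of_eq (Finset.sum_congr rfl fun j _ => ?_))
        rw [norm_mul, Complex.norm_real, Real.norm_eq_abs]
    _ ≤ _ := (Finset.sum_mul_sq_le_sq_mul_sq _ _ _).trans (le_of_eq (by simp only [sq_abs]))

/-- Cauchy-Schwarz with `∑ amp² = N ≤ m + 1` decouples the modes; after reindexing `c = up d j`,
Bessel's inequality sums them. A vector-valued `G` is allowed so that a whole series `∑ a†(T eⱼ) φⱼ`
counts as one creation. -/
theorem tsum_createVec_le (G : Config I K → H) {m : ℕ} (hG : ∀ c, m < num c → G c = 0) :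
    ∑' c, ‖e.createVec G c‖ₑ ^ 2 ≤ (m + 1 : ℕ) * ∑' c, ‖G c‖ₑ ^ 2 := by
  classical
  have h1 : ∀ c, ‖e.createVec G c‖ₑ ^ 2 ≤
      (m + 1 : ℕ) * ∑' j, if amp c j = 0 then 0 else ‖⟪e.vec j, G (low c j)⟫_ℂ‖ₑ ^ 2 := by
    intro c
    have h2 : ∑' j, (if amp c j = 0 then 0 else ‖⟪e.vec j, G (low c j)⟫_ℂ‖ₑ ^ 2) =
        ∑ j ∈ occ c, ‖⟪e.vec j, G (low c j)⟫_ℂ‖ₑ ^ 2 := by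
      rw [tsum_eq_sum (s := occ c)]
      · exact Finset.sum_congr rfl fun j hj => if_neg ((amp_ne_zero_iff c j).mpr hj)
      · intro j hj
        rw [← amp_ne_zero_iff, not_not] at hj
        exact if_pos hj
    rw [h2]
    by_cases hc : num c ≤ m + 1
    · have h3 := e.norm_createVec_sq_le G c
      have h4 := ENNReal.ofReal_le_ofReal h3
      rw [ENNReal.ofReal_pow (norm_nonneg _), ofReal_norm, ENNReal.ofReal_mul (by positivity),
        ENNReal.ofReal_natCast, ENNReal.ofReal_sum_of_nonneg (fun _ _ => by positivity)] at h4
      refine h4.trans ?_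
      gcongr with j
      rw [ENNReal.ofReal_pow (norm_nonneg _), ofReal_norm]
    · have : e.createVec G c = 0 := by
        refine Finset.sum_eq_zero fun j hj => ?_
        have := num_low ((amp_ne_zero_iff c j).mpr hj)
        rw [hG _ (by omega), inner_zero_right, zero_mul]
      rw [this]
      simp
  refine (ENNReal.tsum_le_tsum h1).trans ?_
  rw [ENNReal.tsum_mul_left]
  refine mul_le_mul' le_rfl ?_
  rw [ENNReal.tsum_comm]
  have h2 : ∀ j, ∑' c, (if amp c j = 0 then 0 else ‖⟪e.vec j, G (low c j)⟫_ℂ‖ₑ ^ 2) =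
      ∑' c, if uamp c j = 0 then 0 else ‖⟪e.vec j, G c⟫_ℂ‖ₑ ^ 2 := fun j =>
    tsum_reindex j (fun c hc => if_pos hc) (fun c hc => if_pos hc) fun c hc => by
      rw [amp_up hc, low_up hc]
  simp only [h2]
  rw [ENNReal.tsum_comm]
  refine ENNReal.tsum_le_tsum fun c => ?_
  rw [ENNReal.tsum_eq_iSup_sum]
  refine iSup_le fun F => ?_
  calc ∑ j ∈ F, (if uamp c j = 0 then 0 else ‖⟪e.vec j, G c⟫_ℂ‖ₑ ^ 2)
      ≤ ∑ j ∈ F, ‖⟪e.vec j, G c⟫_ℂ‖ₑ ^ 2 := by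
        refine Finset.sum_le_sum fun j _ => ?_
        split_ifs <;> simp
    _ = ENNReal.ofReal (∑ j ∈ F, ‖⟪e.vec j, G c⟫_ℂ‖ ^ 2) := by
        rw [ENNReal.ofReal_sum_of_nonneg fun _ _ => by positivity]
        refine Finset.sum_congr rfl fun j _ => ?_
        rw [ENNReal.ofReal_pow (norm_nonneg _), ofReal_norm]
    _ ≤ ENNReal.ofReal (‖G c‖ ^ 2) := ENNReal.ofReal_le_ofReal (e.sum_inner_vec_sq_le _ F)
    _ = ‖G c‖ₑ ^ 2 := by rw [ENNReal.ofReal_pow (norm_nonneg _), ofReal_norm]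

theorem tsum_createFun_le (f : H) {ψ : Fock I K} {m : ℕ} (hψ : ψ ∈ lev num m) :
    ∑' c, ‖e.createFun f ψ c‖ₑ ^ 2 ≤ ENNReal.ofReal ((m + 1) * ‖f‖ ^ 2) * ‖ψ‖ₑ ^ 2 := by
  rw [createFun_eq]
  refine (e.tsum_createVec_le _ fun c hc => by rw [hψ c hc, zero_smul]).trans (le_of_eq ?_)
  simp only [enorm_smul, mul_pow]
  rw [ENNReal.tsum_mul_right, ← enorm_sq_eq_tsum, ENNReal.ofReal_mul (by positivity),
    ENNReal.ofReal_pow (norm_nonneg _), ofReal_norm,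
    show (m : ℝ) + 1 = ((m + 1 : ℕ) : ℝ) by push_cast; rfl, ENNReal.ofReal_natCast]
  ring

theorem memℓp_createFun (f : H) {ψ : Fock I K} {m : ℕ} (hψ : ψ ∈ lev num m) :
    Memℓp (e.createFun f ψ) 2 := by
  refine memℓp_two_of_tsum_ne_top ((e.tsum_createFun_le f hψ).trans_lt ?_).ne
  exact ENNReal.mul_lt_top ENNReal.ofReal_lt_top (by simp)

theorem createFun_eq_zero (f : H) {ψ : Config I K → ℂ} {c : Config I K}
    (h : ∀ d, num d + 1 = num c → ψ d = 0) : e.createFun f ψ c = 0 := by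
  rw [createFun_eq]
  refine Finset.sum_eq_zero fun j hj => ?_
  beta_reduce
  rw [h _ (num_low ((amp_ne_zero_iff c j).mpr hj)).symm, zero_smul, inner_zero_right, zero_mul]

/-- The creation operator on the vectors with a bounded number of particles. -/
def cr (f : H) : fin (num (I := I) (K := K)) →ₗ[ℂ] fin (num (I := I) (K := K)) where
  toFun ψ := ⟨⟨e.createFun f (ψ : Fock I K), e.memℓp_createFun f ψ.2.choose_spec⟩, by
    obtain ⟨m, hm⟩ := ψ.2
    exact ⟨m + 1, fun c hc => e.createFun_eq_zero f fun d hd => hm d (by omega)⟩⟩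
  map_add' ψ φ := Subtype.ext (Subtype.ext (e.createFun_add f _ _))
  map_smul' a ψ := Subtype.ext (Subtype.ext (e.createFun_smul f a _))

theorem cr_apply (f : H) (ψ : fin (num (I := I) (K := K))) (c : Config I K) :
    (e.cr f ψ : Fock I K) c = e.createFun f (ψ : Fock I K) c := rfl

theorem cr_mem_lev (f : H) {ψ : fin (num (I := I) (K := K))} {m : ℕ}
    (hψ : (ψ : Fock I K) ∈ lev num m) : (e.cr f ψ : Fock I K) ∈ lev num (m + 1) :=
  fun c hc => e.createFun_eq_zero f fun d hd => hψ d (by omega)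

theorem cr_mem_sec (f : H) {ψ : fin (num (I := I) (K := K))} {m : ℕ}
    (hψ : (ψ : Fock I K) ∈ sec num m) : (e.cr f ψ : Fock I K) ∈ sec num (m + 1) :=
  fun c hc => e.createFun_eq_zero f fun d hd => hψ d (by omega)

theorem norm_cr_sq_le (f : H) {ψ : fin (num (I := I) (K := K))} {m : ℕ}
    (hψ : (ψ : Fock I K) ∈ lev num m) : ‖e.cr f ψ‖ ^ 2 ≤ (m + 1) * ‖f‖ ^ 2 * ‖ψ‖ ^ 2 := by
  refine norm_sq_le_of_enorm (x := (e.cr f ψ : Fock I K)) (y := (ψ : Fock I K)) (by positivity) ?_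
  rw [enorm_sq_eq_tsum]
  exact e.tsum_createFun_le f hψ

theorem norm_cr_le (f : H) {ψ : fin (num (I := I) (K := K))} {m : ℕ}
    (hψ : (ψ : Fock I K) ∈ lev num m) : ‖e.cr f ψ‖ ≤ √(m + 1) * ‖f‖ * ‖ψ‖ := by
  refine abs_le_of_sq_le_sq' (b := √(m + 1) * ‖f‖ * ‖ψ‖) ?_ (by positivity) |>.2
  rw [mul_pow, mul_pow, Real.sq_sqrt (by positivity)]
  exact e.norm_cr_sq_le f hψ

theorem levBdd_cr (f : H) : LevBdd (e.cr f) := fun _ => ⟨_, fun _ hψ => e.norm_cr_le f hψ⟩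

/-- The bound for `∑ⱼ a†(T eⱼ) φⱼ`. -/
theorem norm_sum_cr_sq_le (T : H →L[ℂ] H) {m : ℕ} (F : Finset (I ⊕ K))
    {φ : I ⊕ K → fin (num (I := I) (K := K))} (hφ : ∀ j, (φ j : Fock I K) ∈ lev num m) :
    ‖∑ j ∈ F, e.cr (T (e.vec j)) (φ j)‖ ^ 2 ≤ (m + 1) * ‖T‖ ^ 2 * ∑ j ∈ F, ‖φ j‖ ^ 2 := by
  -- Collecting the sum before applying `T` uses the orthonormality of the modes; estimating term by
  -- term would not give a sum of squares.
  set G : Config I K → H := fun c => T (∑ j ∈ F, (φ j : Fock I K) c • e.vec j) with hG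
  have h1 : ((∑ j ∈ F, e.cr (T (e.vec j)) (φ j) : fin num) : Fock I K) = e.createVec G := by
    funext c
    rw [AddSubmonoidClass.coe_finsetSum, lp.coeFn_sum, Finset.sum_apply]
    simp only [cr_apply, createFun_eq, createVec, hG, map_sum, map_smul, inner_sum]
    rw [Finset.sum_comm]
    exact Finset.sum_congr rfl fun _ _ => by rw [Finset.sum_mul]
  have h2 := e.tsum_createVec_le G (m := m) fun c hc => by
    simp only [hG]
    rw [Finset.sum_eq_zero fun j _ => by rw [hφ j c hc, zero_smul], map_zero]
  have h3 : ∀ c, ‖G c‖ₑ ^ 2 ≤ ‖T‖ₑ ^ 2 * ∑ j ∈ F, ‖(φ j : Fock I K) c‖ₑ ^ 2 := by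
    intro c
    have h4 : ‖G c‖ ^ 2 ≤ ‖T‖ ^ 2 * ∑ j ∈ F, ‖(φ j : Fock I K) c‖ ^ 2 := by
      rw [← e.norm_sum_smul_vec_sq, ← mul_pow]
      gcongr
      exact T.le_opNorm _
    have h5 := ENNReal.ofReal_le_ofReal h4
    rw [ENNReal.ofReal_mul (by positivity), ENNReal.ofReal_sum_of_nonneg fun _ _ => by positivity]
      at h5
    simpa only [ENNReal.ofReal_pow (norm_nonneg _), ofReal_norm] using h5
  have h6 : ∑' c, ‖G c‖ₑ ^ 2 ≤ ‖T‖ₑ ^ 2 * ∑ j ∈ F, ‖(φ j : Fock I K)‖ₑ ^ 2 := by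
    refine (ENNReal.tsum_le_tsum h3).trans (le_of_eq ?_)
    rw [ENNReal.tsum_mul_left]
    congr 1
    simp only [enorm_sq_eq_tsum]
    exact (Summable.tsum_finsetSum fun j _ => ENNReal.summable)
  have h7 : ‖((∑ j ∈ F, e.cr (T (e.vec j)) (φ j) : fin num) : Fock I K)‖ₑ ^ 2 ≤
      (m + 1 : ℕ) * (‖T‖ₑ ^ 2 * ∑ j ∈ F, ‖(φ j : Fock I K)‖ₑ ^ 2) := by
    rw [enorm_sq_eq_tsum, h1]
    refine h2.trans ?_
    gcongr
  have h8 : ENNReal.ofReal (‖∑ j ∈ F, e.cr (T (e.vec j)) (φ j)‖ ^ 2) ≤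
      ENNReal.ofReal ((m + 1) * ‖T‖ ^ 2 * ∑ j ∈ F, ‖φ j‖ ^ 2) := by
    rw [ENNReal.ofReal_mul (by positivity), ENNReal.ofReal_mul (by positivity),
      ENNReal.ofReal_sum_of_nonneg fun _ _ => by positivity,
      show (m : ℝ) + 1 = ((m + 1 : ℕ) : ℝ) by push_cast; rfl, ENNReal.ofReal_natCast, mul_assoc]
    simp only [ENNReal.ofReal_pow (norm_nonneg _), Submodule.coe_norm, ofReal_norm]
    exact h7
  exact (ENNReal.ofReal_le_ofReal_iff (by positivity)).mp h8

end ModeBasis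
end

/-! ### Parity and annihilation operators -/

noncomputable section

namespace NeutralSpace

variable {H : Type*} [NormedAddCommGroup H] [InnerProductSpace ℂ H] [CompleteSpace H]
variable (S : NeutralSpace H)

/-- `γ` to the power of a parity. -/
def tw (p : Bool) : H →L[ℂ] H := bif p then S.γ else 1

/-- `f` is homogeneous of the given parity. -/
def Hom (p : Bool) (f : H) : Prop := S.γ f = bif p then -f else f

theorem tw_tw (p : Bool) (f : H) : S.tw p (S.tw p f) = f := by
  cases p
  · rfl
  · exact S.γ_γ f

theorem inner_tw (p : Bool) (f g : H) : ⟪S.tw p f, g⟫_ℂ = ⟪f, S.tw p g⟫_ℂ := by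
  cases p
  · rfl
  · exact S.inner_γ f g

theorem P_tw (p : Bool) (f : H) : S.P (S.tw p f) = S.tw p (S.P f) := by
  cases p
  · rfl
  · exact S.P_γ f

theorem J_tw (p : Bool) (f : H) : S.J (S.tw p f) = S.tw p (S.J f) := by
  cases p
  · rfl
  · exact S.J_even f

theorem γ_tw (p : Bool) (f : H) : S.γ (S.tw p f) = S.tw p (S.γ f) := by
  cases p
  · rfl
  · rfl

variable {S}

theorem Hom.P {p : Bool} {f : H} (h : S.Hom p f) : S.Hom p (S.P f) := by
  cases p <;> simp_all [Hom, ← S.P_γ]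

theorem Hom.J {p : Bool} {f : H} (h : S.Hom p f) : S.Hom p (S.J f) := by
  cases p <;> simp_all [Hom, ← S.J_even]

theorem Hom.γ {p : Bool} {f : H} (h : S.Hom p f) : S.Hom p (S.γ f) := by
  cases p <;> simp_all [Hom]

theorem exists_hom_add (f : H) : ∃ g h, S.Hom false g ∧ S.Hom true h ∧ f = g + h := by
  refine ⟨(1 / 2 : ℂ) • (f + S.γ f), (1 / 2 : ℂ) • (f - S.γ f), ?_, ?_, ?_⟩
  · simp [Hom, S.γ_γ, add_comm]
  · simp [Hom, S.γ_γ, ← smul_neg]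
  · rw [← smul_add, add_add_sub_cancel, ← two_smul ℂ f, smul_smul]
    norm_num

end NeutralSpace

/-- The vectors with a bounded number of particles. -/
abbrev FinFock (I K : Type*) : Submodule ℂ (Fock I K) := EllTwo.fin (Config.num (I := I) (K := K))

open EllTwo Config

namespace ModeBasis

variable {H : Type*} [NormedAddCommGroup H] [InnerProductSpace ℂ H] [CompleteSpace H]
variable {S : NeutralSpace H} {I K : Type*} (e : ModeBasis S I K)

theorem tw_vec (i j : I ⊕ K) : S.tw j.isRight (e.vec i) = (sg i j : ℂ) • e.vec i := by
  rcases i with i | i <;> rcases j with j | j <;>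
    simp [NeutralSpace.tw, sg, e.γ_vec, par]

theorem hom_vec (j : I ⊕ K) : S.Hom j.isRight (e.vec j) := by
  rcases j with j | j <;> simp [NeutralSpace.Hom, e.γ_vec, par]

theorem inner_vec_of_hom {p : Bool} {f : H} (hf : S.Hom p f) {j : I ⊕ K} (hj : j.isRight ≠ p) :
    ⟪e.vec j, f⟫_ℂ = 0 := by
  have h := S.inner_γ (e.vec j) f
  rw [e.γ_vec] at h
  unfold NeutralSpace.Hom at hf
  rw [hf] at h
  rcases j with j | j <;> cases p <;> simp [par] at h hj ⊢
  · exact CharZero.eq_neg_self_iff.mp h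
  · exact CharZero.neg_eq_self_iff.mp h

variable [LinearOrder K]

theorem cr_add (f g : H) : e.cr (f + g) = e.cr f + e.cr g := by
  ext ψ c
  change e.createFun (f + g) _ c = e.createFun f _ c + e.createFun g _ c
  simp only [createFun_eq, createVec, smul_add, inner_add_right, add_mul, Finset.sum_add_distrib]

theorem cr_smul (a : ℂ) (f : H) : e.cr (a • f) = a • e.cr f := by
  ext ψ c
  change e.createFun (a • f) _ c = a * e.createFun f _ c
  simp only [createFun_eq, createVec, Finset.mul_sum, inner_smul_right]
  exact Finset.sum_congr rfl fun _ _ => by ring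

theorem cr_P (f : H) : e.cr (S.P f) = e.cr f := by
  ext ψ c
  change e.createFun (S.P f) _ c = e.createFun f _ c
  simp only [createFun_eq, createVec, inner_smul_right, ← S.inner_P, e.P_vec]

/-- `f ↦ a†(f) ψ`. -/
def crAt (ψ : FinFock I K) : H →L[ℂ] Fock I K :=
  LinearMap.mkContinuousOfExistsBound
    { toFun := fun f => (e.cr f ψ : Fock I K)
      map_add' := fun f g => by rw [cr_add]; rfl
      map_smul' := fun a f => by rw [cr_smul]; rfl }
    (by
      obtain ⟨m, hm⟩ := ψ.2
      exact ⟨√(m + 1) * ‖ψ‖, fun f => (e.norm_cr_le f hm).trans (le_of_eq (by ring))⟩)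

theorem crAt_apply (ψ : FinFock I K) (f : H) : e.crAt ψ f = e.cr f ψ := rfl

theorem hasSum_cr (f : H) (ψ : FinFock I K) :
    HasSum (fun j => ((⟪e.vec j, f⟫_ℂ • e.cr (e.vec j) ψ : FinFock I K) : Fock I K))
      (e.cr f ψ) := by
  rw [← cr_P, ← crAt_apply]
  refine ((e.crAt ψ).hasSum (e.hasSum_vec f)).congr_fun fun j => ?_
  rw [map_smul]
  rfl

theorem cr_vec_apply (j : I ⊕ K) (ψ : FinFock I K) (c : Config I K) :
    (e.cr (e.vec j) ψ : Fock I K) c = amp c j * (ψ : Fock I K) (low c j) := by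
  classical
  rw [cr_apply, createFun_eq, createVec]
  have h := orthonormal_iff_ite.mp e.orthonormal_vec
  simp only [inner_smul_right, h, mul_ite, mul_one, mul_zero, ite_mul, zero_mul,
    Finset.sum_ite_eq', ← amp_ne_zero_iff]
  split_ifs with h1
  · ring
  · rw [not_not.mp h1]
    simp

theorem cr_vec_delta (j : I ⊕ K) (c : Config I K) :
    (e.cr (e.vec j) (finDelta c) : Fock I K) = (uamp c j : ℂ) • delta (up c j) := by
  classical
  ext d
  rw [cr_vec_apply, lp.coeFn_smul, Pi.smul_apply, smul_eq_mul, finDelta, delta_apply, delta_apply]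
  by_cases hd : d = up c j
  · subst hd
    by_cases hu : uamp c j = 0
    · by_cases ha : amp (up c j) j = 0
      · simp [hu, ha]
      · rw [if_neg]
        · simp [hu]
        · intro h
          rw [← uamp_low ha, h] at ha
          exact ha hu
    · rw [low_up hu, amp_up hu]
      simp
  · rw [if_neg hd]
    by_cases ha : amp d j = 0
    · simp [ha]
    · rw [if_neg]
      · simp
      · rintro rfl
        exact hd (up_low ha).symm

/-- The creation operator, truncated to a bounded operator. -/
def crTrunc (f : H) (m : ℕ) : Fock I K →L[ℂ] Fock I K :=
  LinearMap.mkContinuous ((fin num).subtype ∘ₗ e.cr f ∘ₗ cutFin num 1 m) (√(m + 1) * ‖f‖) fun ψ =>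
    (e.norm_cr_le f (cut_mem_lev 1 m ψ)).trans
      (mul_le_mul_of_nonneg_left (norm_cut_one_le m ψ) (by positivity))

theorem crTrunc_apply (f : H) {m : ℕ} (ψ : FinFock I K) (hψ : (ψ : Fock I K) ∈ lev num m) :
    e.crTrunc f m ψ = e.cr f ψ := by
  change (e.cr f (cutFin num 1 m ψ) : Fock I K) = _
  rw [cutFin_one_of_mem ψ hψ]

theorem norm_crTrunc_le (f : H) (m : ℕ) :
    ‖(e.crTrunc f m : Fock I K →L[ℂ] Fock I K)‖ ≤ √(m + 1) * ‖f‖ :=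
  LinearMap.mkContinuous_norm_le _ (by positivity) _

theorem inner_cr_delta_of_lt (f : H) {ψ : Fock I K} {m : ℕ} (hψ : ψ ∈ lev num m) {c : Config I K}
    (hc : m ≤ num c) : ⟪(e.cr f (finDelta c) : Fock I K), ψ⟫_ℂ = 0 := by
  rw [inner_eq_zero_symm]
  refine inner_eq_zero_of_lev hψ fun d hd => ?_
  exact e.cr_mem_sec (m := num c) f (delta_mem_sec c) d (by omega)

/-- The right side does not mention `m`: the adjoints of the truncated creation operators are
compatible and define one annihilation operator on all levels. -/
theorem adjoint_crTrunc_apply (f : H) {m : ℕ} {ψ : Fock I K} (hψ : ψ ∈ lev num m)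
    (c : Config I K) : ContinuousLinearMap.adjoint (e.crTrunc f m) ψ c =
      ⟪(e.cr f (finDelta c) : Fock I K), ψ⟫_ℂ := by
  rw [← inner_delta_left, ContinuousLinearMap.adjoint_inner_right]
  by_cases hc : num c ≤ m
  · exact congrArg (inner ℂ · ψ)
      (e.crTrunc_apply f (finDelta c) (lev_mono hc (sec_le_lev _ (delta_mem_sec c))))
  · rw [e.inner_cr_delta_of_lt f hψ (by omega)]
    change ⟪(e.cr f (cutFin num 1 m (delta c)) : Fock I K), ψ⟫_ℂ = 0
    have : cutFin num 1 m (delta c) = 0 := by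
      apply Subtype.ext
      ext d
      rw [coe_cutFin, cut_apply]
      split_ifs with hd
      · rw [delta_mem_sec (num := num) c d (by omega)]
        simp
      · rfl
    rw [this, map_zero]
    exact inner_zero_left _

/-- The annihilation operator on the vectors with a bounded number of particles. -/
def an (f : H) : FinFock I K →ₗ[ℂ] FinFock I K where
  toFun ψ := ⟨⟨fun c => ⟪(e.cr f (finDelta c) : Fock I K), (ψ : Fock I K)⟫_ℂ, by
      obtain ⟨m, hm⟩ := ψ.2
      rw [← funext (e.adjoint_crTrunc_apply f hm)]
      exact (ContinuousLinearMap.adjoint (e.crTrunc f m) (ψ : Fock I K)).2⟩, by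
    obtain ⟨m, hm⟩ := ψ.2
    exact ⟨m, fun c hc => e.inner_cr_delta_of_lt f hm hc.le⟩⟩
  map_add' ψ φ := by
    ext c
    exact inner_add_right _ _ _
  map_smul' a ψ := by
    ext c
    exact inner_smul_right _ _ _

theorem an_apply (f : H) (ψ : FinFock I K) (c : Config I K) :
    (e.an f ψ : Fock I K) c = ⟪(e.cr f (finDelta c) : Fock I K), (ψ : Fock I K)⟫_ℂ := rfl

theorem coe_an (f : H) {m : ℕ} {ψ : FinFock I K} (hψ : (ψ : Fock I K) ∈ lev num m) :
    (e.an f ψ : Fock I K) = ContinuousLinearMap.adjoint (e.crTrunc f m) ψ :=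
  lp.ext (funext fun c => (e.adjoint_crTrunc_apply f hψ c).symm)

theorem an_mem_lev (f : H) {ψ : FinFock I K} {m : ℕ} (hψ : (ψ : Fock I K) ∈ lev num m) :
    (e.an f ψ : Fock I K) ∈ lev num (m - 1) :=
  fun _ hc => e.inner_cr_delta_of_lt f hψ (by omega)

theorem an_eq_zero (f : H) {ψ : FinFock I K} (hψ : (ψ : Fock I K) ∈ lev num 0) : e.an f ψ = 0 := by
  ext c
  exact e.inner_cr_delta_of_lt f hψ (Nat.zero_le _)

theorem an_sec (f : H) {ψ : FinFock I K} {n : ℕ} (hψ : (ψ : Fock I K) ∈ sec num n)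
    {c : Config I K} (hc : num c + 1 ≠ n) : (e.an f ψ : Fock I K) c = 0 := by
  rw [an_apply, lp.inner_eq_tsum]
  refine (tsum_congr fun d => ?_).trans tsum_zero
  by_cases hd : num d = n
  · rw [e.cr_mem_sec f (delta_mem_sec c) d (by omega), inner_zero_left]
  · rw [hψ d hd, inner_zero_right]

theorem an_mem_sec (f : H) {ψ : FinFock I K} {n : ℕ} (hψ : (ψ : Fock I K) ∈ sec num n) :
    (e.an f ψ : Fock I K) ∈ sec num (n - 1) := fun c hc => e.an_sec f hψ (by omega)

theorem norm_an_le (f : H) {ψ : FinFock I K} {m : ℕ}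
    (hψ : (ψ : Fock I K) ∈ lev num m) : ‖e.an f ψ‖ ≤ √(m + 1) * ‖f‖ * ‖ψ‖ := by
  rw [Submodule.coe_norm, coe_an e f hψ]
  refine (ContinuousLinearMap.le_opNorm _ _).trans ?_
  rw [LinearIsometryEquiv.norm_map]
  exact mul_le_mul_of_nonneg_right (e.norm_crTrunc_le f m) (norm_nonneg _)

theorem levBdd_an (f : H) : LevBdd (e.an f : FinFock I K →ₗ[ℂ] FinFock I K) :=
  fun _ => ⟨_, fun _ hψ => e.norm_an_le f hψ⟩

theorem inner_an_left (f : H) (φ ψ : FinFock I K) :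
    ⟪e.an f φ, ψ⟫_ℂ = ⟪φ, e.cr f ψ⟫_ℂ := by
  obtain ⟨m, hm⟩ := φ.2
  obtain ⟨n, hn⟩ := ψ.2
  rw [Submodule.coe_inner, Submodule.coe_inner, e.coe_an f (lev_mono (le_max_left m n) hm),
    ContinuousLinearMap.adjoint_inner_left,
    e.crTrunc_apply f ψ (lev_mono (le_max_right m n) hn)]

theorem inner_an_right (f : H) (φ ψ : FinFock I K) :
    ⟪φ, e.an f ψ⟫_ℂ = ⟪e.cr f φ, ψ⟫_ℂ := by
  have h := e.inner_an_left f ψ φ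
  rw [Submodule.coe_inner, Submodule.coe_inner] at h ⊢
  rw [← inner_conj_symm, h, inner_conj_symm]

theorem an_add (f g : H) : e.an (f + g) = e.an f + e.an g :=
  LinearMap.ext fun ψ => ext_inner_right ℂ fun φ => by
    rw [inner_an_left, LinearMap.add_apply, inner_add_left, inner_an_left, inner_an_left, cr_add,
      LinearMap.add_apply, inner_add_right]

theorem an_smul (a : ℂ) (f : H) : e.an (a • f) = conj a • e.an f :=
  LinearMap.ext fun ψ => ext_inner_right ℂ fun φ => by
    rw [inner_an_left, LinearMap.smul_apply, inner_smul_left, inner_an_left, cr_smul,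
      LinearMap.smul_apply, inner_smul_right, Complex.conj_conj]

theorem an_P (f : H) : e.an (S.P f) = e.an f :=
  LinearMap.ext fun ψ => ext_inner_right ℂ fun φ => by
    rw [inner_an_left, inner_an_left, cr_P]

/-- `f ↦ a(f) ψ`. -/
def anAt (ψ : FinFock I K) : H →L⋆[ℂ] Fock I K :=
  LinearMap.mkContinuousOfExistsBound
    { toFun := fun f => (e.an f ψ : Fock I K)
      map_add' := fun f g => by rw [an_add]; rfl
      map_smul' := fun a f => by rw [an_smul]; rfl }
    (by
      obtain ⟨m, hm⟩ := ψ.2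
      exact ⟨√(m + 1) * ‖ψ‖, fun f => (e.norm_an_le f hm).trans (le_of_eq (by ring))⟩)

theorem anAt_apply (ψ : FinFock I K) (f : H) : e.anAt ψ f = e.an f ψ := rfl

theorem hasSum_an (f : H) (ψ : FinFock I K) :
    HasSum (fun j => ((⟪f, e.vec j⟫_ℂ • e.an (e.vec j) ψ : FinFock I K) : Fock I K))
      (e.an f ψ) := by
  rw [← an_P, ← anAt_apply]
  refine ((e.anAt ψ).hasSum (e.hasSum_vec f)).congr_fun fun j => ?_
  rw [ContinuousLinearMap.map_smulₛₗ, inner_conj_symm]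
  rfl

theorem an_vec_apply (j : I ⊕ K) (ψ : FinFock I K) (c : Config I K) :
    (e.an (e.vec j) ψ : Fock I K) c = uamp c j * (ψ : Fock I K) (up c j) := by
  rw [an_apply, cr_vec_delta, inner_smul_left, inner_delta_left, Complex.conj_ofReal]

/-- The full sum is the expectation value `⟪ψ, N ψ⟫`, through `∑ amp² = N`. -/
theorem sum_norm_an_vec_sq_le (F : Finset (I ⊕ K)) {ψ : FinFock I K} {m : ℕ}
    (hψ : (ψ : Fock I K) ∈ lev num m) : ∑ j ∈ F, ‖e.an (e.vec j) ψ‖ ^ 2 ≤ m * ‖ψ‖ ^ 2 := by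
  have h1 : ∀ j, HasSum (fun c => (amp c j * ‖(ψ : Fock I K) c‖) ^ 2)
      (‖e.an (e.vec j) ψ‖ ^ 2) := fun j => by
    have h := hasSum_norm_sq (e.an (e.vec j) ψ : Fock I K)
    refine (hasSum_reindex (g := fun c => ‖(e.an (e.vec j) ψ : Fock I K) c‖ ^ 2) j
      (fun c hc => by simp [hc]) (fun c hc => ?_) (fun c hc => ?_) _).mpr h
    · simp [an_vec_apply, hc]
    · simp only [an_vec_apply, norm_mul, Complex.norm_real, mul_pow, amp_up hc, Real.norm_eq_abs,
        sq_abs]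
  refine hasSum_le (fun c => ?_) (hasSum_sum fun j (_ : j ∈ F) => h1 j)
    ((hasSum_norm_sq (ψ : Fock I K)).mul_left (m : ℝ))
  simp only [mul_pow, ← Finset.sum_mul]
  rcases le_or_gt (num c) m with hc | hc
  · refine mul_le_mul_of_nonneg_right (le_trans ?_ (Nat.cast_le.mpr hc)) (by positivity)
    rw [← sum_amp_sq]
    rw [← Finset.sum_filter_ne_zero]
    refine Finset.sum_le_sum_of_subset_of_nonneg (fun j hj => ?_) fun _ _ _ => by positivity
    rw [← amp_ne_zero_iff]
    exact fun h => (Finset.mem_filter.mp hj).2 (by rw [h]; simp)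
  · rw [hψ c hc]
    simp

/-! ### Commutation relations -/

theorem cr_vec_cr_vec (i j : I ⊕ K) (ψ : FinFock I K) :
    e.cr (e.vec i) (e.cr (e.vec j) ψ) = (sg i j : ℂ) • e.cr (e.vec j) (e.cr (e.vec i) ψ) := by
  ext c
  change (e.cr (e.vec i) _ : Fock I K) c = (sg i j : ℂ) * (e.cr (e.vec j) _ : Fock I K) c
  have h := congrArg (fun x : ℝ => (x : ℂ)) (amp_amp_low c i j)
  push_cast at h
  simp only [cr_vec_apply, low_low_comm c i j]
  linear_combination (ψ : Fock I K) (low (low c j) i) * h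

theorem an_vec_cr_vec [DecidableEq (I ⊕ K)] (i j : I ⊕ K) (ψ : FinFock I K) :
    e.an (e.vec i) (e.cr (e.vec j) ψ) =
      (sg i j : ℂ) • e.cr (e.vec j) (e.an (e.vec i) ψ) + if i = j then ψ else 0 := by
  ext c
  have h := uamp_amp_up c i j (ψ : Fock I K)
  have h1 : ((if i = j then ψ else 0 : FinFock I K) : Fock I K) c =
      if i = j then (ψ : Fock I K) c else 0 := by split_ifs <;> rfl
  change (e.an (e.vec i) _ : Fock I K) c = (sg i j : ℂ) * (e.cr (e.vec j) _ : Fock I K) c +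
    ((if i = j then ψ else 0 : FinFock I K) : Fock I K) c
  rw [an_vec_apply, cr_vec_apply, cr_vec_apply, an_vec_apply, h1, h]

/-- The sign `(-1)^{deg deg}` is absorbed by applying `γ` to the vector that is passed. In this form
the relation is linear in `g`, so `g` need not be homogeneous. -/
theorem cr_cr_vec (g : H) (j : I ⊕ K) (ψ : FinFock I K) :
    e.cr g (e.cr (e.vec j) ψ) = e.cr (e.vec j) (e.cr (S.tw j.isRight g) ψ) := by
  obtain ⟨m, hm⟩ := ψ.2
  apply Subtype.ext
  have h := (e.levBdd_cr (e.vec j)).hasSum (m := m + 1) (fun i => Submodule.smul_mem _ _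
    (e.cr_mem_lev _ hm)) (e.hasSum_cr (S.tw j.isRight g) ψ)
  refine (e.hasSum_cr g (e.cr (e.vec j) ψ)).unique (h.congr_fun fun i => ?_)
  rw [cr_vec_cr_vec, map_smul, ← S.inner_tw, e.tw_vec, inner_smul_left, Complex.conj_ofReal,
    smul_smul, mul_comm]

theorem an_cr_vec (g : H) (j : I ⊕ K) (ψ : FinFock I K) :
    e.an g (e.cr (e.vec j) ψ) =
      e.cr (e.vec j) (e.an (S.tw j.isRight g) ψ) + ⟪g, e.vec j⟫_ℂ • ψ := by
  classical
  obtain ⟨m, hm⟩ := ψ.2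
  apply Subtype.ext
  have h := (e.levBdd_cr (e.vec j)).hasSum (m := m) (fun i => Submodule.smul_mem _ _
    (lev_mono (Nat.sub_le _ _) (e.an_mem_lev _ hm))) (e.hasSum_an (S.tw j.isRight g) ψ)
  have h2 := hasSum_ite_eq j (⟪g, e.vec j⟫_ℂ • (ψ : Fock I K))
  refine (e.hasSum_an g (e.cr (e.vec j) ψ)).unique ((h.add h2).congr_fun fun i => ?_)
  rw [an_vec_cr_vec, map_smul, S.inner_tw, e.tw_vec, inner_smul_right,
    smul_add, smul_smul, mul_comm, Submodule.coe_add]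
  congr 1
  split_ifs with hi
  · rw [hi]
    rfl
  · simp

theorem cr_cr {p : Bool} {f : H} (hf : S.Hom p f) (g : H) (ψ : FinFock I K) :
    e.cr g (e.cr f ψ) = e.cr f (e.cr (S.tw p g) ψ) := by
  obtain ⟨m, hm⟩ := ψ.2
  apply Subtype.ext
  have h := (e.levBdd_cr g).hasSum (m := m + 1) (fun i => Submodule.smul_mem _ _
    (e.cr_mem_lev _ hm)) (e.hasSum_cr f ψ)
  refine h.unique ((e.hasSum_cr f _).congr_fun fun j => ?_)
  by_cases hj : j.isRight = p
  · rw [map_smul, cr_cr_vec, hj]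
  · rw [e.inner_vec_of_hom hf hj, zero_smul, zero_smul, map_zero]

/-- Expansion of `f` in modes: the modes of the wrong parity have coefficient zero, so the same
power of `γ` appears in every term. -/
theorem an_cr {p : Bool} {f : H} (hf : S.Hom p f) (g : H) (ψ : FinFock I K) :
    e.an g (e.cr f ψ) = e.cr f (e.an (S.tw p g) ψ) + ⟪g, S.P f⟫_ℂ • ψ := by
  obtain ⟨m, hm⟩ := ψ.2
  apply Subtype.ext
  have h := (e.levBdd_an g).hasSum (m := m + 1) (fun i => Submodule.smul_mem _ _
    (e.cr_mem_lev _ hm)) (e.hasSum_cr f ψ)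
  have h2 := ((innerSL ℂ g).hasSum (e.hasSum_vec f)).smul_const (ψ : Fock I K)
  refine h.unique (((e.hasSum_cr f _).add h2).congr_fun fun j => ?_)
  by_cases hj : j.isRight = p
  · rw [map_smul, an_cr_vec, hj, smul_add, Submodule.coe_add, map_smul, innerSL_apply_apply,
      smul_smul, smul_eq_mul]
    rfl
  · simp [e.inner_vec_of_hom hf hj]

theorem an_an {p : Bool} {f : H} (hf : S.Hom p f) (g : H) (ψ : FinFock I K) :
    e.an g (e.an f ψ) = e.an f (e.an (S.tw p g) ψ) :=
  ext_inner_right ℂ fun φ => by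
    rw [inner_an_left, inner_an_left, inner_an_left, inner_an_left, e.cr_cr hf, S.tw_tw]

end ModeBasis
end

noncomputable section

open EllTwo

/-! ### Hilbert-Schmidt operators -/

section HilbertSchmidt

variable {H : Type*} [NormedAddCommGroup H] [InnerProductSpace ℂ H] [CompleteSpace H]
variable {ι ι' : Type*}

/-- The square of the Hilbert-Schmidt norm. -/
def hsSq (b : HilbertBasis ι ℂ H) (T : H →L[ℂ] H) : ENNReal := ∑' i, ‖T (b i)‖ₑ ^ 2

omit [CompleteSpace H] in
theorem HilbertBasis.enorm_sq (b : HilbertBasis ι ℂ H) (v : H) :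
    ‖v‖ₑ ^ 2 = ∑' i, ‖⟪b i, v⟫_ℂ‖ₑ ^ 2 := by
  have h : ‖b.repr v‖ₑ = ‖v‖ₑ := by
    rw [← ofReal_norm, b.repr.norm_map, ofReal_norm]
  rw [← h, enorm_sq_eq_tsum]
  simp only [b.repr_apply_apply]

/-- Both sides are the sum of the squared matrix entries of `T` between the two bases. Allowing
different bases makes the independence of the basis a corollary. -/
theorem hsSq_adjoint (b : HilbertBasis ι ℂ H) (b' : HilbertBasis ι' ℂ H) (T : H →L[ℂ] H) :
    hsSq b (ContinuousLinearMap.adjoint T) = hsSq b' T := by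
  simp only [hsSq]
  rw [tsum_congr fun i => b'.enorm_sq _, ENNReal.tsum_comm, tsum_congr fun i => b.enorm_sq _]
  refine tsum_congr fun j => tsum_congr fun i => ?_
  rw [ContinuousLinearMap.adjoint_inner_right, ← inner_conj_symm, RCLike.enorm_conj]

theorem hsSq_basis (b : HilbertBasis ι ℂ H) (b' : HilbertBasis ι' ℂ H) (T : H →L[ℂ] H) :
    hsSq b T = hsSq b' T := by
  rw [← hsSq_adjoint b b, hsSq_adjoint b b']

omit [CompleteSpace H] in
theorem hsSq_mul_left_le (b : HilbertBasis ι ℂ H) (R T : H →L[ℂ] H) :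
    hsSq b (R * T) ≤ ‖R‖ₑ ^ 2 * hsSq b T := by
  rw [hsSq, hsSq, ← ENNReal.tsum_mul_left]
  refine ENNReal.tsum_le_tsum fun i => ?_
  rw [← mul_pow]
  gcongr
  exact R.le_opENorm _

theorem hsSq_mul_right_le (b : HilbertBasis ι ℂ H) (T R : H →L[ℂ] H) :
    hsSq b (T * R) ≤ ‖R‖ₑ ^ 2 * hsSq b T := by
  have h : ∀ A B : H →L[ℂ] H, ContinuousLinearMap.adjoint (A * B) =
      ContinuousLinearMap.adjoint B * ContinuousLinearMap.adjoint A := fun A B =>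
    ContinuousLinearMap.adjoint_comp A B
  have h2 : ‖ContinuousLinearMap.adjoint R‖ₑ = ‖R‖ₑ := by
    rw [← ofReal_norm, LinearIsometryEquiv.norm_map, ofReal_norm]
  rw [← hsSq_adjoint b b, h, ← hsSq_adjoint b b T, ← h2]
  exact hsSq_mul_left_le _ _ _

omit [CompleteSpace H] in
theorem memℓp_iff_hsSq_ne_top (b : HilbertBasis ι ℂ H) (T : H →L[ℂ] H) :
    Memℓp (fun i => T (b i)) 2 ↔ hsSq b T ≠ ⊤ := by
  have h1 : hsSq b T = ∑' i, ((‖T (b i)‖₊ ^ 2 : NNReal) : ENNReal) := by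
    simp [hsSq, enorm]
  rw [memℓp_two_iff, h1, ENNReal.tsum_coe_ne_top_iff_summable, ← NNReal.summable_coe]
  simp

theorem isHilbertSchmidt_iff (b : HilbertBasis ι ℂ H) (T : H →L[ℂ] H) :
    IsHilbertSchmidt T ↔ Memℓp (fun i => T (b i)) 2 := by
  rw [memℓp_iff_hsSq_ne_top]
  constructor
  · rintro ⟨s, b', h⟩
    rw [hsSq_basis b b', ← memℓp_iff_hsSq_ne_top]
    exact memℓp_two_iff.mpr h
  · intro h
    obtain ⟨s, b', -⟩ := exists_hilbertBasis ℂ H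
    refine ⟨s, b', memℓp_two_iff.mp ?_⟩
    rwa [memℓp_iff_hsSq_ne_top, hsSq_basis b' b]

omit [CompleteSpace H] in
theorem memℓp_mul_left (b : HilbertBasis ι ℂ H) (R : H →L[ℂ] H) {T : H →L[ℂ] H}
    (h : Memℓp (fun i => T (b i)) 2) : Memℓp (fun i => (R * T) (b i)) 2 := by
  rw [memℓp_iff_hsSq_ne_top] at h ⊢
  exact ((hsSq_mul_left_le b R T).trans_lt (ENNReal.mul_lt_top (by simp) h.lt_top)).ne

theorem memℓp_mul_right (b : HilbertBasis ι ℂ H) (R : H →L[ℂ] H) {T : H →L[ℂ] H}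
    (h : Memℓp (fun i => T (b i)) 2) : Memℓp (fun i => (T * R) (b i)) 2 := by
  rw [memℓp_iff_hsSq_ne_top] at h ⊢
  exact ((hsSq_mul_right_le b T R).trans_lt (ENNReal.mul_lt_top (by simp) h.lt_top)).ne

theorem memℓp_adjoint (b : HilbertBasis ι ℂ H) {T : H →L[ℂ] H}
    (h : Memℓp (fun i => T (b i)) 2) :
    Memℓp (fun i => ContinuousLinearMap.adjoint T (b i)) 2 := by
  rw [memℓp_iff_hsSq_ne_top] at h ⊢
  rwa [hsSq_adjoint b b]

/-- The vector of the values of a Hilbert-Schmidt operator on a basis. -/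
def hsVec (b : HilbertBasis ι ℂ H) (T : H →L[ℂ] H) (h : Memℓp (fun i => T (b i)) 2) :
    lp (fun _ : ι => H) 2 := ⟨fun i => T (b i), h⟩

omit [CompleteSpace H] in
theorem hasSum_hsVec (b : HilbertBasis ι ℂ H) {T : H →L[ℂ] H} (h : Memℓp (fun i => T (b i)) 2) :
    HasSum (fun i => ‖T (b i)‖ ^ 2) (‖hsVec b T h‖ ^ 2) := by
  have := lp.hasSum_norm (p := 2) (by norm_num) (hsVec b T h)
  simpa [hsVec] using this

omit [CompleteSpace H] in
theorem enorm_hsVec_sq (b : HilbertBasis ι ℂ H) {T : H →L[ℂ] H}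
    (h : Memℓp (fun i => T (b i)) 2) : ‖hsVec b T h‖ₑ ^ 2 = hsSq b T := by
  have h1 := hasSum_hsVec b h
  rw [← ofReal_norm, ← ENNReal.ofReal_pow (norm_nonneg _), ← h1.tsum_eq,
    ENNReal.ofReal_tsum_of_nonneg (fun _ => by positivity) h1.summable]
  exact tsum_congr fun c => by rw [ENNReal.ofReal_pow (norm_nonneg _), ofReal_norm]

omit [CompleteSpace H] in
theorem norm_hsVec_le_of_hsSq_le (b : HilbertBasis ι ℂ H) {R T T' : H →L[ℂ] H}
    (h : Memℓp (fun i => T (b i)) 2) (h' : Memℓp (fun i => T' (b i)) 2)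
    (hle : hsSq b T' ≤ ‖R‖ₑ ^ 2 * hsSq b T) : ‖hsVec b T' h'‖ ≤ ‖R‖ * ‖hsVec b T h‖ := by
  rw [← enorm_hsVec_sq b h, ← enorm_hsVec_sq b h', ← ofReal_norm R,
    ← ENNReal.ofReal_pow (norm_nonneg _)] at hle
  have h1 := norm_sq_le_of_enorm (by positivity) hle
  rw [← mul_pow] at h1
  exact (abs_le_of_sq_le_sq' h1 (by positivity)).2

end HilbertSchmidt

namespace NeutralSpace

variable {H : Type*} [NormedAddCommGroup H] [InnerProductSpace ℂ H] [CompleteSpace H]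
variable (S : NeutralSpace H) {ι : Type*} (b : HilbertBasis ι ℂ H)

/-- The bounded operators `X` for which `[P, X]` is Hilbert-Schmidt. -/
def hsSubalgebra : Subalgebra ℂ (H →L[ℂ] H) where
  carrier := {X | Memℓp (fun i => (S.P * X - X * S.P) (b i)) 2}
  mul_mem' := fun {X Y} hX hY => by
    have h : S.P * (X * Y) - X * Y * S.P =
        (S.P * X - X * S.P) * Y + X * (S.P * Y - Y * S.P) := by noncomm_ring
    simp only [Set.mem_ofPred_eq, h]
    exact (memℓp_mul_right b Y hX).add (memℓp_mul_left b X hY)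
  add_mem' := fun {X Y} hX hY => by
    have h : S.P * (X + Y) - (X + Y) * S.P =
        (S.P * X - X * S.P) + (S.P * Y - Y * S.P) := by noncomm_ring
    simp only [Set.mem_ofPred_eq, h]
    exact hX.add hY
  algebraMap_mem' := fun a => by
    simp only [Set.mem_ofPred_eq, ← Algebra.commutes, sub_self, zero_apply]
    exact zero_memℓp

/-- The Banach algebra of the bounded operators `X` for which `[P, X]` is Hilbert-Schmidt, with
the norm `‖X‖ + ‖[P, X]‖₂`. -/
def HSAlg : Type _ := S.hsSubalgebra b

namespace HSAlg

instance : Ring (S.HSAlg b) := inferInstanceAs (Ring (S.hsSubalgebra b))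

instance : Algebra ℂ (S.HSAlg b) := inferInstanceAs (Algebra ℂ (S.hsSubalgebra b))

/-- The underlying operator. -/
def op : S.HSAlg b →ₐ[ℂ] (H →L[ℂ] H) := (S.hsSubalgebra b).val

variable {S b} in
/-- An operator as an element of the algebra. -/
def mk (X : H →L[ℂ] H) (h : X ∈ S.hsSubalgebra b) : S.HSAlg b := ⟨X, h⟩

theorem op_mk (X : H →L[ℂ] H) (h : X ∈ S.hsSubalgebra b) : op S b (mk X h) = X := rfl

theorem op_injective : Function.Injective (op S b) := Subtype.val_injective

theorem mem (X : S.HSAlg b) :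
    Memℓp (fun i => (S.P * op S b X - op S b X * S.P) (b i)) 2 := X.2

/-- The Hilbert-Schmidt part `[P, X]`. -/
def comm : S.HSAlg b →ₗ[ℂ] lp (fun _ : ι => H) 2 where
  toFun X := hsVec b _ (mem S b X)
  map_add' X Y := by
    ext i
    change (S.P * op S b (X + Y) - op S b (X + Y) * S.P) (b i) =
      (S.P * op S b X - op S b X * S.P) (b i) + (S.P * op S b Y - op S b Y * S.P) (b i)
    rw [map_add, ← add_apply]
    congr 1
    noncomm_ring
  map_smul' a X := by
    ext i
    change (S.P * op S b (a • X) - op S b (a • X) * S.P) (b i) =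
      a • (S.P * op S b X - op S b X * S.P) (b i)
    rw [map_smul, mul_smul_comm, smul_mul_assoc, ← smul_sub]
    rfl

theorem comm_apply (X : S.HSAlg b) (i : ι) :
    comm S b X i = (S.P * op S b X - op S b X * S.P) (b i) := rfl

/-- `[P, ·]` is a derivation and the Hilbert-Schmidt operators form an ideal. -/
theorem norm_comm_mul_le (X Y : S.HSAlg b) :
    ‖comm S b (X * Y)‖ ≤ ‖comm S b X‖ * ‖op S b Y‖ + ‖op S b X‖ * ‖comm S b Y‖ := by
  have h : comm S b (X * Y) = hsVec b _ (memℓp_mul_right b (op S b Y) (mem S b X)) +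
      hsVec b _ (memℓp_mul_left b (op S b X) (mem S b Y)) := by
    ext i
    change (S.P * op S b (X * Y) - op S b (X * Y) * S.P) (b i) =
      ((S.P * op S b X - op S b X * S.P) * op S b Y) (b i) +
        (op S b X * (S.P * op S b Y - op S b Y * S.P)) (b i)
    rw [map_mul, ← add_apply]
    congr 1
    noncomm_ring
  rw [h]
  refine (norm_add_le _ _).trans (add_le_add ?_ ?_)
  · rw [mul_comm]
    exact norm_hsVec_le_of_hsSq_le b (mem S b X) _ (hsSq_mul_right_le _ _ _)
  · exact norm_hsVec_le_of_hsSq_le b (mem S b Y) _ (hsSq_mul_left_le _ _ _)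

instance : NormedRing (S.HSAlg b) :=
  { AddGroupNorm.toNormedAddCommGroup
      { toFun := fun X : S.HSAlg b => ‖op S b X‖ + ‖comm S b X‖
        map_zero' := by simp
        add_le' := fun X Y => by
          rw [map_add, map_add]
          linarith [norm_add_le (op S b X) (op S b Y), norm_add_le (comm S b X) (comm S b Y)]
        neg' := fun X => by rw [map_neg, map_neg, norm_neg, norm_neg]
        eq_zero_of_map_eq_zero' := fun X h => by
          have h1 : op S b X = 0 := norm_eq_zero.mp
            (le_antisymm (by linarith [norm_nonneg (comm S b X)]) (norm_nonneg _))
          exact op_injective S b (by rw [h1, map_zero]) },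
    (inferInstance : Ring (S.HSAlg b)) with
    norm_mul_le := fun X Y => by
      change ‖op S b (X * Y)‖ + ‖comm S b (X * Y)‖ ≤
        (‖op S b X‖ + ‖comm S b X‖) * (‖op S b Y‖ + ‖comm S b Y‖)
      rw [map_mul]
      nlinarith [norm_mul_le (op S b X) (op S b Y), norm_comm_mul_le S b X Y,
        mul_nonneg (norm_nonneg (comm S b X)) (norm_nonneg (comm S b Y))] }

theorem norm_def (X : S.HSAlg b) : ‖X‖ = ‖op S b X‖ + ‖comm S b X‖ := rfl

theorem norm_op_le (X : S.HSAlg b) : ‖op S b X‖ ≤ ‖X‖ :=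
  le_add_of_nonneg_right (norm_nonneg _)

theorem norm_comm_le (X : S.HSAlg b) : ‖comm S b X‖ ≤ ‖X‖ :=
  le_add_of_nonneg_left (norm_nonneg _)

instance : NormedAlgebra ℂ (S.HSAlg b) :=
  { (inferInstance : Algebra ℂ (S.HSAlg b)) with
    norm_smul_le := fun a X => by
      rw [norm_def, map_smul, map_smul, norm_smul, norm_smul, norm_def, mul_add] }

theorem continuous_op : Continuous (op S b) :=
  AddMonoidHomClass.continuous_of_bound (op S b) 1 fun X => by
    rw [one_mul]
    exact norm_op_le S b X

/-- A Cauchy sequence converges in operator norm and its commutators converge in `ℓ²`; the two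
limits are matched basis vector by basis vector. Completeness is what puts the exponentials back
into the algebra. -/
instance : CompleteSpace (S.HSAlg b) := by
  refine Metric.complete_of_cauchySeq_tendsto fun u hu => ?_
  have h1 : CauchySeq fun n => op S b (u n) :=
    hu.map (AddMonoidHomClass.uniformContinuous_of_bound (op S b) 1 fun X => by
      rw [one_mul]
      exact norm_op_le S b X)
  have h2 : CauchySeq fun n => comm S b (u n) :=
    hu.map (AddMonoidHomClass.uniformContinuous_of_bound (comm S b) 1 fun X => by
      rw [one_mul]
      exact norm_comm_le S b X)
  obtain ⟨X, hX⟩ := cauchySeq_tendsto_of_complete h1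
  obtain ⟨φ, hφ⟩ := cauchySeq_tendsto_of_complete h2
  have h3 : ∀ i, φ i = (S.P * X - X * S.P) (b i) := fun i => by
    have h4 := ((lp.evalCLM ℂ (fun _ : ι => H) 2 i).continuous.tendsto φ).comp hφ
    have h5 : Continuous fun Z : H →L[ℂ] H => (S.P * Z - Z * S.P) (b i) := by fun_prop
    exact tendsto_nhds_unique h4 ((h5.tendsto X).comp hX)
  have h6 : X ∈ S.hsSubalgebra b := by
    change Memℓp (fun i => (S.P * X - X * S.P) (b i)) 2
    rw [← funext h3]
    exact φ.2
  refine ⟨mk X h6, tendsto_iff_norm_sub_tendsto_zero.mpr ?_⟩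
  have h7 : comm S b (mk X h6) = φ := by
    ext i
    exact (h3 i).symm
  have h8 := (tendsto_iff_norm_sub_tendsto_zero.mp hX).add
    (tendsto_iff_norm_sub_tendsto_zero.mp hφ)
  rw [add_zero] at h8
  refine h8.congr fun n => ?_
  rw [norm_def, map_sub, map_sub, h7, op_mk]

variable {b}

theorem op_oneParam (X : S.HSAlg b) (t : ℝ) :
    op S b (oneParam X t) = oneParam (op S b X) t := by
  let _ : NormedAlgebra ℚ (S.HSAlg b) := NormedAlgebra.restrictScalars ℚ ℂ _
  let _ : NormedAlgebra ℚ (H →L[ℂ] H) := NormedAlgebra.restrictScalars ℚ ℂ _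
  rw [oneParam, oneParam, NormedSpace.map_exp (op S b) (continuous_op S b), map_smul]

/-- `e^{itX} Y e^{-itX}` in the algebra. -/
def evol (X Y : S.HSAlg b) (t : ℝ) : S.HSAlg b := oneParam X t * Y * oneParam X (-t)

theorem op_evol (X Y : S.HSAlg b) (t : ℝ) :
    op S b (evol S X Y t) = evolve (op S b X) (op S b Y) t := by
  rw [evol, map_mul, map_mul, op_oneParam, op_oneParam, evolve, oneParam, oneParam]
  push_cast
  rw [mul_neg]

theorem evol_zero (X Y : S.HSAlg b) : evol S X Y 0 = Y := by
  rw [evol, neg_zero, oneParam_zero, one_mul, mul_one]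

theorem hasDerivAt_evol (X Y : S.HSAlg b) (t : ℝ) :
    HasDerivAt (evol S X Y) (Complex.I • (X * evol S X Y t - evol S X Y t * X)) t := by
  have h := ((hasDerivAt_oneParam X t).mul_const Y).mul (hasDerivAt_oneParam_neg X t)
  have h1 : Commute X (oneParam X t) := commute_oneParam (Commute.refl X) t
  have h2 : Commute X (oneParam X (-t)) := commute_oneParam (Commute.refl X) _
  refine h.congr_deriv ?_
  rw [evol, mul_smul_comm, ← h1.eq, smul_sub, smul_mul_assoc, smul_mul_assoc, smul_mul_assoc,
    h2.eq, mul_neg, mul_smul_comm, ← sub_eq_add_neg]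
  simp only [mul_assoc]

variable (b) in
/-- The operators `γ` and `1`. -/
def twA (p : Bool) : S.HSAlg b := ⟨S.tw p, by
  have h : S.P * S.tw p - S.tw p * S.P = 0 := by
    ext f
    simp [S.P_tw]
  change Memℓp (fun i => (S.P * S.tw p - S.tw p * S.P) (b i)) 2
  rw [h]
  exact zero_memℓp⟩

theorem op_twA (p : Bool) : op S b (twA S b p) = S.tw p := rfl

theorem twA_mul_self (p : Bool) : twA S b p * twA S b p = 1 :=
  op_injective S b (ContinuousLinearMap.ext fun f => S.tw_tw p f)

variable (b) in
/-- The operator `q`. -/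
def qA : S.HSAlg b := ⟨S.q, by
  have h : S.P * S.q - S.q * S.P = 0 := by
    have h1 := S.P_idem
    have h2 := S.P_even
    rw [q, mul_sub, sub_mul, ← mul_assoc, h2, mul_assoc, mul_assoc, mul_sub, sub_mul, h1]
    simp
  change Memℓp (fun i => (S.P * S.q - S.q * S.P) (b i)) 2
  rw [h]
  exact zero_memℓp⟩

theorem op_qA : op S b (qA S b) = S.q := rfl

/-- The adjoint. -/
def adj (X : S.HSAlg b) : S.HSAlg b := ⟨ContinuousLinearMap.adjoint (op S b X), by
  have h : S.P * ContinuousLinearMap.adjoint (op S b X) -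
      ContinuousLinearMap.adjoint (op S b X) * S.P =
        ContinuousLinearMap.adjoint (-(S.P * op S b X - op S b X * S.P)) := by
    simp only [← ContinuousLinearMap.star_eq_adjoint, star_neg, star_sub, star_mul,
      S.P_selfAdjoint.star_eq]
    abel
  change Memℓp (fun i => (S.P * ContinuousLinearMap.adjoint (op S b X) -
      ContinuousLinearMap.adjoint (op S b X) * S.P) (b i)) 2
  rw [h]
  exact memℓp_adjoint b (mem S b X).neg⟩

theorem op_adj (X : S.HSAlg b) : op S b (adj S X) = ContinuousLinearMap.adjoint (op S b X) := rfl

end HSAlg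

variable {S}

theorem IsG2.mem {X : H →L[ℂ] H} (hX : S.IsG2 X) : X ∈ S.hsSubalgebra b := by
  have h : S.P * X - X * S.P = S.P * X * (1 - S.P) - (1 - S.P) * X * S.P := by noncomm_ring
  change Memℓp (fun i => (S.P * X - X * S.P) (b i)) 2
  rw [h]
  exact ((isHilbertSchmidt_iff b _).mp hX.hs₁).sub ((isHilbertSchmidt_iff b _).mp hX.hs₂)

theorem isG2_of_mem {X : S.HSAlg b} (hX : S.SelfDual (HSAlg.op S b X)) :
    S.IsG2 (HSAlg.op S b X) where
  selfDual := hX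
  hs₁ := by
    rw [isHilbertSchmidt_iff b]
    have h : S.P * HSAlg.op S b X * (1 - S.P) =
        S.P * (S.P * HSAlg.op S b X - HSAlg.op S b X * S.P) := by
      simp only [mul_sub, mul_one, ← mul_assoc, S.P_idem]
    rw [h]
    exact memℓp_mul_left b _ (HSAlg.mem S b X)
  hs₂ := by
    rw [isHilbertSchmidt_iff b]
    have h : (1 - S.P) * HSAlg.op S b X * S.P =
        (S.P - 1) * (S.P * HSAlg.op S b X - HSAlg.op S b X * S.P) := by
      rw [mul_sub, ← mul_assoc, sub_mul S.P 1 S.P, S.P_idem]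
      noncomm_ring
    rw [h]
    exact memℓp_mul_left b _ (HSAlg.mem S b X)

end NeutralSpace
end

noncomputable section

namespace NeutralSpace

variable {H : Type*} [NormedAddCommGroup H] [InnerProductSpace ℂ H] [CompleteSpace H]
variable (S : NeutralSpace H)

/-! ### Self-dual operators -/

theorem q_apply (f : H) : S.q f = S.P f - S.γ (f - S.P f) := by
  simp [q]

theorem q_of_P {f : H} (h : S.P f = f) : S.q f = f := by
  rw [q_apply, h, sub_self, map_zero, sub_zero]

theorem P_q (f : H) : S.P (S.q f) = S.P f := by
  rw [q_apply, map_sub, S.P_P, P_γ, map_sub, S.P_P, sub_self, map_zero, sub_zero]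

theorem γ_q (f : H) : S.γ (S.q f) = S.q (S.γ f) := by
  simp only [q_apply, map_sub, P_γ]

theorem q_q (f : H) : S.q (S.q f) = f := by
  simp only [q_apply, map_sub, P_γ, P_P, γ_γ]
  abel

theorem star_q : star S.q = S.q := by
  rw [q, star_sub, star_mul, star_sub, star_one, S.P_selfAdjoint.star_eq, S.γ_selfAdjoint.star_eq,
    sub_mul, mul_sub, S.P_even, one_mul, mul_one]

theorem inner_q (f g : H) : ⟪S.q f, g⟫_ℂ = ⟪f, S.q g⟫_ℂ := by
  conv_rhs => rw [← ContinuousLinearMap.adjoint_inner_left, ← ContinuousLinearMap.star_eq_adjoint,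
    S.star_q]

/-- `PJq = -γPJ` -/
theorem P_J_q (f : H) : S.P (S.J (S.q f)) = -S.γ (S.P (S.J f)) := by
  simp only [q_apply, map_sub, P_γ, P_P, P_J, J_even]
  abel

/-- `qJ = -γJq` -/
theorem q_J (f : H) : S.q (S.J f) = -S.γ (S.J (S.q f)) := by
  simp only [q_apply, map_sub, P_J, J_even, γ_γ]
  abel

theorem eps_apply (Y : H →L[ℂ] H) (f : H) : S.eps Y f =
    Y f - (1 / 2 : ℂ) • (Y (f - S.γ f) - S.γ (Y (f - S.γ f))) := by
  simp only [eps, oddProj, sub_apply, smul_apply, mul_apply_eq_comp, one_apply_eq_self, map_smul,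
    smul_smul, smul_sub, map_sub]
  norm_num
  abel

/-- On an odd vector, `ε` flips the odd component of `Y f`, exactly as `γ` does. -/
theorem eps_of_hom (Y : H →L[ℂ] H) {p : Bool} {f : H} (hf : S.Hom p f) :
    S.eps Y f = S.tw p (Y f) := by
  rw [eps_apply]
  cases p
  · simp only [Hom, cond_false] at hf
    simp [hf, tw]
  · simp only [Hom, cond_true] at hf
    rw [hf, sub_neg_eq_add, ← two_smul ℂ f, map_smul, map_smul, ← smul_sub, smul_smul]
    simp [tw]

variable {S}

/-- The adjoint of a self-dual operator. -/
theorem SelfDual.adjoint_apply {Y : H →L[ℂ] H} (hY : S.SelfDual Y) (f : H) :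
    ContinuousLinearMap.adjoint Y f = S.J (S.q (S.eps Y (S.J (S.q f)))) := by
  refine ext_inner_right ℂ fun v => ?_
  rw [ContinuousLinearMap.adjoint_inner_left, hY v, ← S.inner_q, S.inner_J_right,
    ContinuousLinearMap.adjoint_inner_left, S.inner_q, S.inner_J_left]

theorem selfDual_of_adjoint {Y : H →L[ℂ] H}
    (h : ∀ f, ContinuousLinearMap.adjoint Y f = S.J (S.q (S.eps Y (S.J (S.q f))))) :
    S.SelfDual Y := fun f => by
  refine ext_inner_left ℂ fun u => ?_
  rw [← ContinuousLinearMap.adjoint_inner_left, h, ← S.inner_q, S.inner_J_right,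
    ContinuousLinearMap.adjoint_inner_left, S.inner_q, S.inner_J_left]

/-- On `P H` the operator `q` is the identity, so self-duality expresses the adjoint through the
action of `Y` on `J P H`. This and the next lemma convert the coefficients of an adjoint into those
of `Y`. -/
theorem SelfDual.P_adjoint {Y : H →L[ℂ] H} (hY : S.SelfDual Y) {p : Bool} {f : H}
    (hf : S.Hom p f) (hP : S.P f = f) :
    S.P (ContinuousLinearMap.adjoint Y f) = -S.tw p (S.γ (S.P (S.J (Y (S.J f))))) := by
  rw [hY.adjoint_apply, S.q_of_P hP, P_J_q, S.eps_of_hom Y hf.J, S.J_tw, S.P_tw, S.γ_tw]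

theorem SelfDual.P_J_adjoint {Y : H →L[ℂ] H} (hY : S.SelfDual Y) {p : Bool} {f : H}
    (hf : S.Hom p f) (hP : S.P f = f) :
    S.P (S.J (ContinuousLinearMap.adjoint Y f)) = S.tw p (S.P (Y (S.J f))) := by
  rw [hY.adjoint_apply, S.q_of_P hP, S.J_invol, P_q, S.eps_of_hom Y hf.J, S.P_tw]

/-- Self-duality, as the symmetry of a bilinear form on `P H`. -/
theorem SelfDual.inner_symm {Y : H →L[ℂ] H} (hY : S.SelfDual Y) {p : Bool} {f g : H}
    (hf : S.Hom p f) (hPf : S.P f = f) (hPg : S.P g = g) :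
    ⟪g, S.tw p (S.γ (S.P (S.J (Y f))))⟫_ℂ = ⟪f, S.γ (S.P (S.J (Y g)))⟫_ℂ := by
  have h1 : ⟪f, S.γ (S.P (S.J (Y g)))⟫_ℂ =
      ⟪g, ContinuousLinearMap.adjoint Y (S.γ (S.J f))⟫_ℂ := by
    rw [← S.inner_γ, ← S.inner_P, P_γ, hPf, S.inner_J_right, S.J_even,
      ContinuousLinearMap.adjoint_inner_right]
  have h2 : S.q (S.γ (S.J f)) = -S.J f := by
    rw [← S.γ_q, S.q_J, S.q_of_P hPf, map_neg, γ_γ]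
  rw [h1, hY.adjoint_apply, h2, map_neg, S.J_invol, map_neg, S.eps_of_hom Y hf]
  rw [← hPg, S.inner_P, S.inner_P, P_J_q]
  simp only [map_neg, neg_neg, S.P_tw, S.P_γ, S.P_P, S.J_tw, S.γ_tw]

theorem SelfDual.conj_γ {Y : H →L[ℂ] H} (hY : S.SelfDual Y) : S.SelfDual (S.γ * Y * S.γ) :=
  selfDual_of_adjoint fun f => by
    have h : ContinuousLinearMap.adjoint (S.γ * Y * S.γ) =
        S.γ * ContinuousLinearMap.adjoint Y * S.γ := by
      simp only [← ContinuousLinearMap.star_eq_adjoint, star_mul, S.γ_selfAdjoint.star_eq,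
        mul_assoc]
    rw [h, mul_apply_eq_comp, mul_apply_eq_comp, hY.adjoint_apply]
    simp only [eps_apply, mul_apply_eq_comp, ← γ_q, S.J_even, map_sub, γ_γ, map_smulₛₗ, smul_sub]
    abel

theorem SelfDual.conj_tw {Y : H →L[ℂ] H} (hY : S.SelfDual Y) (p : Bool) :
    S.SelfDual (S.tw p * Y * S.tw p) := by
  cases p
  · simpa [tw] using hY
  · exact hY.conj_γ

theorem adjoint_conj_q (Y : H →L[ℂ] H) :
    ContinuousLinearMap.adjoint (S.q * ContinuousLinearMap.adjoint Y * S.q) = S.q * Y * S.q := by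
  simp only [← ContinuousLinearMap.star_eq_adjoint, star_mul, star_q, star_star, mul_assoc]

/-- `ε` commutes with taking adjoints and, `q` being even, with multiplication by `q`. -/
theorem SelfDual.dag {Y : H →L[ℂ] H} (hY : S.SelfDual Y) :
    S.SelfDual (S.q * ContinuousLinearMap.adjoint Y * S.q) := by
  have hε : ∀ f, ContinuousLinearMap.adjoint (S.eps Y) f =
      S.eps (ContinuousLinearMap.adjoint Y) f := fun f => by
    have h1 : star S.oddProj = S.oddProj := by
      simp [oddProj, S.γ_selfAdjoint.star_eq]
    rw [eps, eps, ← ContinuousLinearMap.star_eq_adjoint, ← ContinuousLinearMap.star_eq_adjoint,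
      star_sub, star_smul, star_mul, star_mul, h1, mul_assoc]
    simp
  refine selfDual_of_adjoint fun f => ?_
  have h2 := hY (S.q f)
  rw [hε] at h2
  rw [adjoint_conj_q, mul_apply_eq_comp, mul_apply_eq_comp, h2]
  have h3 : ∀ g, S.eps (S.q * ContinuousLinearMap.adjoint Y * S.q) g =
      S.q (S.eps (ContinuousLinearMap.adjoint Y) (S.q g)) := fun g => by
    simp only [eps_apply, mul_apply_eq_comp, map_sub, ← γ_q, map_smul]
  rw [h3, S.q_q, S.q_q]

variable (S)

theorem norm_conj_le (T : H →L[ℂ] H) (f : H) :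
    ‖S.q (S.J (T (S.J (S.q f))))‖ ≤ ‖S.q‖ * ‖T‖ * ‖S.q‖ * ‖f‖ := by
  refine (S.q.le_opNorm _).trans ?_
  rw [S.J.norm_map, mul_assoc, mul_assoc]
  gcongr
  refine (T.le_opNorm _).trans ?_
  rw [S.J.norm_map]
  gcongr
  exact S.q.le_opNorm _

/-- Conjugation with the antiunitary operator `qJ`. -/
def conjK : (H →L[ℂ] H) →+* (H →L[ℂ] H) where
  toFun T := LinearMap.mkContinuous
    { toFun := fun f => S.q (S.J (T (S.J (S.q f))))
      map_add' := fun f g => by simp only [map_add]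
      map_smul' := fun a f => by simp [map_smulₛₗ] } (‖S.q‖ * ‖T‖ * ‖S.q‖) (S.norm_conj_le T)
  map_one' := ContinuousLinearMap.ext fun f => by
    change S.q (S.J (S.J (S.q f))) = f
    rw [S.J_invol, S.q_q]
  map_mul' T R := ContinuousLinearMap.ext fun f => by
    change S.q (S.J (T (R (S.J (S.q f))))) =
      S.q (S.J (T (S.J (S.q (S.q (S.J (R (S.J (S.q f)))))))))
    rw [S.q_q, S.J_invol]
  map_zero' := ContinuousLinearMap.ext fun f => by
    change S.q (S.J 0) = 0
    rw [map_zero, map_zero]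
  map_add' T R := ContinuousLinearMap.ext fun f => by
    change S.q (S.J (T (S.J (S.q f)) + R (S.J (S.q f)))) = _
    rw [map_add, map_add]
    rfl

theorem conjK_apply (T : H →L[ℂ] H) (f : H) : S.conjK T f = S.q (S.J (T (S.J (S.q f)))) := rfl

theorem conjK_smul (a : ℂ) (T : H →L[ℂ] H) : S.conjK (a • T) = conj a • S.conjK T :=
  ContinuousLinearMap.ext fun f => by
    rw [smul_apply, conjK_apply, conjK_apply, smul_apply, map_smulₛₗ, map_smul]

theorem continuous_conjK : Continuous S.conjK :=
  AddMonoidHomClass.continuous_of_bound S.conjK (‖S.q‖ * ‖S.q‖) fun T =>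
    (ContinuousLinearMap.opNorm_le_bound _ (by positivity) (S.norm_conj_le T)).trans
      (le_of_eq (by ring))

variable {S}

theorem selfDual_iff {Y : H →L[ℂ] H} :
    S.SelfDual Y ↔ Y = -S.conjK (star (S.eps Y)) * S.γ := by
  rw [ContinuousLinearMap.ext_iff]
  refine forall_congr' fun f => ?_
  rw [mul_apply_eq_comp, neg_apply, conjK_apply, ← γ_q, J_even, S.q_J f,
    ContinuousLinearMap.star_eq_adjoint]
  simp only [map_neg]

theorem eps_mul_left {X : H →L[ℂ] H} (hX : S.IsEven X) (Y : H →L[ℂ] H) :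
    S.eps (X * Y) = X * S.eps Y := by
  have h : S.oddProj * X = X * S.oddProj := by
    simp only [oddProj, smul_mul_assoc, mul_smul_comm, sub_mul, mul_sub, one_mul, mul_one, hX.symm]
  simp only [eps, mul_sub, mul_smul_comm, ← mul_assoc, h]

theorem eps_mul_right {X : H →L[ℂ] H} (hX : S.IsEven X) (Y : H →L[ℂ] H) :
    S.eps (Y * X) = S.eps Y * X := by
  have h : X * S.oddProj = S.oddProj * X := by
    simp only [oddProj, smul_mul_assoc, mul_smul_comm, sub_mul, mul_sub, one_mul, mul_one, hX.symm]
  simp only [eps, sub_mul, smul_mul_assoc, mul_assoc, h]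

/-- For even `X` one has `ε(X) = X γ`, and self-duality loses its sign rule: it says that `X` is odd
under the anti-automorphism `T ↦ qJ T* Jq`. Such operators exponentiate to elements inverted by it.
-/
theorem conjK_star {X : H →L[ℂ] H} (hX : S.IsEven X) (hd : S.SelfDual X) :
    S.conjK (star X) = -X := by
  have h1 : S.eps X = X * S.γ := by
    ext f
    have h : ∀ g, S.γ (X g) = X (S.γ g) := fun g => (DFunLike.congr_fun hX g).symm
    simp only [eps_apply, h, mul_apply_eq_comp, map_sub, γ_γ]
    module
  have h2 : S.conjK S.γ = S.γ := by
    ext f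
    rw [conjK_apply, ← S.J_even, S.J_invol, ← γ_q, q_q]
  have h3 := selfDual_iff.mp hd
  rw [h1, star_mul, S.γ_selfAdjoint.star_eq, map_mul, h2] at h3
  have h4 : star X * S.γ = S.γ * star X := by
    have := congrArg star hX
    rw [star_mul, star_mul, S.γ_selfAdjoint.star_eq] at this
    exact this.symm
  rw [← h2, ← map_mul, ← h4, map_mul, h2] at h3
  rw [neg_mul, mul_assoc, S.γ_sq, mul_one] at h3
  rw [h3, neg_neg, ← h3]

theorem SelfDual.commutator {X Y : H →L[ℂ] H} (hX : S.IsEven X) (hd : S.SelfDual X)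
    (hY : S.SelfDual Y) : S.SelfDual (X * Y - Y * X) := by
  have h1 : S.eps (X * Y - Y * X) = X * S.eps Y - S.eps Y * X := by
    rw [← eps_mul_left hX, ← eps_mul_right hX, eps, eps, eps]
    simp only [mul_sub, sub_mul, smul_sub]
    abel
  have h2 := selfDual_iff.mp hY
  rw [selfDual_iff, h1, star_sub, star_mul, star_mul, map_sub, map_mul, map_mul, conjK_star hX hd]
  conv_lhs => rw [h2]
  have h3 : X * S.γ = S.γ * X := hX
  simp only [mul_neg, neg_mul, sub_mul, mul_assoc, h3]
  abel

theorem IsEven.oneParam {X : H →L[ℂ] H} (hX : S.IsEven X) (t : ℝ) : S.IsEven (oneParam X t) :=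
  (commute_oneParam (show Commute S.γ X from hX.symm) t).symm

theorem evolve_eq (X Y : H →L[ℂ] H) (t : ℝ) :
    evolve X Y t = _root_.oneParam X t * Y * _root_.oneParam X (-t) := by
  rw [evolve, _root_.oneParam, _root_.oneParam]
  push_cast
  rw [mul_neg]

theorem star_oneParam (X : H →L[ℂ] H) (t : ℝ) :
    star (oneParam X t) = oneParam (star X) (-t) := by
  let _ : NormedAlgebra ℚ (H →L[ℂ] H) := NormedAlgebra.restrictScalars ℚ ℂ _
  rw [_root_.oneParam, _root_.oneParam, NormedSpace.star_exp, star_smul]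
  congr 2
  simp

theorem conjK_oneParam (X : H →L[ℂ] H) (t : ℝ) :
    S.conjK (oneParam X t) = oneParam (S.conjK X) (-t) := by
  let _ : NormedAlgebra ℚ (H →L[ℂ] H) := NormedAlgebra.restrictScalars ℚ ℂ _
  rw [_root_.oneParam, _root_.oneParam, NormedSpace.map_exp _ S.continuous_conjK, conjK_smul]
  congr 2
  simp

theorem oneParam_neg (X : H →L[ℂ] H) (t : ℝ) : oneParam (-X) t = oneParam X (-t) := by
  rw [_root_.oneParam, _root_.oneParam, smul_neg, ← neg_smul]
  push_cast
  rw [mul_neg]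

/-- The anti-automorphism `T ↦ qJ T* Jq` inverts `e^{isX}`, while `γ` commutes with it and `ε` lets
even factors through on both sides; so conjugation with `e^{itX}` preserves the self-duality of any
`Y`, even or not. -/
theorem SelfDual.evolve {X Y : H →L[ℂ] H} (hX : S.IsEven X) (hd : S.SelfDual X)
    (hY : S.SelfDual Y) (t : ℝ) : S.SelfDual (evolve X Y t) := by
  have h1 : ∀ s, S.conjK (star (oneParam X s)) = oneParam X (-s) := fun s => by
    rw [star_oneParam, conjK_oneParam, conjK_star hX hd, neg_neg, oneParam_neg]
  have h2 := selfDual_iff.mp hY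
  have h3 : ∀ s, oneParam X s * S.γ = S.γ * oneParam X s := fun s => hX.oneParam s
  rw [evolve_eq, selfDual_iff, eps_mul_right (hX.oneParam _), eps_mul_left (hX.oneParam _),
    star_mul, star_mul, map_mul, map_mul, h1, h1, neg_neg]
  conv_lhs => rw [h2]
  simp only [mul_neg, neg_mul, mul_assoc, h3]

theorem q_sq : S.q * S.q = 1 := ContinuousLinearMap.ext fun f => S.q_q f

theorem oneParam_conj_q (X : H →L[ℂ] H) (t : ℝ) :
    oneParam (S.q * X * S.q) t = S.q * oneParam X t * S.q := by
  let _ : NormedAlgebra ℚ (H →L[ℂ] H) := NormedAlgebra.restrictScalars ℚ ℂ _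
  have h := NormedSpace.exp_units_conj ⟨S.q, S.q, q_sq, q_sq⟩ ((Complex.I * t : ℂ) • X)
  rw [_root_.oneParam, _root_.oneParam, ← smul_mul_assoc, ← mul_smul_comm]
  exact h

theorem star_evolve {X Y : H →L[ℂ] H} (hX : star X = S.q * X * S.q)
    (hY : star Y = S.q * Y * S.q) (t : ℝ) :
    star (evolve X Y t) = S.q * evolve X Y t * S.q := by
  have h : ∀ T : H →L[ℂ] H, S.q * (S.q * T) = T := fun T => by rw [← mul_assoc, q_sq, one_mul]
  rw [evolve_eq, star_mul, star_mul, star_oneParam, star_oneParam, hX, hY, oneParam_conj_q,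
    oneParam_conj_q, neg_neg]
  simp only [mul_assoc, h]

end NeutralSpace
end

/-! ### Second quantisation and its number bounds -/

noncomputable section

section Summation

variable {E : Type*} [NormedAddCommGroup E] {ι : Type*}

/-- The convergence criterion for the three series of dΓ: the finite sums are controlled in square,
which does not require absolute convergence. -/
theorem summable_of_norm_sum_sq_le [CompleteSpace E] {x : ι → E} {r : ι → ℝ} {C : ℝ}
    (hr : Summable r) (h : ∀ F : Finset ι, ‖∑ i ∈ F, x i‖ ^ 2 ≤ C * ∑ i ∈ F, r i) :
    Summable x := by
  rw [summable_iff_vanishing_norm]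
  intro ε hε
  have hC : 0 < |C| + 1 := by positivity
  obtain ⟨s, hs⟩ := summable_iff_vanishing_norm.mp hr (ε ^ 2 / (|C| + 1)) (by positivity)
  refine ⟨s, fun t ht => ?_⟩
  have h1 := hs t ht
  rw [Real.norm_eq_abs, lt_div_iff₀ hC] at h1
  refine lt_of_pow_lt_pow_left₀ 2 hε.le ((h t).trans_lt ?_)
  have h2 : C * ∑ i ∈ t, r i ≤ |C| * |∑ i ∈ t, r i| := by
    rw [← abs_mul]
    exact le_abs_self _
  nlinarith [abs_nonneg (∑ i ∈ t, r i)]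

theorem norm_sq_le_of_hasSum {x : ι → E} {r : ι → ℝ} {C b : ℝ} {a : E}
    (hx : HasSum x a) (hr : HasSum r b)
    (h : ∀ F : Finset ι, ‖∑ i ∈ F, x i‖ ^ 2 ≤ C * ∑ i ∈ F, r i) : ‖a‖ ^ 2 ≤ C * b :=
  le_of_tendsto_of_tendsto (hx.norm.pow 2) (hr.const_mul C) (Filter.Eventually.of_forall h)

end Summation

namespace EllTwo

variable {C : Type*} {num : C → ℕ} {ι V : Type*} [AddCommGroup V] [Module ℂ V]

/-- The series `∑ i, T i ψ` converges in `fin num`. -/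
def SummableOp (T : ι → fin num →ₗ[ℂ] fin num) : Prop :=
  ∀ ψ, (∃ m, ∀ i, (T i ψ : EllTwo C) ∈ lev num m) ∧ Summable fun i => (T i ψ : EllTwo C)

/-- The sum of a family of operators. -/
def sumOp (T : ι → fin num →ₗ[ℂ] fin num) (h : SummableOp T) : fin num →ₗ[ℂ] fin num where
  toFun ψ := ⟨∑' i, (T i ψ : EllTwo C), by
    obtain ⟨⟨m, hm⟩, h2⟩ := h ψ
    exact ⟨m, (isClosed_lev m).mem_of_tendsto h2.hasSum
      (Filter.Eventually.of_forall fun F => Submodule.sum_mem _ fun i _ => hm i)⟩⟩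
  map_add' ψ φ := Subtype.ext (by
    simp only [map_add, Submodule.coe_add]
    exact (h ψ).2.tsum_add (h φ).2)
  map_smul' a ψ := Subtype.ext (by
    simp only [map_smul, Submodule.coe_smul]
    exact (h ψ).2.tsum_const_smul a)

theorem hasSum_sumOp {T : ι → fin num →ₗ[ℂ] fin num} (h : SummableOp T) (ψ : fin num) :
    HasSum (fun i => (T i ψ : EllTwo C)) (sumOp T h ψ : EllTwo C) := (h ψ).2.hasSum

/-- The sum of a family of operators that depend linearly on a parameter. -/
def sumOpLin (T : ι → V →ₗ[ℂ] (fin num →ₗ[ℂ] fin num)) (h : ∀ v, SummableOp fun i => T i v) :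
    V →ₗ[ℂ] (fin num →ₗ[ℂ] fin num) where
  toFun v := sumOp (fun i => T i v) (h v)
  map_add' v w := LinearMap.ext fun ψ => Subtype.ext
    ((hasSum_sumOp (h (v + w)) ψ).unique
      (((hasSum_sumOp (h v) ψ).add (hasSum_sumOp (h w) ψ)).congr_fun fun i => by
        rw [map_add]
        rfl))
  map_smul' a v := LinearMap.ext fun ψ => Subtype.ext
    ((hasSum_sumOp (h (a • v)) ψ).unique
      (((hasSum_sumOp (h v) ψ).const_smul a).congr_fun fun i => by
        rw [map_smul]
        rfl))

theorem hasSum_sumOpLin {T : ι → V →ₗ[ℂ] (fin num →ₗ[ℂ] fin num)}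
    (h : ∀ v, SummableOp fun i => T i v) (v : V) (ψ : fin num) :
    HasSum (fun i => (T i v ψ : EllTwo C)) (sumOpLin T h v ψ : EllTwo C) :=
  hasSum_sumOp (h v) ψ

theorem hasSum_coord {x : ι → EllTwo C} {a : EllTwo C} (h : HasSum x a) (c : C) :
    HasSum (fun i => x i c) (a c) := (lp.evalCLM ℂ (fun _ : C => ℂ) 2 c).hasSum h

theorem Banded.add {T T' : fin num →ₗ[ℂ] fin num} {B B' : ℝ} (h : Banded T B)
    (h' : Banded T' B') : Banded (T + T') (B + B') where
  nonneg := add_nonneg h.nonneg h'.nonneg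
  band n ψ hψ c hc := by
    by_cases h1 : (T ψ : EllTwo C) c = 0
    · refine h'.band n ψ hψ c fun h2 => hc ?_
      change (T ψ : EllTwo C) c + (T' ψ : EllTwo C) c = 0
      rw [h1, h2, add_zero]
    · exact h.band n ψ hψ c h1
  bound n ψ hψ := by
    rw [add_mul, add_mul]
    exact (norm_add_le _ _).trans (add_le_add (h.bound n ψ hψ) (h'.bound n ψ hψ))

end EllTwo

open EllTwo Config

namespace NeutralSpace

variable {H : Type*} [NormedAddCommGroup H] [InnerProductSpace ℂ H] [CompleteSpace H]
variable (S : NeutralSpace H)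

theorem norm_γ (f : H) : ‖S.γ f‖ = ‖f‖ := by
  have h : ‖S.γ f‖ ^ 2 = ‖f‖ ^ 2 := by
    rw [← inner_self_eq_norm_sq (𝕜 := ℂ), S.inner_γ, γ_γ, inner_self_eq_norm_sq]
  exact (pow_left_inj₀ (norm_nonneg _) (norm_nonneg _) two_ne_zero).mp h

theorem norm_tw (p : Bool) (f : H) : ‖S.tw p f‖ = ‖f‖ := by
  cases p
  · rfl
  · exact S.norm_γ f

end NeutralSpace

namespace ModeBasis

variable {H : Type*} [NormedAddCommGroup H] [InnerProductSpace ℂ H] [CompleteSpace H]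
variable {S : NeutralSpace H} {I K : Type*} (e : ModeBasis S I K)

/-- The Banach algebra in which the operators of `g₂` live. -/
abbrev Alg : Type _ := S.HSAlg e.basis

open NeutralSpace

variable {e}

theorem comm_inr (X : e.Alg) (j : I ⊕ K) :
    HSAlg.comm S e.basis X (.inr j) = S.P (HSAlg.op S e.basis X (S.J (e.vec j))) := by
  rw [HSAlg.comm_apply, e.coe_basis]
  simp only [dvec, Sum.elim_inr, sub_apply, mul_apply_eq_comp, e.P_J_vec, map_zero, sub_zero]

theorem norm_comm_inl (X : e.Alg) (j : I ⊕ K) :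
    ‖HSAlg.comm S e.basis X (.inl j)‖ =
      ‖S.γ (S.P (S.J (HSAlg.op S e.basis X (e.vec j))))‖ := by
  rw [HSAlg.comm_apply, e.coe_basis, norm_γ, P_J, ← map_sub, S.J.norm_map, norm_sub_rev]
  simp only [dvec, Sum.elim_inl, sub_apply, mul_apply_eq_comp, e.P_vec]

/-- The two halves of the basis split `‖[P, X]‖₂²`: the vectors `J eⱼ` give the coefficients of pair
creation and the vectors `eⱼ` those of pair annihilation. -/
theorem hasSum_norm_comm (X : e.Alg) : ∃ a b : ℝ, a ≤ ‖X‖ ^ 2 ∧ b ≤ ‖X‖ ^ 2 ∧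
    HasSum (fun j => ‖S.P (HSAlg.op S e.basis X (S.J (e.vec j)))‖ ^ 2) a ∧
    HasSum (fun j => ‖S.γ (S.P (S.J (HSAlg.op S e.basis X (e.vec j))))‖ ^ 2) b := by
  have h0 := hasSum_hsVec e.basis (HSAlg.mem S e.basis X)
  have h : HasSum (fun i => ‖HSAlg.comm S e.basis X i‖ ^ 2) (‖HSAlg.comm S e.basis X‖ ^ 2) := h0
  have hle : ‖HSAlg.comm S e.basis X‖ ^ 2 ≤ ‖X‖ ^ 2 := by
    gcongr
    exact HSAlg.norm_comm_le S e.basis X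
  have key : ∀ k : I ⊕ K → (I ⊕ K) ⊕ (I ⊕ K), Function.Injective k →
      ∃ a ≤ ‖X‖ ^ 2, HasSum (fun j => ‖HSAlg.comm S e.basis X (k j)‖ ^ 2) a := fun k hk => by
    have h1 : ∀ F : Finset (I ⊕ K), ∑ j ∈ F, ‖HSAlg.comm S e.basis X (k j)‖ ^ 2 ≤ ‖X‖ ^ 2 :=
      fun F => by
        have h2 := sum_le_hasSum (F.map ⟨k, hk⟩) (fun _ _ => by positivity) h
        rw [Finset.sum_map] at h2
        exact h2.trans hle
    have h3 : Summable fun j => ‖HSAlg.comm S e.basis X (k j)‖ ^ 2 :=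
      summable_of_sum_le (fun _ => by positivity) h1
    exact ⟨_, h3.tsum_le_of_sum_le h1, h3.hasSum⟩
  obtain ⟨a, ha, hsa⟩ := key _ Sum.inr_injective
  obtain ⟨b, hb, hsb⟩ := key _ Sum.inl_injective
  simp only [comm_inr] at hsa
  simp only [norm_comm_inl] at hsb
  exact ⟨a, b, ha, hb, hsa, hsb⟩

variable (e) [LinearOrder K]

/-- The terms of `(P X P) a†a`. -/
def term₁ (j : I ⊕ K) : e.Alg →ₗ[ℂ] (FinFock I K →ₗ[ℂ] FinFock I K) where
  toFun X := e.cr (S.P (HSAlg.op S e.basis X (e.vec j))) ∘ₗ e.an (e.vec j)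
  map_add' X Y := by rw [map_add, add_apply, map_add, cr_add, LinearMap.add_comp]
  map_smul' a X := by
    rw [map_smul, smul_apply, map_smul, cr_smul, LinearMap.smul_comp, RingHom.id_apply]

/-- The terms of `(P X J J' P) a†a†`. -/
def term₂ (j : I ⊕ K) : e.Alg →ₗ[ℂ] (FinFock I K →ₗ[ℂ] FinFock I K) where
  toFun X := e.cr (S.P (HSAlg.op S e.basis X (S.J (e.vec j)))) ∘ₗ e.cr (e.vec j)
  map_add' X Y := by rw [map_add, add_apply, map_add, cr_add, LinearMap.add_comp]
  map_smul' a X := by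
    rw [map_smul, smul_apply, map_smul, cr_smul, LinearMap.smul_comp, RingHom.id_apply]

/-- The terms of `(γ P J' J X P) aa`. -/
def term₃ (j : I ⊕ K) : e.Alg →ₗ[ℂ] (FinFock I K →ₗ[ℂ] FinFock I K) where
  toFun X := e.an (S.γ (S.P (S.J (HSAlg.op S e.basis X (e.vec j))))) ∘ₗ e.an (e.vec j)
  map_add' X Y := by
    rw [map_add, add_apply, map_add, map_add, map_add, an_add, LinearMap.add_comp]
  map_smul' a X := by
    rw [map_smul, smul_apply, map_smulₛₗ, map_smul, map_smul, an_smul, LinearMap.smul_comp,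
      RingHom.id_apply, starRingEnd_apply, starRingEnd_apply, star_star]

theorem hasSum_norm_an_vec {ψ : FinFock I K} {m : ℕ} (hψ : (ψ : Fock I K) ∈ lev num m) :
    ∃ a : ℝ, a ≤ m * ‖ψ‖ ^ 2 ∧ HasSum (fun j => ‖e.an (e.vec j) ψ‖ ^ 2) a := by
  have h : Summable fun j => ‖e.an (e.vec j) ψ‖ ^ 2 :=
    summable_of_sum_le (fun _ => by positivity) fun F => e.sum_norm_an_vec_sq_le F hψ
  exact ⟨_, h.tsum_le_of_sum_le fun F => e.sum_norm_an_vec_sq_le F hψ, h.hasSum⟩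

theorem norm_sum_term₁_le (X : e.Alg) {ψ : FinFock I K} {m : ℕ}
    (hψ : (ψ : Fock I K) ∈ lev num m) (F : Finset (I ⊕ K)) :
    ‖∑ j ∈ F, (e.term₁ j X ψ : Fock I K)‖ ^ 2 ≤
      (m + 1) * ‖X‖ ^ 2 * ∑ j ∈ F, ‖e.an (e.vec j) ψ‖ ^ 2 := by
  have h := e.norm_sum_cr_sq_le (HSAlg.op S e.basis X) F
    (fun j => lev_mono (Nat.sub_le m 1) (e.an_mem_lev (e.vec j) hψ))
  have h1 : ‖HSAlg.op S e.basis X‖ ^ 2 ≤ ‖X‖ ^ 2 := by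
    gcongr
    exact HSAlg.norm_op_le S e.basis X
  rw [← AddSubmonoidClass.coe_finsetSum]
  simp only [term₁, LinearMap.coe_mk, AddHom.coe_mk, LinearMap.comp_apply, cr_P]
  refine h.trans ?_
  gcongr

/-- The two creation operators are exchanged first, so that the orthonormal `eⱼ` stand on the left
and `norm_sum_cr_sq_le` applies with `T = 1`; the other factors are then square summable. -/
theorem norm_sum_term₂_le (X : e.Alg) {ψ : FinFock I K} {m : ℕ}
    (hψ : (ψ : Fock I K) ∈ lev num m) (F : Finset (I ⊕ K)) :
    ‖∑ j ∈ F, (e.term₂ j X ψ : Fock I K)‖ ^ 2 ≤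
      (m + 2) * ((m + 1) * ‖ψ‖ ^ 2) *
        ∑ j ∈ F, ‖S.P (HSAlg.op S e.basis X (S.J (e.vec j)))‖ ^ 2 := by
  have h := e.norm_sum_cr_sq_le 1 F (fun j => e.cr_mem_lev
    (S.tw j.isRight (S.P (HSAlg.op S e.basis X (S.J (e.vec j))))) hψ)
  have h1 : ‖(1 : H →L[ℂ] H)‖ ^ 2 ≤ 1 := pow_le_one₀ (norm_nonneg _) ContinuousLinearMap.norm_id_le
  rw [← AddSubmonoidClass.coe_finsetSum]
  simp only [term₂, LinearMap.coe_mk, AddHom.coe_mk, LinearMap.comp_apply, cr_cr_vec]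
  refine h.trans ?_
  push_cast
  have h2 : ∀ j ∈ F,
      ‖e.cr (S.tw j.isRight (S.P (HSAlg.op S e.basis X (S.J (e.vec j))))) ψ‖ ^ 2 ≤
        (m + 1) * ‖ψ‖ ^ 2 * ‖S.P (HSAlg.op S e.basis X (S.J (e.vec j)))‖ ^ 2 := fun j _ => by
    refine (e.norm_cr_sq_le _ hψ).trans (le_of_eq ?_)
    rw [norm_tw]
    ring
  have h3 := Finset.sum_le_sum h2
  have h4 : ((m : ℝ) + 1 + 1) * ‖(1 : H →L[ℂ] H)‖ ^ 2 ≤ m + 2 := by nlinarith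
  have h5 := mul_le_mul h4 h3 (Finset.sum_nonneg fun _ _ => by positivity) (by positivity)
  refine h5.trans (le_of_eq ?_)
  rw [← Finset.mul_sum]
  ring

/-- Cauchy-Schwarz between the square summable coefficient vectors and `∑ ‖aⱼ ψ‖² ≤ m ‖ψ‖²`. -/
theorem norm_sum_term₃_le (X : e.Alg) {ψ : FinFock I K} {m : ℕ}
    (hψ : (ψ : Fock I K) ∈ lev num m) (F : Finset (I ⊕ K)) :
    ‖∑ j ∈ F, (e.term₃ j X ψ : Fock I K)‖ ^ 2 ≤
      (m + 1) * (m * ‖ψ‖ ^ 2) *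
        ∑ j ∈ F, ‖S.γ (S.P (S.J (HSAlg.op S e.basis X (e.vec j))))‖ ^ 2 := by
  set r : I ⊕ K → ℝ := fun j => ‖S.γ (S.P (S.J (HSAlg.op S e.basis X (e.vec j))))‖
  have h1 : ‖∑ j ∈ F, (e.term₃ j X ψ : Fock I K)‖ ≤
      √(m + 1) * ∑ j ∈ F, r j * ‖e.an (e.vec j) ψ‖ := by
    refine (norm_sum_le _ _).trans ?_
    rw [Finset.mul_sum]
    refine Finset.sum_le_sum fun j _ => ?_
    rw [← mul_assoc]
    exact e.norm_an_le _ (lev_mono (Nat.sub_le m 1) (e.an_mem_lev (e.vec j) hψ))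
  calc ‖∑ j ∈ F, (e.term₃ j X ψ : Fock I K)‖ ^ 2
      ≤ (√(m + 1) * ∑ j ∈ F, r j * ‖e.an (e.vec j) ψ‖) ^ 2 := by gcongr
    _ = (m + 1) * (∑ j ∈ F, r j * ‖e.an (e.vec j) ψ‖) ^ 2 := by
        rw [mul_pow, Real.sq_sqrt (by positivity)]
    _ ≤ (m + 1) * ((∑ j ∈ F, r j ^ 2) * ∑ j ∈ F, ‖e.an (e.vec j) ψ‖ ^ 2) := by
        gcongr
        exact Finset.sum_mul_sq_le_sq_mul_sq _ _ _
    _ ≤ (m + 1) * ((∑ j ∈ F, r j ^ 2) * (m * ‖ψ‖ ^ 2)) := by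
        gcongr
        exact e.sum_norm_an_vec_sq_le F hψ
    _ = _ := by ring

theorem summableOp_term₁ (X : e.Alg) : SummableOp fun j => e.term₁ j X := fun ψ => by
  obtain ⟨m, hm⟩ := ψ.2
  obtain ⟨a, -, ha⟩ := e.hasSum_norm_an_vec hm
  exact ⟨⟨_, fun j => e.cr_mem_lev _ (e.an_mem_lev _ hm)⟩,
    summable_of_norm_sum_sq_le ha.summable (e.norm_sum_term₁_le X hm)⟩

theorem summableOp_term₂ (X : e.Alg) : SummableOp fun j => e.term₂ j X := fun ψ => by
  obtain ⟨m, hm⟩ := ψ.2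
  obtain ⟨a, b, -, -, ha, -⟩ := hasSum_norm_comm X
  exact ⟨⟨_, fun j => e.cr_mem_lev _ (e.cr_mem_lev _ hm)⟩,
    summable_of_norm_sum_sq_le ha.summable (e.norm_sum_term₂_le X hm)⟩

theorem summableOp_term₃ (X : e.Alg) : SummableOp fun j => e.term₃ j X := fun ψ => by
  obtain ⟨m, hm⟩ := ψ.2
  obtain ⟨a, b, -, -, -, hb⟩ := hasSum_norm_comm X
  exact ⟨⟨_, fun j => e.an_mem_lev _ (e.an_mem_lev _ hm)⟩,
    summable_of_norm_sum_sq_le hb.summable (e.norm_sum_term₃_le X hm)⟩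

/-- `(P X P) a†a` -/
def dG₁ : e.Alg →ₗ[ℂ] (FinFock I K →ₗ[ℂ] FinFock I K) := sumOpLin e.term₁ e.summableOp_term₁

/-- `(P X J J' P) a†a†` -/
def dG₂ : e.Alg →ₗ[ℂ] (FinFock I K →ₗ[ℂ] FinFock I K) := sumOpLin e.term₂ e.summableOp_term₂

/-- `(γ P J' J X P) aa` -/
def dG₃ : e.Alg →ₗ[ℂ] (FinFock I K →ₗ[ℂ] FinFock I K) := sumOpLin e.term₃ e.summableOp_term₃

/-- The second quantisation on the vectors with a bounded number of particles. -/
def dG : e.Alg →ₗ[ℂ] (FinFock I K →ₗ[ℂ] FinFock I K) :=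
  e.dG₁ + (1 / 2 : ℂ) • e.dG₂ - (1 / 2 : ℂ) • e.dG₃

theorem hasSum_dG₁ (X : e.Alg) (ψ : FinFock I K) :
    HasSum (fun j => (e.term₁ j X ψ : Fock I K)) (e.dG₁ X ψ) := hasSum_sumOpLin _ _ _

theorem hasSum_dG₂ (X : e.Alg) (ψ : FinFock I K) :
    HasSum (fun j => (e.term₂ j X ψ : Fock I K)) (e.dG₂ X ψ) := hasSum_sumOpLin _ _ _

theorem hasSum_dG₃ (X : e.Alg) (ψ : FinFock I K) :
    HasSum (fun j => (e.term₃ j X ψ : Fock I K)) (e.dG₃ X ψ) := hasSum_sumOpLin _ _ _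

theorem dG_apply (X : e.Alg) (ψ : FinFock I K) :
    e.dG X ψ = e.dG₁ X ψ + (1 / 2 : ℂ) • e.dG₂ X ψ - (1 / 2 : ℂ) • e.dG₃ X ψ := rfl

theorem banded_dG₁ (X : e.Alg) : Banded (e.dG₁ X) ‖X‖ where
  nonneg := norm_nonneg _
  band n ψ hψ c hc := by
    by_contra h
    refine hc ((hasSum_coord (e.hasSum_dG₁ X ψ) c).unique (hasSum_zero.congr_fun fun j => ?_))
    exact e.createFun_eq_zero _ fun d hd => e.an_sec _ hψ (by omega)
  bound n ψ hψ := by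
    obtain ⟨a, ha, hs⟩ := e.hasSum_norm_an_vec (sec_le_lev _ hψ)
    have h := norm_sq_le_of_hasSum (e.hasSum_dG₁ X ψ) hs (e.norm_sum_term₁_le X (sec_le_lev _ hψ))
    refine abs_le_of_sq_le_sq' (h.trans ?_) (by positivity) |>.2
    calc ((n : ℝ) + 1) * ‖X‖ ^ 2 * a ≤ (n + 2) * ‖X‖ ^ 2 * ((n + 2) * ‖ψ‖ ^ 2) := by
          have : a ≤ (n + 2) * ‖ψ‖ ^ 2 := ha.trans (by gcongr; linarith)
          have h0 : 0 ≤ a := hs.nonneg fun _ => by positivity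
          gcongr
          linarith
      _ = _ := by ring

theorem banded_dG₂ (X : e.Alg) : Banded (e.dG₂ X) ‖X‖ where
  nonneg := norm_nonneg _
  band n ψ hψ c hc := by
    by_contra h
    refine hc ((hasSum_coord (e.hasSum_dG₂ X ψ) c).unique (hasSum_zero.congr_fun fun j => ?_))
    exact e.createFun_eq_zero _ fun d hd => e.cr_mem_sec _ hψ d (by omega)
  bound n ψ hψ := by
    obtain ⟨a, b, ha, -, hs, -⟩ := hasSum_norm_comm X
    have h := norm_sq_le_of_hasSum (e.hasSum_dG₂ X ψ) hs (e.norm_sum_term₂_le X (sec_le_lev _ hψ))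
    have h0 : 0 ≤ a := hs.nonneg fun _ => by positivity
    refine abs_le_of_sq_le_sq' (h.trans ?_) (by positivity) |>.2
    calc ((n : ℝ) + 2) * ((n + 1) * ‖ψ‖ ^ 2) * a ≤ (n + 2) * ((n + 2) * ‖ψ‖ ^ 2) * ‖X‖ ^ 2 := by
          gcongr
          linarith
      _ = _ := by ring

theorem banded_dG₃ (X : e.Alg) : Banded (e.dG₃ X) ‖X‖ where
  nonneg := norm_nonneg _
  band n ψ hψ c hc := by
    by_contra h
    refine hc ((hasSum_coord (e.hasSum_dG₃ X ψ) c).unique (hasSum_zero.congr_fun fun j => ?_))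
    rcases Nat.eq_zero_or_pos n with rfl | hn
    · have : e.an (e.vec j) ψ = 0 := e.an_eq_zero _ (sec_le_lev _ hψ)
      change (e.an _ (e.an (e.vec j) ψ) : Fock I K) c = 0
      rw [this, map_zero]
      rfl
    · exact e.an_sec _ (e.an_mem_sec _ hψ) (by omega)
  bound n ψ hψ := by
    obtain ⟨a, b, -, hb, -, hs⟩ := hasSum_norm_comm X
    have h := norm_sq_le_of_hasSum (e.hasSum_dG₃ X ψ) hs (e.norm_sum_term₃_le X (sec_le_lev _ hψ))
    have h0 : 0 ≤ b := hs.nonneg fun _ => by positivity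
    refine abs_le_of_sq_le_sq' (h.trans ?_) (by positivity) |>.2
    calc ((n : ℝ) + 1) * (n * ‖ψ‖ ^ 2) * b ≤ (n + 2) * ((n + 2) * ‖ψ‖ ^ 2) * ‖X‖ ^ 2 := by
          gcongr <;> linarith
      _ = _ := by ring

theorem banded_dG (X : e.Alg) : Banded (e.dG X) (2 * ‖X‖) := by
  have h := ((e.banded_dG₁ X).add ((e.banded_dG₂ X).smul (1 / 2 : ℂ))).add
    ((e.banded_dG₃ X).smul (-(1 / 2) : ℂ))
  have h1 : e.dG X = e.dG₁ X + (1 / 2 : ℂ) • e.dG₂ X + (-(1 / 2) : ℂ) • e.dG₃ X := by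
    ext1 ψ
    simp only [dG_apply, LinearMap.add_apply, LinearMap.smul_apply]
    module
  rw [h1]
  convert h using 1
  norm_num
  ring

theorem levBdd_dG (X : e.Alg) : LevBdd (e.dG X) := (e.banded_dG X).levBdd

end ModeBasis
end

/-! ### Commutators of dΓ with creation and annihilation operators -/

noncomputable section

open EllTwo Config

namespace EllTwo

variable {C ι : Type*}

theorem hasSum_inner_right (φ : EllTwo C) {x : ι → EllTwo C} {a : EllTwo C} (h : HasSum x a) :
    HasSum (fun i => ⟪φ, x i⟫_ℂ) ⟪φ, a⟫_ℂ := (innerSL ℂ φ).hasSum h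

theorem hasSum_inner_left (φ : EllTwo C) {x : ι → EllTwo C} {a : EllTwo C} (h : HasSum x a) :
    HasSum (fun i => ⟪x i, φ⟫_ℂ) ⟪a, φ⟫_ℂ := by
  have h1 := (hasSum_inner_right φ h).star
  simpa only [← starRingEnd_apply, inner_conj_symm] using h1

end EllTwo

namespace NeutralSpace

variable {H : Type*} [NormedAddCommGroup H] [InnerProductSpace ℂ H] [CompleteSpace H]
variable {S : NeutralSpace H}

theorem Hom.tw {p : Bool} {f : H} (hf : S.Hom p f) : S.tw p f = bif p then -f else f := by
  cases p
  · rfl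
  · exact hf

namespace HSAlg

variable {ι : Type*} {b : HilbertBasis ι ℂ H}

/-- Conjugation with `γ` to the power of a parity. -/
def conjTw (p : Bool) (Y : S.HSAlg b) : S.HSAlg b := twA S b p * Y * twA S b p

theorem op_conjTw (p : Bool) (Y : S.HSAlg b) :
    op S b (conjTw p Y) = S.tw p * op S b Y * S.tw p := by
  rw [conjTw, map_mul, map_mul, op_twA]

theorem op_conjTw_apply (p : Bool) (Y : S.HSAlg b) (f : H) :
    op S b (conjTw p Y) f = S.tw p (op S b Y (S.tw p f)) := by
  rw [op_conjTw]
  rfl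

theorem conjTw_conjTw (p : Bool) (Y : S.HSAlg b) : conjTw p (conjTw p Y) = Y := by
  have h := twA_mul_self S (b := b) p
  rw [conjTw, conjTw]
  calc twA S b p * (twA S b p * Y * twA S b p) * twA S b p
      = (twA S b p * twA S b p) * Y * (twA S b p * twA S b p) := by noncomm_ring
    _ = Y := by rw [h, one_mul, mul_one]

theorem conjTw_mul (p : Bool) (X Y : S.HSAlg b) :
    conjTw p (X * Y) = conjTw p X * conjTw p Y := by
  have h := twA_mul_self S (b := b) p
  rw [conjTw, conjTw, conjTw]
  calc twA S b p * (X * Y) * twA S b p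
      = twA S b p * X * 1 * Y * twA S b p := by noncomm_ring
    _ = _ := by
      rw [← h]
      noncomm_ring

theorem conjTw_sub (p : Bool) (X Y : S.HSAlg b) :
    conjTw p (X - Y) = conjTw p X - conjTw p Y := by
  rw [conjTw, conjTw, conjTw, mul_sub, sub_mul]

theorem conjTw_of_even {X : S.HSAlg b} (hX : S.IsEven (op S b X)) (p : Bool) :
    conjTw p X = X := by
  refine op_injective S b (ContinuousLinearMap.ext fun f => ?_)
  rw [op_conjTw_apply]
  cases p
  · rfl
  · have h := DFunLike.congr_fun hX (S.γ f)
    simp only [mul_apply_eq_comp, γ_γ] at h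
    exact h.symm

theorem _root_.NeutralSpace.SelfDual.conjTw {Y : S.HSAlg b} (hY : S.SelfDual (op S b Y))
    (p : Bool) : S.SelfDual (op S b (conjTw p Y)) := by
  rw [op_conjTw]
  exact hY.conj_tw p

/-- The involution `Y ↦ q Y* q`. -/
def dag (Y : S.HSAlg b) : S.HSAlg b := qA S b * adj S Y * qA S b

theorem op_dag (Y : S.HSAlg b) :
    op S b (dag Y) = S.q * ContinuousLinearMap.adjoint (op S b Y) * S.q := by
  rw [dag, map_mul, map_mul, op_qA, op_adj]

theorem op_dag_apply (Y : S.HSAlg b) (f : H) :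
    op S b (dag Y) f = S.q (ContinuousLinearMap.adjoint (op S b Y) (S.q f)) := by
  rw [op_dag]
  rfl

theorem dag_dag (Y : S.HSAlg b) : dag (dag Y) = Y := by
  refine op_injective S b (ContinuousLinearMap.ext fun f => ?_)
  rw [op_dag, op_dag, adjoint_conj_q]
  simp only [mul_apply_eq_comp, q_q]

theorem selfDual_dag {Y : S.HSAlg b} (hY : S.SelfDual (op S b Y)) :
    S.SelfDual (op S b (dag Y)) := by
  rw [op_dag]
  exact hY.dag

theorem q_tw (p : Bool) (f : H) : S.q (S.tw p f) = S.tw p (S.q f) := by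
  cases p
  · rfl
  · exact (S.γ_q f).symm

theorem dag_conjTw (p : Bool) (Y : S.HSAlg b) : dag (conjTw p Y) = conjTw p (dag Y) := by
  refine op_injective S b (ContinuousLinearMap.ext fun f => ?_)
  have h1 : star (S.tw p) = S.tw p := by
    cases p
    · exact star_one _
    · exact S.γ_selfAdjoint.star_eq
  rw [op_dag_apply, op_conjTw, op_conjTw_apply, op_dag_apply,
    ← ContinuousLinearMap.star_eq_adjoint, star_mul, star_mul, h1]
  simp only [mul_apply_eq_comp, q_tw, ContinuousLinearMap.star_eq_adjoint]

theorem dag_of_star {X : S.HSAlg b}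
    (hX : ContinuousLinearMap.adjoint (op S b X) = S.q * op S b X * S.q) : dag X = X := by
  refine op_injective S b (ContinuousLinearMap.ext fun f => ?_)
  rw [op_dag_apply, hX]
  simp only [mul_apply_eq_comp, q_q]

end HSAlg

end NeutralSpace

open NeutralSpace HSAlg

namespace ModeBasis

variable {H : Type*} [NormedAddCommGroup H] [InnerProductSpace ℂ H] [CompleteSpace H]
variable {S : NeutralSpace H} {I K : Type*} (e : ModeBasis S I K)

/-- The sign by which `γ` to the power of a parity acts on a mode. -/
def twSign (p : Bool) (j : I ⊕ K) : ℝ := bif p && j.isRight then -1 else 1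

theorem tw_vec_eq (p : Bool) (j : I ⊕ K) : S.tw p (e.vec j) = (twSign p j : ℂ) • e.vec j := by
  rcases j with j | j <;> cases p <;> simp [tw, twSign, e.γ_vec, par]

variable [LinearOrder K]

theorem an_tw_vec (p : Bool) (j : I ⊕ K) (ψ : FinFock I K) :
    e.an (S.tw p (e.vec j)) ψ = (twSign p j : ℂ) • e.an (e.vec j) ψ := by
  rw [tw_vec_eq, an_smul, Complex.conj_ofReal, LinearMap.smul_apply]

theorem cr_neg (f : H) : e.cr (-f) = -e.cr f := by
  rw [← neg_one_smul ℂ f, cr_smul]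
  ext1 ψ
  exact neg_one_smul ℂ (e.cr f ψ)

theorem an_neg (f : H) : e.an (-f) = -e.an f := by
  rw [← neg_one_smul ℂ f, an_smul, map_neg, map_one]
  ext1 ψ
  exact neg_one_smul ℂ (e.an f ψ)

variable {e}

/-- Moving `a†(f)` to the left twists both factors with `γ^p`; since `γ^p eⱼ = ± eⱼ`, the two twists
combine into the conjugation of `Y`. -/
theorem term₁_cr (Y : e.Alg) {p : Bool} {f : H} (hf : S.Hom p f) (hP : S.P f = f)
    (j : I ⊕ K) (ψ : FinFock I K) :
    e.term₁ j Y (e.cr f ψ) = e.cr f (e.term₁ j (conjTw p Y) ψ) +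
      ⟪e.vec j, f⟫_ℂ • e.cr (S.P (op S e.basis Y (e.vec j))) ψ := by
  change e.cr _ (e.an (e.vec j) (e.cr f ψ)) = e.cr f (e.cr _ (e.an (e.vec j) ψ)) + _
  rw [e.an_cr hf, map_add, map_smul, hP, e.cr_cr hf, an_tw_vec, op_conjTw_apply, tw_vec_eq]
  simp only [map_smul, S.P_tw, cr_smul, LinearMap.smul_apply]

theorem term₂_cr (Y : e.Alg) {p : Bool} {f : H} (hf : S.Hom p f)
    (j : I ⊕ K) (ψ : FinFock I K) :
    e.term₂ j Y (e.cr f ψ) = e.cr f (e.term₂ j (conjTw p Y) ψ) := by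
  change e.cr _ (e.cr (e.vec j) (e.cr f ψ)) = e.cr f (e.cr _ (e.cr (e.vec j) ψ))
  rw [e.cr_cr hf, e.cr_cr hf, op_conjTw_apply, ← J_tw, tw_vec_eq]
  simp only [map_smulₛₗ, Complex.conj_ofReal, RingHom.id_apply, S.P_tw, cr_smul,
    LinearMap.smul_apply]

theorem term₃_cr (Y : e.Alg) {p : Bool} {f : H} (hf : S.Hom p f) (hP : S.P f = f)
    (j : I ⊕ K) (ψ : FinFock I K) :
    e.term₃ j Y (e.cr f ψ) = e.cr f (e.term₃ j (conjTw p Y) ψ) +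
      (⟪S.γ (S.P (S.J (op S e.basis Y (e.vec j)))), f⟫_ℂ • e.an (S.tw p (e.vec j)) ψ +
      ⟪e.vec j, f⟫_ℂ • e.an (S.γ (S.P (S.J (op S e.basis Y (e.vec j))))) ψ) := by
  change e.an _ (e.an (e.vec j) (e.cr f ψ)) = e.cr f (e.an _ (e.an (e.vec j) ψ)) + _
  rw [e.an_cr hf, map_add, map_smul, hP, e.an_cr hf, hP, op_conjTw_apply, tw_vec_eq]
  simp only [map_smulₛₗ, J_tw, S.P_tw, S.γ_tw, an_smul, LinearMap.smul_apply,
    Complex.conj_ofReal, RingHom.id_apply, add_assoc]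

theorem dG₁_cr (Y : e.Alg) {p : Bool} {f : H} (hf : S.Hom p f) (hP : S.P f = f)
    (ψ : FinFock I K) :
    e.dG₁ Y (e.cr f ψ) = e.cr f (e.dG₁ (conjTw p Y) ψ) + e.cr (op S e.basis Y f) ψ := by
  obtain ⟨m, hm⟩ := ((e.summableOp_term₁ (conjTw p Y)) ψ).1
  have h1 := (e.levBdd_cr f).hasSum hm (e.hasSum_dG₁ (conjTw p Y) ψ)
  have h2 := e.hasSum_vec f
  rw [hP] at h2
  have h3 := (e.crAt ψ).hasSum (S.P.hasSum (((op S e.basis Y)).hasSum h2))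
  rw [crAt_apply, cr_P] at h3
  refine Subtype.ext ((e.hasSum_dG₁ Y (e.cr f ψ)).unique ((h1.add h3).congr_fun fun j => ?_))
  rw [term₁_cr Y hf hP, map_smul, map_smul, map_smul]
  rfl

theorem dG₂_cr (Y : e.Alg) {p : Bool} {f : H} (hf : S.Hom p f) (ψ : FinFock I K) :
    e.dG₂ Y (e.cr f ψ) = e.cr f (e.dG₂ (conjTw p Y) ψ) := by
  obtain ⟨m, hm⟩ := ((e.summableOp_term₂ (conjTw p Y)) ψ).1
  have h1 := (e.levBdd_cr f).hasSum hm (e.hasSum_dG₂ (conjTw p Y) ψ)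
  refine Subtype.ext ((e.hasSum_dG₂ Y (e.cr f ψ)).unique (h1.congr_fun fun j => ?_))
  rw [term₂_cr Y hf]

/-- `a†(f)` can be contracted with either annihilation operator. By self-duality both contractions
have the same sum; this accounts for the 2, which the factor ½ in dΓ cancels. -/
theorem dG₃_cr {Y : e.Alg} (hY : S.SelfDual (op S e.basis Y)) {p : Bool} {f : H} (hf : S.Hom p f)
    (hP : S.P f = f) (ψ : FinFock I K) :
    e.dG₃ Y (e.cr f ψ) = e.cr f (e.dG₃ (conjTw p Y) ψ) +
      (2 : ℂ) • e.an (S.γ (S.J (op S e.basis Y f))) ψ := by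
  obtain ⟨m, hm⟩ := ((e.summableOp_term₃ (conjTw p Y)) ψ).1
  have h1 := (e.levBdd_cr f).hasSum hm (e.hasSum_dG₃ (conjTw p Y) ψ)
  have h2 := e.hasSum_vec f
  rw [hP] at h2
  have h3 := (e.anAt ψ).hasSum (S.γ.hasSum (S.P.hasSum
    ((((op S e.basis Y)).hasSum h2).map S.J S.J.continuous)))
  have h4 := e.hasSum_an (S.γ (S.P (S.J (op S e.basis Y f)))) ψ
  have h5 : e.an (S.γ (S.P (S.J (op S e.basis Y f)))) = e.an (S.γ (S.J (op S e.basis Y f))) := by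
    rw [← S.P_γ, an_P]
  rw [anAt_apply, h5] at h3
  rw [h5] at h4
  refine Subtype.ext ((e.hasSum_dG₃ Y (e.cr f ψ)).unique ?_)
  have h6 := h1.add (h4.add h3)
  rw [two_smul]
  refine h6.congr_fun fun j => ?_
  -- The symmetry of the bilinear form of `Y` turns this contraction into a term of the mode
  -- expansion `h4`; the twist sign occurs twice and drops out.
  have h7 : ⟪S.γ (S.P (S.J (op S e.basis Y (e.vec j)))), f⟫_ℂ • e.an (S.tw p (e.vec j)) ψ =
      ⟪S.γ (S.P (S.J (op S e.basis Y f))), e.vec j⟫_ℂ • e.an (e.vec j) ψ := by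
    have h8 := hY.inner_symm hf hP (e.P_vec j)
    rw [← S.inner_tw, tw_vec_eq, inner_smul_left, Complex.conj_ofReal] at h8
    have h9 := congrArg conj h8
    rw [map_mul, inner_conj_symm, inner_conj_symm, Complex.conj_ofReal] at h9
    have h10 : (twSign p j : ℂ) * twSign p j = 1 := by
      cases p <;> rcases j with j | j <;> simp [twSign]
    rw [an_tw_vec, ← h9, smul_smul]
    congr 1
    linear_combination ⟪S.γ (S.P (S.J (op S e.basis Y f))), e.vec j⟫_ℂ * h10
  rw [term₃_cr Y hf hP, h7]
  simp only [Function.comp_apply, map_smul, map_smulₛₗ, Complex.conj_conj]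
  rfl

theorem dG_cr {Y : e.Alg} (hY : S.SelfDual (op S e.basis Y)) {p : Bool} {f : H} (hf : S.Hom p f)
    (hP : S.P f = f) (ψ : FinFock I K) :
    e.dG Y (e.cr f ψ) =
      e.cr f (e.dG (conjTw p Y) ψ) + e.cr (op S e.basis Y f) ψ -
        e.an (S.γ (S.J (op S e.basis Y f))) ψ := by
  rw [dG_apply, dG_apply, dG₁_cr Y hf hP, dG₂_cr Y hf, dG₃_cr hY hf hP]
  simp only [map_add, map_sub, map_smul]
  module

/-! ### Adjoints -/

theorem an_vec_finDelta {c : Config I K} {j : I ⊕ K} (hj : j ∉ occ c) :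
    e.an (e.vec j) (finDelta c) = 0 := by
  classical
  ext d
  rw [an_vec_apply]
  by_cases hu : uamp d j = 0
  · simp [hu]
  · have : c ≠ up d j := by
      rintro rfl
      refine hj ((amp_ne_zero_iff _ _).mp ?_)
      rwa [amp_up hu]
    rw [finDelta, delta_apply, if_neg this.symm]
    simp

/-- Both sides are a double sum over modes. On a basis state only the finitely many occupied modes
contribute to one of the sums, so interchanging them is harmless; level-boundedness then extends the
identity to all `ψ`. -/
theorem inner_dG₁ (Y : e.Alg) (φ ψ : FinFock I K) :
    ⟪φ, e.dG₁ Y ψ⟫_ℂ = ⟪e.dG₁ (dag Y) φ, ψ⟫_ℂ := by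
  have key : ∀ c, ⟪(φ : Fock I K), (e.dG₁ Y (finDelta c) : Fock I K)⟫_ℂ =
      ⟪(e.dG₁ (dag Y) φ : Fock I K), delta c⟫_ℂ := fun c => by
    have h1 : HasSum (fun i => ∑ j ∈ occ c, ⟪e.vec i, (op S e.basis Y) (e.vec j)⟫_ℂ *
        ⟪(e.an (e.vec i) φ : Fock I K), (e.an (e.vec j) (finDelta c) : Fock I K)⟫_ℂ)
        ⟪(φ : Fock I K), (e.dG₁ Y (finDelta c) : Fock I K)⟫_ℂ := by
      have h2 := hasSum_inner_right (φ : Fock I K) (e.hasSum_dG₁ Y (finDelta c))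
      rw [h2.unique (hasSum_sum_of_ne_finset_zero (s := occ c) fun j hj => by
        change ⟪(φ : Fock I K), (e.cr _ (e.an (e.vec j) (finDelta c)) : Fock I K)⟫_ℂ = 0
        rw [an_vec_finDelta hj, map_zero]
        exact inner_zero_right _)]
      refine hasSum_sum fun j _ => ?_
      have h4 := hasSum_inner_left (e.an (e.vec j) (finDelta c) : Fock I K)
        (e.hasSum_an (op S e.basis Y (e.vec j)) φ)
      have h5 : ⟪(φ : Fock I K), (e.term₁ j Y (finDelta c) : Fock I K)⟫_ℂ =
          ⟪(e.an (op S e.basis Y (e.vec j)) φ : Fock I K),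
            (e.an (e.vec j) (finDelta c) : Fock I K)⟫_ℂ := by
        have := e.inner_an_left (S.P (op S e.basis Y (e.vec j))) φ (e.an (e.vec j) (finDelta c))
        rw [an_P] at this
        exact this.symm
      rw [h5]
      refine h4.congr_fun fun i => ?_
      rw [Submodule.coe_smul, inner_smul_left, inner_conj_symm]
    have h9 := hasSum_inner_left (delta c) (e.hasSum_dG₁ (dag Y) φ)
    refine h1.unique (h9.congr_fun fun i => ?_)
    have h6 := e.inner_an_right (S.P ((op S e.basis (dag Y)) (e.vec i))) (e.an (e.vec i) φ)
      (finDelta c)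
    rw [an_P] at h6
    change _ = ⟪(e.cr _ (e.an (e.vec i) φ) : Fock I K), ((finDelta c : FinFock I K) : Fock I K)⟫_ℂ
    rw [Submodule.coe_inner, Submodule.coe_inner] at h6
    rw [← h6]
    have h7 := hasSum_inner_right (e.an (e.vec i) φ : Fock I K)
      (e.hasSum_an ((op S e.basis (dag Y)) (e.vec i)) (finDelta c))
    rw [h7.unique (hasSum_sum_of_ne_finset_zero (s := occ c) fun j hj => by
      rw [an_vec_finDelta hj, smul_zero]
      exact inner_zero_right _)]
    refine Finset.sum_congr rfl fun j _ => ?_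
    rw [Submodule.coe_smul, inner_smul_right, op_dag_apply, S.q_of_P (e.P_vec i), S.inner_q,
      S.q_of_P (e.P_vec j), ContinuousLinearMap.adjoint_inner_left]
  have h1 := hasSum_inner_right (φ : Fock I K) ((e.banded_dG₁ Y).levBdd.hasSum_finDelta ψ)
  have h2 := hasSum_inner_right (e.dG₁ (dag Y) φ : Fock I K) (hasSum_delta (ψ : Fock I K))
  refine h1.unique (h2.congr_fun fun c => ?_)
  rw [inner_smul_right, inner_smul_right, key]

/-- Term by term: reversing the order of the operators costs a twist, which is the one relating the
coefficients of `q Y* q` to those of `Y` by self-duality. The minus sign matches the opposite signs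
of the two pair terms in dΓ. -/
theorem inner_dG₂ {Y : e.Alg} (hY : S.SelfDual (op S e.basis Y)) (φ ψ : FinFock I K) :
    ⟪φ, e.dG₂ Y ψ⟫_ℂ = -⟪e.dG₃ (dag Y) φ, ψ⟫_ℂ := by
  have h1 := hasSum_inner_right (φ : Fock I K) (e.hasSum_dG₂ Y ψ)
  have h2 := (hasSum_inner_left (ψ : Fock I K) (e.hasSum_dG₃ (dag Y) φ)).neg
  refine h1.unique (h2.congr_fun fun j => ?_)
  change ⟪φ, e.cr _ (e.cr (e.vec j) ψ)⟫_ℂ = -⟪e.an _ (e.an (e.vec j) φ), ψ⟫_ℂ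
  rw [← inner_an_left, ← inner_an_left]
  have h3 : S.γ (S.P (S.J ((op S e.basis (dag Y)) (e.vec j)))) =
      -S.tw j.isRight (S.P (op S e.basis Y (S.J (e.vec j)))) := by
    rw [op_dag_apply, S.P_J_q, map_neg, γ_γ, S.q_of_P (e.P_vec j),
      hY.P_J_adjoint (e.hom_vec j) (e.P_vec j)]
  rw [h3, an_neg, LinearMap.neg_apply, e.an_an (e.hom_vec j), tw_tw, Submodule.coe_inner,
    Submodule.coe_inner, Submodule.coe_neg, inner_neg_left, neg_neg]

theorem inner_dG₃ {Y : e.Alg} (hY : S.SelfDual (op S e.basis Y)) (φ ψ : FinFock I K) :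
    ⟪φ, e.dG₃ Y ψ⟫_ℂ = -⟪e.dG₂ (dag Y) φ, ψ⟫_ℂ := by
  have h := congrArg conj (inner_dG₂ (selfDual_dag hY) ψ φ)
  rw [dag_dag, map_neg, Submodule.coe_inner, Submodule.coe_inner, inner_conj_symm,
    inner_conj_symm] at h
  rw [Submodule.coe_inner, Submodule.coe_inner, h, neg_neg]

theorem inner_dG {Y : e.Alg} (hY : S.SelfDual (op S e.basis Y)) (φ ψ : FinFock I K) :
    ⟪φ, e.dG Y ψ⟫_ℂ = ⟪e.dG (dag Y) φ, ψ⟫_ℂ := by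
  have h1 := inner_dG₁ Y φ ψ
  have h2 := inner_dG₂ hY φ ψ
  have h3 := inner_dG₃ hY φ ψ
  simp only [Submodule.coe_inner] at h1 h2 h3
  rw [dG_apply, dG_apply, Submodule.coe_inner, Submodule.coe_inner]
  simp only [Submodule.coe_add, Submodule.coe_sub, Submodule.coe_smul, inner_add_right,
    inner_sub_right, inner_smul_right, inner_add_left, inner_sub_left, inner_smul_left, h1, h2, h3,
    map_div₀, map_one, map_ofNat]
  ring

theorem symm_dG {X : e.Alg} (hX : S.SelfDual (op S e.basis X))
    (hs : ContinuousLinearMap.adjoint (op S e.basis X) = S.q * (op S e.basis X) * S.q) :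
      Symm (e.dG X) := fun φ ψ => by
  have h := inner_dG hX φ ψ
  rw [dag_of_star hs] at h
  exact h.symm

/-- The adjoint of `dG_cr` for the twisted operator `q Y* q`; self-duality rewrites its values on
`h` through `Y γ J h`. -/
theorem dG_an {Y : e.Alg} (hY : S.SelfDual (op S e.basis Y)) {p : Bool} {h : H} (hh : S.Hom p h)
    (hP : S.P h = h) (ψ : FinFock I K) :
    e.dG Y (e.an h ψ) = e.an h (e.dG (conjTw p Y) ψ) - e.cr (op S e.basis Y (S.γ (S.J h))) ψ +
      e.an (S.γ (S.J (op S e.basis Y (S.γ (S.J h))))) ψ := by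
  refine ext_inner_left ℂ fun φ => ?_
  set Z : e.Alg := conjTw p (dag Y)
  have hZ : S.SelfDual (op S e.basis Z) := (selfDual_dag hY).conjTw p
  have h1 : conjTw p Z = dag Y := conjTw_conjTw p _
  have h2 : dag Z = conjTw p Y := by rw [dag_conjTw, dag_dag]
  have h3 := dG_cr hZ hh hP φ
  rw [h1, add_sub_assoc, ← sub_eq_iff_eq_add] at h3
  have h4 : ⟪φ, e.dG Y (e.an h ψ)⟫_ℂ = ⟪e.cr h (e.dG (dag Y) φ), ψ⟫_ℂ :=
    (inner_dG hY φ _).trans (e.inner_an_right h _ ψ)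
  have h5 := inner_dG hZ
  have hJ : S.J (S.γ (S.J h)) = S.γ h := by rw [S.J_even, S.J_invol]
  have hZh : (op S e.basis Z) h =
    bif p then -S.tw p (S.q (ContinuousLinearMap.adjoint (op S e.basis Y) h))
      else S.tw p (S.q (ContinuousLinearMap.adjoint (op S e.basis Y) h)) := by
    rw [op_conjTw_apply, hh.tw, op_dag_apply]
    cases p <;> simp [S.q_of_P hP]
  have hγ : S.γ (S.J h) = bif p then -S.J h else S.J h := hh.J
  have hb := hY.P_adjoint hh hP
  have hc := hY.P_J_adjoint hh hP
  have h6 : e.an (op S e.basis Z h) = -e.an (S.γ (S.J (op S e.basis Y (S.γ (S.J h))))) := by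
    have : S.P (op S e.basis Z h) = -S.P (S.γ (S.J (op S e.basis Y (S.γ (S.J h))))) := by
      rw [hZh, hγ]
      cases p
      · simp only [cond_false, S.P_tw, P_q, hb, map_neg, tw_tw, S.P_γ]
      · simp only [cond_true, S.P_tw, P_q, hb, map_neg, tw_tw, S.P_γ]
    rw [← an_P, this, an_neg, an_P]
  have h7 : e.cr (S.γ (S.J (op S e.basis Z h))) = -e.cr (op S e.basis Y (S.γ (S.J h))) := by
    have : S.P (S.γ (S.J (op S e.basis Z h))) = -S.P (op S e.basis Y (S.γ (S.J h))) := by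
      rw [hZh, hγ]
      cases p
      · simp only [cond_false, S.P_tw, S.P_γ, S.J_tw, P_J_q, hc, map_neg, tw_tw, γ_γ, γ_tw]
      · simp only [cond_true, S.P_tw, S.P_γ, S.J_tw, P_J_q, hc, map_neg, tw_tw, γ_γ, γ_tw]
    rw [← cr_P, this, cr_neg, cr_P]
  have h8 : ⟪e.dG Z (e.cr h φ), ψ⟫_ℂ = ⟪φ, e.an h (e.dG (conjTw p Y) ψ)⟫_ℂ := by
    rw [← h2]
    have h9 := inner_dG (selfDual_dag hZ) (e.cr h φ) ψ
    rw [dag_dag] at h9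
    exact h9.symm.trans (e.inner_an_right h φ _).symm
  have h10 := e.inner_an_left (S.γ (S.J (op S e.basis Z h))) φ ψ
  have h11 := e.inner_an_right (op S e.basis Z h) φ ψ
  rw [h6] at h11
  rw [h7] at h10
  rw [← h3] at h4
  simp only [Submodule.coe_inner, LinearMap.neg_apply, inner_neg_right] at h10 h11
  rw [Submodule.coe_inner, Submodule.coe_inner] at h4 h8
  simp only [Submodule.coe_inner, Submodule.coe_sub, inner_add_right,
    inner_sub_right, inner_sub_left] at h4 ⊢
  rw [h4, h8, h10, ← h11]
  ring

end ModeBasis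
end

/-! ### Field operators and the projective representation -/

noncomputable section

open EllTwo Config NeutralSpace HSAlg

namespace EllTwo

variable {C : Type*} {num : C → ℕ} {T T' : fin num →ₗ[ℂ] fin num}

theorem LevBdd.sub (h : LevBdd T) (h' : LevBdd T') : LevBdd (T - T') := fun m => by
  obtain ⟨B, hB⟩ := h m
  obtain ⟨B', hB'⟩ := h' m
  refine ⟨B + B', fun ψ hψ => ?_⟩
  rw [add_mul]
  exact (norm_sub_le _ _).trans (add_le_add (hB ψ hψ) (hB' ψ hψ))

theorem LevBdd.comp_banded {B : ℝ} (h : LevBdd T) (h' : Banded T' B) : LevBdd (T ∘ₗ T') :=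
  fun m => by
    obtain ⟨D, hD⟩ := h (m + 2)
    refine ⟨|D| * (3 * B * (m + 2)), fun ψ hψ => ?_⟩
    refine (hD _ (h'.mem_lev ψ hψ)).trans ?_
    rw [mul_assoc]
    exact mul_le_mul (le_abs_self D) (h'.norm_le ψ hψ) (norm_nonneg _) (abs_nonneg _)

theorem levBdd_smul_id (a : ℂ) : LevBdd (a • LinearMap.id : fin num →ₗ[ℂ] fin num) := fun _ =>
  ⟨‖a‖, fun ψ _ => (norm_smul a (ψ : EllTwo C)).le⟩

end EllTwo

namespace ModeBasis

variable {H : Type*} [NormedAddCommGroup H] [InnerProductSpace ℂ H] [CompleteSpace H]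
variable {S : NeutralSpace H} {I K : Type*} (e : ModeBasis S I K) [LinearOrder K]

/-- The field operator on the vectors with a bounded number of particles. -/
def fld (f : H) : FinFock I K →ₗ[ℂ] FinFock I K := e.cr f - e.an (S.γ (S.J f))

theorem fld_apply (f : H) (ψ : FinFock I K) :
    e.fld f ψ = e.cr f ψ - e.an (S.γ (S.J f)) ψ := rfl

theorem fld_add (f g : H) : e.fld (f + g) = e.fld f + e.fld g := by
  rw [fld, fld, fld, map_add, map_add, cr_add, an_add]
  abel

theorem fld_smul (a : ℂ) (f : H) : e.fld (a • f) = a • e.fld f := by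
  rw [fld, fld, map_smulₛₗ, map_smul, cr_smul, an_smul, Complex.conj_conj, smul_sub]

theorem cr_eq_zero {f : H} (hf : S.P f = 0) : e.cr f = 0 := by
  rw [← cr_P, hf, ← zero_smul ℂ (0 : H), cr_smul]
  ext1 ψ
  exact zero_smul ℂ (e.cr 0 ψ)

theorem an_eq_zero_of_P {f : H} (hf : S.P f = 0) : e.an f = 0 := by
  rw [← an_P, hf, ← zero_smul ℂ (0 : H), an_smul, map_zero]
  ext1 ψ
  exact zero_smul ℂ (e.an 0 ψ)

theorem fld_of_P {f : H} (hf : S.P f = f) : e.fld f = e.cr f := by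
  rw [fld, e.an_eq_zero_of_P, sub_zero]
  rw [S.P_γ, S.P_J, hf, sub_self, map_zero]

theorem fld_γ_J {f : H} (hf : S.P f = f) : e.fld (S.γ (S.J f)) = -e.an f := by
  rw [fld, e.cr_eq_zero, zero_sub, S.J_even, γ_γ, S.J_invol]
  rw [S.P_γ, S.P_J, hf, sub_self, map_zero]

variable {e}

/-- The field is a creation operator on `P H` and minus an annihilation operator on `(1 - P) H`, so
`dG_cr` and `dG_an` are its two halves. -/
theorem dG_fld {Y : e.Alg} (hY : S.SelfDual (op S e.basis Y)) {p : Bool} {f : H} (hf : S.Hom p f)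
    (ψ : FinFock I K) :
    e.dG Y (e.fld f ψ) = e.fld f (e.dG (conjTw p Y) ψ) + e.fld (op S e.basis Y f) ψ := by
  have h1 : e.dG Y (e.fld (S.P f) ψ) =
      e.fld (S.P f) (e.dG (conjTw p Y) ψ) + e.fld (op S e.basis Y (S.P f)) ψ := by
    rw [e.fld_of_P (S.P_P f), dG_cr hY hf.P (S.P_P f), fld_apply]
    abel
  set h : H := S.γ (S.J (f - S.P f)) with hh
  have hhom : S.Hom p h := by
    have h2 : S.Hom p (f - S.P f) := by
      have h3 := hf.P
      cases p <;> simp_all [Hom]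
      abel
    exact h2.J.γ
  have hPh : S.P h = h := by
    rw [hh, S.P_γ, S.P_J, map_sub S.P, S.P_P, sub_self, map_zero, sub_zero]
  have hfh : S.γ (S.J h) = f - S.P f := by
    rw [hh, S.J_even, γ_γ, S.J_invol]
  have h2 : e.dG Y (e.fld (f - S.P f) ψ) =
      e.fld (f - S.P f) (e.dG (conjTw p Y) ψ) + e.fld (op S e.basis Y (f - S.P f)) ψ := by
    have h3 := dG_an hY hhom hPh ψ
    rw [← hfh, e.fld_γ_J hPh, LinearMap.neg_apply, map_neg, h3, LinearMap.neg_apply, fld_apply]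
    abel
  have h4 : e.fld f = e.fld (S.P f) + e.fld (f - S.P f) := by
    rw [← fld_add, add_sub_cancel]
  have h5 : e.fld (op S e.basis Y f) =
    e.fld (op S e.basis Y (S.P f)) + e.fld (op S e.basis Y (f - S.P f)) := by
    rw [← fld_add, ← map_add, add_sub_cancel]
  rw [h4, h5, LinearMap.add_apply, map_add, h1, h2, LinearMap.add_apply, LinearMap.add_apply]
  abel

theorem dG_fld_of_even {X : e.Alg} (hX : S.SelfDual (op S e.basis X))
    (hev : S.IsEven (op S e.basis X)) (f : H)
    (ψ : FinFock I K) : e.dG X (e.fld f ψ) = e.fld f (e.dG X ψ) + e.fld (op S e.basis X f) ψ := by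
  obtain ⟨g, h, hg, hh, rfl⟩ := S.exists_hom_add f
  have h1 := dG_fld hX hg ψ
  have h2 := dG_fld hX hh ψ
  rw [conjTw_of_even hev] at h1 h2
  rw [map_add, fld_add, fld_add, LinearMap.add_apply, map_add, h1, h2, LinearMap.add_apply,
    LinearMap.add_apply]
  abel

/-! ### The commutator of second quantised operators -/

variable (e) in
/-- The failure of `dG` to preserve the commutator. -/
def defect (X Y : e.Alg) : FinFock I K →ₗ[ℂ] FinFock I K :=
  e.dG X ∘ₗ e.dG Y - e.dG Y ∘ₗ e.dG X - e.dG (X * Y - Y * X)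

theorem defect_apply (X Y : e.Alg) (ψ : FinFock I K) : e.defect X Y ψ =
    e.dG X (e.dG Y ψ) - e.dG Y (e.dG X ψ) - e.dG (X * Y - Y * X) ψ := rfl

theorem levBdd_defect (X Y : e.Alg) : LevBdd (e.defect X Y) :=
  (((e.levBdd_dG X).comp_banded (e.banded_dG Y)).sub
    ((e.levBdd_dG Y).comp_banded (e.banded_dG X))).sub (e.levBdd_dG _)

omit [LinearOrder K] in
theorem selfDual_commutator {X Y : e.Alg} (hX : S.SelfDual (op S e.basis X))
    (hev : S.IsEven (op S e.basis X))
    (hY : S.SelfDual (op S e.basis Y)) : S.SelfDual (op S e.basis (X * Y - Y * X)) := by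
  rw [map_sub, map_mul, map_mul]
  exact SelfDual.commutator hev hX hY

/-- The Jacobi identity: the terms in which dΓ acts on the field vector cancel because `f ↦ [X, Y]
f` is the commutator of the two actions. -/
theorem defect_fld {X Y : e.Alg} (hX : S.SelfDual (op S e.basis X))
    (hev : S.IsEven (op S e.basis X))
    (hY : S.SelfDual (op S e.basis Y)) {p : Bool} {f : H} (hf : S.Hom p f) (ψ : FinFock I K) :
    e.defect X Y (e.fld f ψ) = e.fld f (e.defect X (conjTw p Y) ψ) := by
  have hXf : S.Hom p (op S e.basis X f) := by
    have h := DFunLike.congr_fun hev f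
    simp only [mul_apply_eq_comp] at h
    unfold Hom at hf ⊢
    rw [← h, hf]
    cases p <;> simp
  have h1 := dG_fld (selfDual_commutator hX hev hY) hf ψ
  rw [conjTw_sub, conjTw_mul, conjTw_mul, conjTw_of_even hev] at h1
  rw [defect_apply, defect_apply, h1, dG_fld hY hf, dG_fld_of_even hX hev f, map_add, map_add,
    dG_fld hY hf, dG_fld hY hXf, dG_fld_of_even hX hev, dG_fld_of_even hX hev]
  have h2 : e.fld ((op S e.basis (X * Y - Y * X)) f) =
    e.fld (op S e.basis X (op S e.basis Y f)) - e.fld (op S e.basis Y (op S e.basis X f)) := by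
    rw [eq_sub_iff_add_eq, ← fld_add, map_sub, map_mul, map_mul, sub_apply, mul_apply_eq_comp,
      mul_apply_eq_comp, sub_add_cancel]
  rw [h2, LinearMap.sub_apply, map_sub (e.fld f), map_sub (e.fld f)]
  abel

variable (I K) in
/-- The vacuum, as a vector with a bounded number of particles. -/
def vac : FinFock I K := finDelta ((0, ∅) : Config I K)

omit [LinearOrder K] in
theorem vac_mem : (vac I K : Fock I K) ∈ lev num 0 := by
  have h : num ((0, ∅) : Config I K) = 0 := by simp [num]
  have h1 := sec_le_lev (num := num) _ (delta_mem_sec ((0, ∅) : Config I K))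
  rwa [h] at h1

theorem an_vac (f : H) : e.an f (vac I K) = 0 := e.an_eq_zero f vac_mem

theorem inner_vac_cr (f : H) (ψ : FinFock I K) : ⟪vac I K, e.cr f ψ⟫_ℂ = 0 := by
  rw [← inner_an_left, an_vac, Submodule.coe_inner]
  exact inner_zero_left _

omit [LinearOrder K] in
theorem inner_vac (ψ : FinFock I K) : ⟪vac I K, ψ⟫_ℂ = (ψ : Fock I K) (0, ∅) :=
  inner_delta_left _ _

theorem inner_vac_vac : ⟪vac I K, vac I K⟫_ℂ = 1 := by
  classical
  rw [inner_vac]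
  change delta ((0, ∅) : Config I K) (0, ∅) = 1
  rw [delta_apply, if_pos rfl]

theorem exists_amp_ne_zero {c : Config I K} (hc : num c ≠ 0) : ∃ j, amp c j ≠ 0 := by
  by_contra! h
  have h1 := sum_amp_sq c
  simp only [h, ne_eq, OfNat.ofNat_ne_zero, not_false_eq_true, zero_pow,
    Finset.sum_const_zero] at h1
  exact hc (by exact_mod_cast h1.symm)

omit [LinearOrder K] in
theorem eq_vac_of_num {c : Config I K} (hc : num c = 0) : c = (0, ∅) := by
  simp only [num, Nat.add_eq_zero_iff, Finset.card_eq_zero, Finsupp.degree_eq_zero_iff] at hc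
  exact Prod.ext hc.1 hc.2

theorem eq_smul_vac_of_an {ψ : FinFock I K} (h : ∀ j, e.an (e.vec j) ψ = 0) :
    ψ = ⟪vac I K, ψ⟫_ℂ • vac I K := by
  classical
  ext c
  change (ψ : Fock I K) c = ⟪vac I K, ψ⟫_ℂ * delta ((0, ∅) : Config I K) c
  rw [inner_vac, delta_apply]
  by_cases hc : num c = 0
  · rw [eq_vac_of_num hc, if_pos rfl, mul_one]
  · obtain ⟨j, hj⟩ := exists_amp_ne_zero hc
    have h1 := congrArg (fun φ : FinFock I K => (φ : Fock I K) (low c j)) (h j)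
    simp only [an_vec_apply, uamp_low hj, up_low hj] at h1
    have h2 : (ψ : Fock I K) c = 0 :=
      (mul_eq_zero.mp h1).resolve_left (Complex.ofReal_ne_zero.mpr hj)
    rw [h2, if_neg, mul_zero]
    rintro rfl
    exact hc (by simp [num])

/-- `a(eⱼ) = -B†(γ J eⱼ)` can be moved through the defect onto the vacuum, so the image of the
vacuum is killed by every `a(eⱼ)`. The defect is taken of the twisted `Y`, so that the twist is
undone. -/
theorem defect_vac {X Y : e.Alg} (hX : S.SelfDual (op S e.basis X))
    (hev : S.IsEven (op S e.basis X))
    (hY : S.SelfDual (op S e.basis Y)) :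
    e.defect X Y (vac I K) = ⟪vac I K, e.defect X Y (vac I K)⟫_ℂ • vac I K := by
  refine eq_smul_vac_of_an (e := e) fun j => ?_
  have h1 := defect_fld hX hev (hY.conjTw j.isRight) (e.hom_vec j).J.γ (vac I K)
  rw [e.fld_γ_J (e.P_vec j), conjTw_conjTw, LinearMap.neg_apply, an_vac, neg_zero, map_zero,
    LinearMap.neg_apply] at h1
  exact neg_eq_zero.mp h1.symm

theorem dG₁_vac (Y : e.Alg) : e.dG₁ Y (vac I K) = 0 :=
  Subtype.ext ((e.hasSum_dG₁ Y (vac I K)).unique (hasSum_zero.congr_fun fun j => by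
    change (e.cr _ (e.an (e.vec j) (vac I K)) : Fock I K) = 0
    rw [an_vac, map_zero]
    rfl))

theorem dG₃_vac (Y : e.Alg) : e.dG₃ Y (vac I K) = 0 :=
  Subtype.ext ((e.hasSum_dG₃ Y (vac I K)).unique (hasSum_zero.congr_fun fun j => by
    change (e.an _ (e.an (e.vec j) (vac I K)) : Fock I K) = 0
    rw [an_vac, map_zero]
    rfl))

theorem dG_vac (Y : e.Alg) : e.dG Y (vac I K) = (1 / 2 : ℂ) • e.dG₂ Y (vac I K) := by
  rw [dG_apply, dG₁_vac, dG₃_vac, smul_zero, sub_zero, zero_add]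

theorem inner_vac_dG_vac (Y : e.Alg) : ⟪vac I K, e.dG Y (vac I K)⟫_ℂ = 0 := by
  rw [dG_vac, Submodule.coe_inner, Submodule.coe_smul, inner_smul_right]
  have h := hasSum_inner_right (vac I K : Fock I K) (e.hasSum_dG₂ Y (vac I K))
  have h1 := h.unique (hasSum_zero.congr_fun fun j => inner_vac_cr (e := e) _ _)
  rw [h1, mul_zero]

theorem inner_vac_of_dG_cr {Y : e.Alg} {g : H} {χ : FinFock I K} (j : I ⊕ K)
    (h : e.dG Y (e.cr g (e.cr (e.vec j) (vac I K))) =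
      e.cr g χ + e.fld (op S e.basis Y g) (e.cr (e.vec j) (vac I K))) :
    ⟪vac I K, e.dG Y (e.cr g (e.cr (e.vec j) (vac I K)))⟫_ℂ =
      -⟪S.γ (S.J (op S e.basis Y g)), e.vec j⟫_ℂ := by
  have h1 := inner_vac_cr (e := e) g χ
  have h2 := inner_vac_cr (e := e) (op S e.basis Y g) (e.cr (e.vec j) (vac I K))
  have h3 := inner_vac_cr (e := e) (e.vec j)
    (e.an (S.tw j.isRight (S.γ (S.J (op S e.basis Y g)))) (vac I K))
  have h4 := inner_vac_vac (I := I) (K := K)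
  rw [Submodule.coe_inner] at h1 h2 h3 h4
  rw [h, fld_apply, an_cr_vec, Submodule.coe_inner]
  simp only [Submodule.coe_add, Submodule.coe_sub, Submodule.coe_smul, inner_add_right,
    inner_sub_right, inner_smul_right, h1, h2, h3, h4]
  ring

/-- `dG Y` maps the vacuum to `½ ∑ a†(P Y J eⱼ) a†(eⱼ) Ω`, and `dG X` has to annihilate the pair
again; the ½ and the sign of the annihilation part of the field make up the factor `-2`. The
hypothesis isolates the only use of the commutation relation, so that the roles of even and general
operators may be exchanged. -/
theorem hasSum_inner_vac_dG_dG {X Y : e.Alg} (h : ∀ j, ∃ χ,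
    e.dG X (e.cr (S.P (op S e.basis Y (S.J (e.vec j)))) (e.cr (e.vec j) (vac I K))) =
      e.cr (S.P (op S e.basis Y (S.J (e.vec j)))) χ +
        e.fld (op S e.basis X (S.P (op S e.basis Y (S.J (e.vec j))))) (e.cr (e.vec j) (vac I K))) :
    HasSum (fun j => ⟪S.γ (S.J (op S e.basis X (S.P (op S e.basis Y (S.J (e.vec j)))))), e.vec j⟫_ℂ)
      (-2 * ⟪vac I K, e.dG X (e.dG Y (vac I K))⟫_ℂ) := by
  have h1 := (e.levBdd_dG X).hasSum (fun j => e.cr_mem_lev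
    (S.P (op S e.basis Y (S.J (e.vec j)))) (e.cr_mem_lev (e.vec j) vac_mem))
    (e.hasSum_dG₂ Y (vac I K))
  have h2 := (hasSum_inner_right (vac I K : Fock I K) h1).neg
  have h3 : -2 * ⟪vac I K, e.dG X (e.dG Y (vac I K))⟫_ℂ =
      -⟪(vac I K : Fock I K), (e.dG X (e.dG₂ Y (vac I K)) : Fock I K)⟫_ℂ := by
    rw [dG_vac, map_smul, Submodule.coe_inner, Submodule.coe_smul, inner_smul_right]
    ring
  rw [h3]
  refine h2.congr_fun fun j => ?_
  obtain ⟨χ, hχ⟩ := h j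
  have h4 := inner_vac_of_dG_cr j hχ
  rw [Submodule.coe_inner] at h4
  rw [h4, neg_neg]

/-- The diagonal entries of the trace at `eⱼ` vanish because of the factor `1 - P`, and those at `J
eⱼ` are the terms of the two vacuum series. In particular the trace converges. The vacuum
expectation value of `dG [X, Y]` is zero. -/
theorem schwinger_eq {X Y : e.Alg} (hX : S.SelfDual (op S e.basis X))
    (hev : S.IsEven (op S e.basis X))
    (hY : S.SelfDual (op S e.basis Y)) : e.schwinger (op S e.basis X) (op S e.basis Y) =
      -2 * ⟪vac I K, e.defect X Y (vac I K)⟫_ℂ := by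
  have hXe : ∀ f, (op S e.basis X) (S.γ f) = S.γ (op S e.basis X f) := fun f =>
    DFunLike.congr_fun hev f
  have h1 := hasSum_inner_vac_dG_dG (X := X) (Y := Y) fun j => by
    refine ⟨e.dG X (e.cr (e.vec j) (vac I K)), ?_⟩
    have := dG_fld_of_even hX hev (S.P (op S e.basis Y (S.J (e.vec j)))) (e.cr (e.vec j) (vac I K))
    rwa [e.fld_of_P (S.P_P _)] at this
  have h2 := hasSum_inner_vac_dG_dG (X := Y) (Y := X) fun j => by
    have hg : S.Hom j.isRight (S.P (op S e.basis X (S.J (e.vec j)))) := by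
      have := (e.hom_vec j).J
      refine Hom.P ?_
      unfold Hom at this ⊢
      rw [← hXe, this]
      cases j.isRight <;> simp
    refine ⟨e.dG (conjTw j.isRight Y) (e.cr (e.vec j) (vac I K)), ?_⟩
    have := dG_fld hY hg (e.cr (e.vec j) (vac I K))
    rwa [e.fld_of_P (S.P_P _)] at this
  have h3 := inner_vac_dG_vac (X * Y - Y * X)
  have h4 := h1.sub h2
  have h5 : -2 * ⟪vac I K, e.defect X Y (vac I K)⟫_ℂ =
      -2 * ⟪vac I K, e.dG X (e.dG Y (vac I K))⟫_ℂ -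
        -2 * ⟪vac I K, e.dG Y (e.dG X (vac I K))⟫_ℂ := by
    rw [Submodule.coe_inner] at h3
    simp only [defect_apply, Submodule.coe_inner, inner_sub_right, h3]
    ring
  rw [h5, schwinger, trace]
  refine HasSum.tsum_eq (h4.congr_fun fun j => ?_)
  have h6 : S.oddPart (op S e.basis X) = 0 := by
    ext f
    simp [oddPart, hXe, S.γ_γ]
  have h7 : S.evenPart (op S e.basis X) = (op S e.basis X) := by
    ext f
    simp only [evenPart, smul_apply, add_apply, mul_apply_eq_comp, hXe, S.γ_γ]
    module
  have h8 : ∀ f, ⟪e.vec j, S.γ (f - S.P f)⟫_ℂ = 0 := fun f => by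
    rw [← e.P_vec j, S.inner_P, S.P_γ, map_sub, S.P_P, sub_self, map_zero, inner_zero_right]
  have h9 : ∀ f, ⟪S.J (e.vec j), S.γ (f - S.P f)⟫_ℂ = ⟪S.γ (S.J f), e.vec j⟫_ℂ := fun f => by
    rw [← S.inner_γ, inner_sub_right, ← S.inner_P, S.P_γ, e.P_J_vec, map_zero, inner_zero_left,
      sub_zero, S.inner_γ, S.inner_J_left, S.J_even]
  rw [h6, h7]
  simp only [mul_zero, add_zero, mul_apply_eq_comp, sub_apply, one_apply_eq_self, map_sub,
    inner_sub_right]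
  have h10 := h8
  have h11 := h9
  simp only [map_sub, inner_sub_right] at h10 h11
  rw [h10, h10, h11, h11]
  ring

omit [LinearOrder K] in
theorem trace_conj_γ (T : H →L[ℂ] H) : e.trace (S.γ * T * S.γ) = e.trace T := by
  refine tsum_congr fun j => ?_
  have h : ∀ f, (S.γ f = f ∨ S.γ f = -f) → ⟪f, (S.γ * T * S.γ) f⟫_ℂ = ⟪f, T f⟫_ℂ := by
    intro f hf
    simp only [mul_apply_eq_comp]
    rw [← S.inner_γ]
    rcases hf with hf | hf <;> simp [hf]
  rw [h, h]
  · rw [← S.J_even, e.γ_vec]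
    cases j <;> simp [par]
  · rw [e.γ_vec]
    cases j <;> simp [par]

omit [LinearOrder K] in
theorem schwinger_conj_γ {X : H →L[ℂ] H} (hev : S.IsEven X) (Y : H →L[ℂ] H) :
    e.schwinger X (S.γ * Y * S.γ) = e.schwinger X Y := by
  have hX : ∀ f, X (S.γ f) = S.γ (X f) := fun f => DFunLike.congr_fun hev f
  have h6 : S.oddPart X = 0 := by
    ext f
    simp [oddPart, hX, S.γ_γ]
  have h7 : S.evenPart X = X := by
    ext f
    simp only [evenPart, smul_apply, add_apply, mul_apply_eq_comp, hX, S.γ_γ]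
    module
  rw [schwinger, schwinger, ← e.trace_conj_γ (S.γ * _), h6, h7]
  congr 1
  ext f
  simp only [mul_apply_eq_comp, sub_apply, add_apply, one_apply_eq_self, map_sub, S.γ_γ, S.P_γ, hX,
    zero_apply, map_zero, add_zero]

/-- A basis state is a creation operator applied to a state with one particle less, and the defect
passes creation operators. Hence its value on the vacuum spreads to all states. -/
theorem defect_eq {X : e.Alg} (hX : S.SelfDual (op S e.basis X)) (hev : S.IsEven (op S e.basis X))
    {Y : e.Alg}
    (hY : S.SelfDual (op S e.basis Y)) (ψ : FinFock I K) :
    e.defect X Y ψ = (-(1 / 2) * e.schwinger (op S e.basis X) (op S e.basis Y) : ℂ) • ψ := by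
  -- `Y` varies in the induction since passing a fermion replaces it by `γ Y γ`, which has the same
  -- Schwinger term.
  have key : ∀ n, ∀ c : Config I K, num c = n → ∀ Y : e.Alg, S.SelfDual (op S e.basis Y) →
      e.defect X Y (finDelta c) =
        (-(1 / 2) * e.schwinger (op S e.basis X) (op S e.basis Y) : ℂ) • finDelta c := by
    intro n
    induction n with
    | zero =>
      intro c hc Y hY
      rw [eq_vac_of_num hc, schwinger_eq hX hev hY]
      refine (defect_vac hX hev hY).trans ?_
      congr 1
      ring
    | succ n ih =>
      intro c hc Y hY
      obtain ⟨j, hj⟩ := exists_amp_ne_zero (c := c) (by omega)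
      have h1 : e.cr (e.vec j) (finDelta (low c j)) = (amp c j : ℂ) • finDelta c := by
        apply Subtype.ext
        rw [cr_vec_delta, uamp_low hj, up_low hj]
        rfl
      have h2 := defect_fld hX hev hY (e.hom_vec j) (finDelta (low c j))
      have hn := num_low hj
      rw [e.fld_of_P (e.P_vec j), h1, map_smul, ih _ (by omega) _ (hY.conjTw _), map_smul, h1,
        smul_comm] at h2
      have h3 : e.schwinger (op S e.basis X) (op S e.basis (conjTw j.isRight Y)) =
        e.schwinger (op S e.basis X) (op S e.basis Y) := by
        rw [op_conjTw]
        cases j.isRight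
        · simp [tw]
        · exact e.schwinger_conj_γ hev _
      rw [h3] at h2
      exact smul_right_injective _ (Complex.ofReal_ne_zero.mpr hj) h2
  have h := LevBdd.ext (levBdd_defect X Y)
    (levBdd_smul_id (-(1 / 2) * e.schwinger (op S e.basis X) (op S e.basis Y) : ℂ)) fun c =>
      key _ c rfl Y hY
  rw [h]
  rfl

end ModeBasis
end

noncomputable section

open EllTwo Config NeutralSpace HSAlg

theorem IsUnitaryGroup.hasDerivAt_apply {E : Type*} [NormedAddCommGroup E]
    [InnerProductSpace ℂ E] [CompleteSpace E] {U : ℝ → E →L[ℂ] E} (hU : IsUnitaryGroup U) {x v : E}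
    (h : HasDerivAt (fun t => U t x) v 0) (t : ℝ) :
    HasDerivAt (fun s => U s (U t x)) (U t v) 0 := by
  have h2 := HasDerivAt.scomp_of_eq (𝕜 := ℝ) 0 (hU.hasDerivAt_of_zero h t)
    ((hasDerivAt_id (0 : ℝ)).const_add t) (by simp)
  rw [one_smul] at h2
  refine h2.congr_of_eventuallyEq (Filter.Eventually.of_forall fun a => ?_)
  simp only [Function.comp_apply, id]
  rw [← mul_apply_eq_comp, ← hU.add, add_comm]

namespace EllTwo

variable {C : Type*} {num : C → ℕ}

theorem banded_id : Banded (LinearMap.id : fin num →ₗ[ℂ] fin num) 1 where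
  nonneg := zero_le_one
  band n ψ hψ c hc := by
    have h : num c = n := by
      by_contra h
      exact hc (hψ c h)
    omega
  bound n ψ _ := by
    rw [LinearMap.id_apply]
    refine le_mul_of_one_le_left (norm_nonneg _) ?_
    have : (0 : ℝ) ≤ n := n.cast_nonneg
    linarith

end EllTwo

namespace ModeBasis

variable {H : Type*} [NormedAddCommGroup H] [InnerProductSpace ℂ H] [CompleteSpace H]
variable {S : NeutralSpace H} {I K : Type*} (e : ModeBasis S I K)

/-! ### The Schwinger term and its integral -/

theorem trace_smul (a : ℂ) (T : H →L[ℂ] H) : e.trace (a • T) = a * e.trace T := by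
  rw [trace, trace, ← tsum_mul_left]
  refine tsum_congr fun j => ?_
  rw [smul_apply, smul_apply, inner_smul_right, inner_smul_right, mul_add]

theorem schwinger_smul (a : ℂ) (X Y : H →L[ℂ] H) :
    e.schwinger (a • X) Y = a * e.schwinger X Y := by
  rw [schwinger, schwinger, ← trace_smul]
  congr 1
  simp only [evenPart, oddPart, mul_smul_comm, smul_mul_assoc, smul_sub, smul_add, mul_add, mul_sub,
    smul_comm a]

omit [CompleteSpace H] in
theorem _root_.evolve_smul (t : ℝ) (X Y : H →L[ℂ] H) (s : ℝ) :
    evolve ((t : ℂ) • X) Y s = evolve X Y (t * s) := by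
  rw [evolve, evolve, smul_smul, smul_smul]
  push_cast
  ring_nf

/-- The substitution `s ↦ t s` moves `t` into the limit of integration, where it can be
differentiated. -/
theorem bTerm_smul (X Y : H →L[ℂ] H) (t : ℝ) : e.bTerm ((t : ℂ) • X) Y =
    Complex.I * ∫ s in (0 : ℝ)..t, e.schwinger X (evolve X Y s) := by
  have h := intervalIntegral.smul_integral_comp_mul_left (a := 0) (b := 1)
    (fun s => e.schwinger X (evolve X Y s)) t
  rw [mul_zero, mul_one, ← intervalIntegral.integral_smul] at h
  rw [bTerm, ← h]
  simp only [schwinger_smul, evolve_smul, Complex.real_smul]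

variable [LinearOrder K] {e}

/-- `Y ↦ -2 ⟨Ω, [dΓ(X), dΓ(Y)] Ω⟩`, as a bounded linear form. -/
def vacForm (X : e.Alg) : e.Alg →L[ℂ] ℂ :=
  LinearMap.mkContinuous
    { toFun := fun Y => -2 * (⟪vac I K, e.dG X (e.dG Y (vac I K))⟫_ℂ -
        ⟪vac I K, e.dG Y (e.dG X (vac I K))⟫_ℂ)
      map_add' := fun Y Z => by
        simp only [map_add, LinearMap.add_apply, Submodule.coe_inner, inner_add_right]
        ring
      map_smul' := fun a Y => by
        simp only [map_smul, LinearMap.smul_apply, Submodule.coe_inner, Submodule.coe_smul,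
          inner_smul_right, RingHom.id_apply, smul_eq_mul]
        ring }
    -- The bounds on levels 0 and 2 give `288 = (3 · 2 · 2) · (3 · 2 · 4)`, and `1152 = 2 · 2 ·
    -- 288`.
    (1152 * ‖X‖) fun Y => by
      have h : ∀ Z W : e.Alg, ‖⟪vac I K, e.dG Z (e.dG W (vac I K))⟫_ℂ‖ ≤ 288 * ‖Z‖ * ‖W‖ := by
        intro Z W
        have h0 : ‖vac I K‖ = 1 := by
          have h := inner_self_eq_norm_sq_to_K (𝕜 := ℂ) (vac I K : Fock I K)
          have h' := inner_vac_vac (I := I) (K := K)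
          rw [Submodule.coe_inner] at h'
          rw [h'] at h
          have h2 : ‖(vac I K : Fock I K)‖ ^ 2 = 1 := Complex.ofReal_injective (by
            rw [Complex.ofReal_pow, Complex.ofReal_one]
            exact h.symm)
          exact (pow_eq_one_iff_of_nonneg (norm_nonneg _) two_ne_zero).mp h2
        have h1 := (e.banded_dG W).norm_le (vac I K) vac_mem
        have h2 := (e.banded_dG Z).norm_le _ ((e.banded_dG W).mem_lev (vac I K) vac_mem)
        have h3 := norm_inner_le_norm (𝕜 := ℂ) (vac I K : Fock I K)
          (e.dG Z (e.dG W (vac I K)) : Fock I K)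
        rw [h0] at h1
        rw [Submodule.coe_norm] at h0
        rw [h0, one_mul] at h3
        refine h3.trans (h2.trans ?_)
        have h4 : 3 * (2 * ‖Z‖) * (((0 + 2 : ℕ) : ℝ) + 2) * ‖e.dG W (vac I K)‖ ≤
            3 * (2 * ‖Z‖) * (((0 + 2 : ℕ) : ℝ) + 2) *
              (3 * (2 * ‖W‖) * (((0 : ℕ) : ℝ) + 2) * 1) := by
          gcongr
        refine h4.trans (le_of_eq ?_)
        push_cast
        ring
      simp only [LinearMap.coe_mk, AddHom.coe_mk]
      rw [norm_mul, norm_neg, Complex.norm_ofNat]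
      have h1 := norm_sub_le (⟪vac I K, e.dG X (e.dG Y (vac I K))⟫_ℂ)
        (⟪vac I K, e.dG Y (e.dG X (vac I K))⟫_ℂ)
      have h2 := h X Y
      have h3 := h Y X
      nlinarith

theorem vacForm_apply (X Y : e.Alg) : vacForm X Y =
    -2 * (⟪vac I K, e.dG X (e.dG Y (vac I K))⟫_ℂ - ⟪vac I K, e.dG Y (e.dG X (vac I K))⟫_ℂ) := rfl

theorem schwinger_eq_vacForm {X Y : e.Alg} (hX : S.SelfDual (op S e.basis X))
    (hev : S.IsEven (op S e.basis X))
    (hY : S.SelfDual (op S e.basis Y)) : e.schwinger (op S e.basis X) (op S e.basis Y) =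
      vacForm X Y := by
  have h3 := inner_vac_dG_vac (X * Y - Y * X)
  rw [Submodule.coe_inner] at h3
  rw [schwinger_eq hX hev hY, vacForm_apply]
  simp only [defect_apply, Submodule.coe_inner, inner_sub_right, h3, sub_zero]

omit [LinearOrder K] in
theorem selfDual_evol {X Y : e.Alg} (hX : S.SelfDual (op S e.basis X))
    (hev : S.IsEven (op S e.basis X))
    (hY : S.SelfDual (op S e.basis Y)) (t : ℝ) : S.SelfDual (op S e.basis (evol S X Y t)) := by
  rw [op_evol]
  exact SelfDual.evolve hev hX hY t

theorem bTerm_eq {X Y : e.Alg} (hX : S.SelfDual (op S e.basis X)) (hev : S.IsEven (op S e.basis X))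
    (hY : S.SelfDual (op S e.basis Y)) (t : ℝ) :
      e.bTerm ((t : ℂ) • (op S e.basis X)) (op S e.basis Y) =
      Complex.I * ∫ s in (0 : ℝ)..t, vacForm X (evol S X Y s) := by
  rw [bTerm_smul]
  congr 2
  funext s
  rw [← op_evol, schwinger_eq_vacForm hX hev (selfDual_evol hX hev hY s)]

/-- The trace in `c` has no evident continuity; its expression as a bounded form on the algebra
makes the integrand continuous, and the fundamental theorem of calculus applies. -/
theorem hasDerivAt_bTerm {X Y : e.Alg} (hX : S.SelfDual (op S e.basis X))
    (hev : S.IsEven (op S e.basis X))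
    (hY : S.SelfDual (op S e.basis Y)) (t : ℝ) :
    HasDerivAt (fun t : ℝ => e.bTerm ((t : ℂ) • (op S e.basis X)) (op S e.basis Y))
      (Complex.I * vacForm X (evol S X Y t)) t := by
  have hc : Continuous fun s => vacForm X (evol S X Y s) :=
    (vacForm X).continuous.comp
      (continuous_iff_continuousAt.mpr fun s => (hasDerivAt_evol S X Y s).continuousAt)
  have h := (hc.integral_hasStrictDerivAt 0 t).hasDerivAt.const_mul Complex.I
  simpa only [bTerm_eq hX hev hY] using h

/-- The vacuum expectation value of a commutator of symmetric operators is purely imaginary. Reality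
makes the factor in the projective relation a phase. -/
theorem im_bTerm {X Y : e.Alg} (hX : S.SelfDual (op S e.basis X)) (hev : S.IsEven (op S e.basis X))
    (hY : S.SelfDual (op S e.basis Y)) (hsX : Symm (e.dG X)) (hsY : ∀ t, Symm (e.dG (evol S X Y t)))
    (t : ℝ) :
    ∃ r : ℝ, e.bTerm ((t : ℂ) • (op S e.basis X)) (op S e.basis Y) = r := by
  have h : ∀ s, vacForm X (evol S X Y s) = Complex.I * ((vacForm X (evol S X Y s)).im : ℂ) := by
    intro s
    have h1 := hsX (vac I K) (e.dG (evol S X Y s) (vac I K))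
    have h2 := hsY s (vac I K) (e.dG X (vac I K))
    have h3 : conj (vacForm X (evol S X Y s)) = -vacForm X (evol S X Y s) := by
      rw [vacForm_apply, Submodule.coe_inner, Submodule.coe_inner, ← h1, ← h2]
      simp only [map_mul, map_sub, inner_conj_symm, map_neg, map_ofNat]
      ring
    have h4 := congrArg Complex.re h3
    rw [Complex.conj_re, Complex.neg_re] at h4
    conv_lhs => rw [← Complex.re_add_im (vacForm X (evol S X Y s)), self_eq_neg.mp h4]
    rw [Complex.ofReal_zero, zero_add, mul_comm]
  refine ⟨-∫ s in (0 : ℝ)..t, (vacForm X (evol S X Y s)).im, ?_⟩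
  rw [bTerm_eq hX hev hY]
  rw [funext h]
  rw [intervalIntegral.integral_const_mul, intervalIntegral.integral_ofReal, ← mul_assoc,
    Complex.I_mul_I]
  simp

/-! ### The Heisenberg evolution -/

variable (e) in
theorem banded_fld (f : H) : Banded (e.fld f) (2 * ‖f‖) where
  nonneg := by positivity
  band n ψ hψ c hc := by
    by_contra hn
    have h1 : (e.cr f ψ : Fock I K) c = 0 := e.cr_mem_sec f hψ c (by omega)
    have h2 : (e.an (S.γ (S.J f)) ψ : Fock I K) c = 0 := e.an_sec _ hψ (by omega)
    refine hc ?_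
    rw [fld_apply, Submodule.coe_sub, lp.coeFn_sub, Pi.sub_apply, h1, h2, sub_zero]
  bound n ψ hψ := by
    have h1 := e.norm_cr_le f (sec_le_lev n hψ)
    have h2 := e.norm_an_le (S.γ (S.J f)) (sec_le_lev n hψ)
    rw [norm_γ, S.J.norm_map] at h2
    have h3 : √((n : ℝ) + 1) ≤ n + 2 := by
      rw [Real.sqrt_le_left (by positivity)]
      have : (0 : ℝ) ≤ n := n.cast_nonneg
      nlinarith
    rw [fld_apply]
    refine (norm_sub_le _ _).trans ((add_le_add h1 h2).trans ?_)
    have h4 : √((n : ℝ) + 1) * ‖f‖ * ‖ψ‖ ≤ (n + 2) * ‖f‖ * ‖ψ‖ := by gcongr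
    linarith

variable (e) in
/-- `f ↦ B†(f)`, as a linear map. -/
def fldLin : H →ₗ[ℂ] (FinFock I K →ₗ[ℂ] FinFock I K) where
  toFun := e.fld
  map_add' := e.fld_add
  map_smul' := e.fld_smul

variable {X : e.Alg} {U : ℝ → Fock I K →L[ℂ] Fock I K}

/-- `B†(e^{isX} f)` solves the Heisenberg equation because `[dΓ(X), B†(g)] = B†(X g)`. -/
theorem fld_mem_clGraph (hX : S.SelfDual (op S e.basis X)) (hev : S.IsEven (op S e.basis X))
    (hsX : Symm (e.dG X))
    (hU : IsFlowLimit (e.dG X) U) (f : H) (t : ℝ) (ψ : FinFock I K) :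
    (U (-t) ψ, U (-t) (e.fld (oneParam (op S e.basis X) t f) ψ : Fock I K)) ∈
      clGraph (e.fld f) := by
  have h := hU.mem_clGraph (T := e.fldLin) (e.banded_dG X) hsX e.banded_fld zero_le_two
    (y := fun s => oneParam (op S e.basis X) s f)
    (y' := fun s => Complex.I • (op S e.basis X) (oneParam (op S e.basis X) s f))
    (fun s => by
      have h := (ContinuousLinearMap.apply ℂ H f).restrictScalars ℝ |>.hasFDerivAt.comp_hasDerivAt s
        (hasDerivAt_oneParam (op S e.basis X) s)
      rw [((commute_oneParam (Commute.refl (op S e.basis X)) s).smul_left Complex.I).eq.symm] at h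
      exact h)
    (fun s ψ => by
      change e.fld _ ψ = Complex.I • (e.dG X (e.fld _ ψ) - e.fld _ (e.dG X ψ))
      rw [dG_fld_of_even hX hev, fld_smul, add_sub_cancel_left]
      rfl) t ψ
  simp only [oneParam_zero] at h
  exact h

variable (e) in
/-- `(Y, z) ↦ dΓ(Y) + z`, as a linear map. -/
def dGAdd : e.Alg × ℂ →ₗ[ℂ] (FinFock I K →ₗ[ℂ] FinFock I K) :=
  e.dG.coprod (LinearMap.toSpanSingleton ℂ _ LinearMap.id)

theorem dGAdd_apply (Y : e.Alg) (z : ℂ) (ψ : FinFock I K) :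
    e.dGAdd (Y, z) ψ = e.dG Y ψ + z • ψ := by
  simp [dGAdd]

theorem banded_dGAdd (v : e.Alg × ℂ) : Banded (e.dGAdd v) (3 * ‖v‖) := by
  obtain ⟨Y, z⟩ := v
  have h := (e.banded_dG Y).add ((banded_id (num := num (I := I) (K := K))).smul z)
  have h1 : e.dGAdd (Y, z) = e.dG Y + z • LinearMap.id := by
    ext1 ψ
    rw [dGAdd_apply]
    rfl
  rw [h1]
  refine h.mono ?_
  have h2 := norm_fst_le (Y, z)
  have h3 := norm_snd_le (Y, z)
  simp only at h2 h3
  linarith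

/-- `dΓ(Y_s)` alone misses the Heisenberg equation by the scalar `-(i/2) c(X, Y_s)`, and `-b(sX,
Y)/2` is the primitive of this scalar that vanishes at `s = 0`. The pair therefore solves the
equation exactly. -/
theorem dG_mem_clGraph (hX : S.SelfDual (op S e.basis X)) (hev : S.IsEven (op S e.basis X))
    (hsX : Symm (e.dG X))
    (hU : IsFlowLimit (e.dG X) U) {Y : e.Alg} (hY : S.SelfDual (op S e.basis Y)) (t : ℝ)
    (ψ : FinFock I K) :
    (U (-t) ψ, U (-t) ((e.dG (evol S X Y t) ψ : Fock I K) -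
      ((1 / 2 : ℂ) * e.bTerm ((t : ℂ) • (op S e.basis X)) (op S e.basis Y)) • (ψ : Fock I K))) ∈
      clGraph (e.dG Y) := by
  have h := hU.mem_clGraph (T := e.dGAdd) (e.banded_dG X) hsX banded_dGAdd zero_le_three
    (y := fun s => (evol S X Y s,
      -(1 / 2 : ℂ) * e.bTerm ((s : ℂ) • (op S e.basis X)) (op S e.basis Y)))
    (y' := fun s => (Complex.I • (X * evol S X Y s - evol S X Y s * X),
      -(1 / 2 : ℂ) * (Complex.I * vacForm X (evol S X Y s))))
    (fun s => (hasDerivAt_evol S X Y s).prodMk ((hasDerivAt_bTerm hX hev hY s).const_mul _))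
    (fun s ψ => by
      have hd := selfDual_evol hX hev hY s
      have h := defect_eq hX hev hd ψ
      rw [schwinger_eq_vacForm hX hev hd, defect_apply] at h
      rw [dGAdd_apply, dGAdd_apply, dGAdd_apply, map_smul, LinearMap.smul_apply, map_add, map_smul]
      have h2 : e.dG X (e.dG (evol S X Y s) ψ) - e.dG (evol S X Y s) (e.dG X ψ) =
          e.dG (X * evol S X Y s - evol S X Y s * X) ψ +
            (-(1 / 2) * vacForm X (evol S X Y s) : ℂ) • ψ := by
        rw [← h]
        abel
      rw [add_sub_add_right_eq_sub, h2]
      module) t ψ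
  have h0 : e.bTerm (((0 : ℝ) : ℂ) • (op S e.basis X)) (op S e.basis Y) = 0 := by
    rw [bTerm_eq hX hev hY 0, intervalIntegral.integral_same, mul_zero]
  have h1 : e.dGAdd (Y, 0) = e.dG Y := by
    ext1 ψ
    rw [dGAdd_apply, zero_smul, add_zero]
  simp only [h0, mul_zero, evol_zero, h1] at h
  rw [dGAdd_apply] at h
  convert h using 3
  rw [Submodule.coe_add, Submodule.coe_smul]
  module

/-- The projective relation between the groups generated by `dΓ(X)` and `dΓ(Y)`. -/
theorem mul_mul_eq_smul (hX : S.SelfDual (op S e.basis X)) (hev : S.IsEven (op S e.basis X))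
    (hsX : Symm (e.dG X))
    (hU : IsFlowLimit (e.dG X) U) {Y : e.Alg} (hY : S.SelfDual (op S e.basis Y))
    (hsY : ∀ s, Symm (e.dG (evol S X Y s))) {V : ℝ → Fock I K →L[ℂ] Fock I K}
    (hV : IsFlowLimit (e.dG Y) V) {s : ℝ} {W : ℝ → Fock I K →L[ℂ] Fock I K}
    (hW : IsFlowLimit (e.dG (evol S X Y s)) W) (t : ℝ) :
    U s * V t * U (-s) =
      Complex.exp (-(Complex.I / 2) * t * e.bTerm ((s : ℂ) • (op S e.basis X)) (op S e.basis Y)) •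
        W t := by
  obtain ⟨r, hr⟩ := im_bTerm hX hev hY hsX hsY s
  have hsY0 : Symm (e.dG Y) := by
    have := hsY 0
    rwa [evol_zero] at this
  have gU := hU.isUnitaryGroup (e.banded_dG X) hsX
  have gV := hV.isUnitaryGroup (e.banded_dG Y) hsY0
  have gW := hW.isUnitaryGroup (e.banded_dG _) (hsY s)
  -- The phase compensates the scalar `-r/2` by which the conjugated generator differs from `dG
  -- (evol S X Y s)`.
  let Z : ℝ → Fock I K →L[ℂ] Fock I K := fun t =>
    Complex.exp (Complex.I / 2 * r * t) • (U s * V t * U (-s))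
  have hUs : ∀ T : Fock I K →L[ℂ] Fock I K, U (-s) * (U s * T) = T := fun T => by
    rw [← mul_assoc, ← gU.add, neg_add_cancel, gU.zero, one_mul]
  have gZ : IsUnitaryGroup Z := by
    refine ⟨fun t => ?_, ?_, fun a b => ?_, fun ψ => ?_⟩
    · have h1 : (Complex.exp (Complex.I / 2 * r * t)) ∈ unitary ℂ := by
        have h2 : ‖Complex.exp (Complex.I / 2 * r * t)‖ = 1 := by
          rw [show Complex.I / 2 * r * t = ((r * t / 2 : ℝ) : ℂ) * Complex.I by push_cast; ring]
          exact Complex.norm_exp_ofReal_mul_I _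
        rw [Unitary.mem_iff_star_mul_self, ← starRingEnd_apply, Complex.conj_mul', h2]
        simp
      have h3 := mul_mem (mul_mem (gU.unitary s) (gV.unitary t)) (gU.unitary (-s))
      exact Unitary.smul_mem_of_mem h1 h3
    · simp only [Z]
      rw [gV.zero, mul_one, ← gU.add, add_neg_cancel, gU.zero]
      simp
    · simp only [Z]
      rw [smul_mul_smul_comm, ← Complex.exp_add, gV.add]
      push_cast
      rw [mul_add]
      congr 1
      simp only [mul_assoc, hUs]
    · simp only [Z]
      have h1 : Continuous fun t : ℝ => Complex.exp (Complex.I / 2 * r * t) := by fun_prop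
      exact h1.smul ((U s).continuous.comp (gV.continuous (U (-s) ψ)))
  have key : ∀ ψ : FinFock I K,
      HasDerivAt (fun t => Z t ψ) (Complex.I • (e.dG (evol S X Y s) ψ : Fock I K)) 0 := by
    intro ψ
    have h1 := (hV.mem_clGraph_iff (e.banded_dG Y) hsY0 _ _).mp
      (dG_mem_clGraph hX hev hsX hU hY s ψ)
    have h2 := ((U s).restrictScalars ℝ).hasFDerivAt.comp_hasDerivAt 0 h1
    have h3 : HasDerivAt (fun t : ℝ => Complex.exp (Complex.I / 2 * r * t))
        (Complex.I / 2 * r) 0 := by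
      have h4 : HasDerivAt (fun t : ℝ => Complex.I / 2 * r * (t : ℂ)) (Complex.I / 2 * r) 0 := by
        simpa using (Complex.ofRealCLM.hasDerivAt (x := (0 : ℝ))).const_mul (Complex.I / 2 * r)
      simpa using h4.cexp
    have h5 := h3.smul h2
    refine h5.congr_deriv ?_
    simp only [Function.comp_apply, ContinuousLinearMap.coe_restrictScalars', gV.zero,
      one_apply_eq_self, Complex.ofReal_zero, mul_zero, Complex.exp_zero, one_smul, map_smul,
      gU.apply_neg_apply, hr]
    module
  have h : W = Z := by
    -- The set is the domain of the closed generator of `W`, which `W` leaves invariant. Vectors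
    -- with boundedly many particles form a core, so the derivatives of `Z` known there extend to
    -- the whole domain.
    refine gW.eq_of_generator gZ
      (D := {x | ∃ y, (x, y) ∈ clGraph (e.dG (evol S X Y s))}) ?_ ?_ ?_
    · refine (dense_fin (num := num (I := I) (K := K))).mono fun x hx => ?_
      exact ⟨e.dG (evol S X Y s) ⟨x, hx⟩,
        mem_clGraph_of_tendsto (ψ := fun _ => ⟨x, hx⟩) tendsto_const_nhds tendsto_const_nhds⟩
    · rintro x ⟨y, hy⟩
      refine ⟨Complex.I • y, (hW.mem_clGraph_iff (e.banded_dG _) (hsY s) x y).mp hy, ?_⟩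
      obtain ⟨ψ, h₁, h₂⟩ := exists_tendsto_of_mem_clGraph hy
      have h := gZ.hasDerivAt_of_tendsto (fun n t => gZ.hasDerivAt_of_zero (key (ψ n)) t) h₁
        (h₂.const_smul Complex.I) 0
      rwa [gZ.zero] at h
    · rintro t x ⟨y, hy⟩
      refine ⟨W t y, (hW.mem_clGraph_iff (e.banded_dG _) (hsY s) _ _).mpr ?_⟩
      have h := gW.hasDerivAt_apply ((hW.mem_clGraph_iff (e.banded_dG _) (hsY s) x y).mp hy) t
      rwa [map_smul] at h
  rw [h, hr]
  simp only [Z]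
  rw [smul_smul, ← Complex.exp_add,
    show -(Complex.I / 2) * t * r + Complex.I / 2 * r * t = 0 by ring, Complex.exp_zero, one_smul]

end ModeBasis
end

noncomputable section

open EllTwo Config NeutralSpace HSAlg

/-! ### The operators of the Fock space as unbounded operators -/

namespace EllTwo

variable {C : Type*} {num : C → ℕ}

/-- The unbounded operator `A` is defined on all vectors with bounded `num`, where it agrees
with `T`. -/
def Extends (A : EllTwo C →ₗ.[ℂ] EllTwo C) (T : fin num →ₗ[ℂ] fin num) : Prop :=
  ∀ ψ : fin num, ∃ h : (ψ : EllTwo C) ∈ A.domain, A ⟨ψ, h⟩ = (T ψ : EllTwo C)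

variable {A A' : EllTwo C →ₗ.[ℂ] EllTwo C} {T T' : fin num →ₗ[ℂ] fin num}

theorem Extends.apply (h : Extends A T) (ψ : fin num) (hψ : (ψ : EllTwo C) ∈ A.domain) :
    A ⟨ψ, hψ⟩ = (T ψ : EllTwo C) := (h ψ).2

theorem Extends.add (h : Extends A T) (h' : Extends A' T') : Extends (A + A') (T + T') :=
  fun ψ => ⟨⟨(h ψ).1, (h' ψ).1⟩, by
    rw [LinearPMap.add_apply, LinearMap.add_apply, Submodule.coe_add, ← (h ψ).2, ← (h' ψ).2]⟩

theorem Extends.sub (h : Extends A T) (h' : Extends A' T') : Extends (A - A') (T - T') :=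
  fun ψ => ⟨⟨(h ψ).1, (h' ψ).1⟩, by
    rw [LinearPMap.sub_apply, LinearMap.sub_apply, Submodule.coe_sub, ← (h ψ).2, ← (h' ψ).2]⟩

theorem Extends.smul (h : Extends A T) (a : ℂ) : Extends (a • A) (a • T) :=
  fun ψ => ⟨(h ψ).1, by
    rw [LinearPMap.smul_apply, LinearMap.smul_apply, Submodule.coe_smul, ← (h ψ).2]⟩

theorem Extends.opMul (h : Extends A T) (h' : Extends A' T') :
    Extends (opMul A A') (T ∘ₗ T') := fun ψ => by
  have h1 : A' ⟨ψ, (h' ψ).1⟩ ∈ A.domain := by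
    rw [(h' ψ).2]
    exact (h _).1
  refine ⟨⟨(h' ψ).1, h1⟩, ?_⟩
  change A ⟨A' ⟨ψ, _⟩, _⟩ = _
  rw [LinearMap.comp_apply, ← (h (T' ψ)).2]
  congr 1
  exact Subtype.ext (h' ψ).2

theorem Extends.opSum {ι : Type*} {A : ι → EllTwo C →ₗ.[ℂ] EllTwo C}
    {T : ι → fin num →ₗ[ℂ] fin num} {T' : fin num →ₗ[ℂ] fin num} (h : ∀ i, Extends (A i) (T i))
    (hT : ∀ ψ, HasSum (fun i => (T i ψ : EllTwo C)) (T' ψ : EllTwo C)) :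
    Extends (opSum A) T' := fun ψ => by
  have h1 : (fun i => A i ⟨ψ, (h i ψ).1⟩) = fun i => (T i ψ : EllTwo C) :=
    funext fun i => (h i ψ).2
  refine ⟨⟨fun i => (h i ψ).1, ?_⟩, ?_⟩
  · rw [h1]
    exact (hT ψ).summable
  · change ∑' i, A i ⟨ψ, _⟩ = _
    rw [h1]
    exact (hT ψ).tsum_eq

section Core

variable {D : Submodule ℂ (EllTwo C)}

theorem Extends.domRestrict (h : Extends A T) {ψ : fin num} (hψ : (ψ : EllTwo C) ∈ D) :
    ∃ h : (ψ : EllTwo C) ∈ (A.domRestrict D).domain, A.domRestrict D ⟨ψ, h⟩ = (T ψ : EllTwo C) :=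
  ⟨⟨hψ, (h ψ).1⟩, (LinearPMap.domRestrict_apply rfl).trans (h ψ).2⟩

theorem Extends.exists_of_domRestrict (h : Extends A T) (hD : D ≤ fin num)
    (x : (A.domRestrict D).domain) : ∃ ψ : fin num, (ψ : EllTwo C) = x ∧ (ψ : EllTwo C) ∈ D ∧
      A.domRestrict D x = (T ψ : EllTwo C) := by
  have hx := x.2.1
  refine ⟨⟨x, hD hx⟩, rfl, hx, ?_⟩
  exact (h.domRestrict (ψ := ⟨x, hD hx⟩) hx).2

/-- The operator is contained in the adjoint of the densely defined `T'`, which is closed. -/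
theorem Extends.isClosable (h : Extends A T) (hD : D ≤ fin num)
    (hT : ∀ φ ψ : fin num, ⟪T' φ, ψ⟫_ℂ = ⟪φ, T ψ⟫_ℂ) : (A.domRestrict D).IsClosable := by
  let Q : EllTwo C →ₗ.[ℂ] EllTwo C := ⟨fin num, (fin num).subtype ∘ₗ T'⟩
  have hQ : Dense (Q.domain : Set (EllTwo C)) := dense_fin
  refine (LinearPMap.adjoint_isClosed hQ).isClosable.leIsClosable
    (LinearPMap.IsFormalAdjoint.le_adjoint hQ fun y x => ?_)
  obtain ⟨ψ, hψ, -, hA⟩ := h.exists_of_domRestrict hD x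
  rw [hA, ← hψ]
  exact hT y ψ

/-- Any domain between the span of the basis states and the vectors of bounded level yields the same
closure: by level-boundedness the basis expansion of a vector of bounded level converges in the
graph norm. -/
theorem Extends.mem_closure_iff (h : Extends A T) (hD : D ≤ fin num) (hδ : ∀ c, delta c ∈ D)
    (hT : ∀ φ ψ : fin num, ⟪T' φ, ψ⟫_ℂ = ⟪φ, T ψ⟫_ℂ) (hb : LevBdd T) (x y : EllTwo C) :
    (∃ h : x ∈ (A.domRestrict D).closure.domain, (A.domRestrict D).closure ⟨x, h⟩ = y) ↔
      (x, y) ∈ clGraph T := by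
  have h1 : (A.domRestrict D).graph.topologicalClosure = clGraph T := by
    apply le_antisymm
    · refine Submodule.topologicalClosure_mono fun p hp => ?_
      obtain ⟨x, hx⟩ := (LinearPMap.mem_graph_iff' _).mp hp
      obtain ⟨ψ, hψ, -, hA⟩ := h.exists_of_domRestrict hD x
      exact ⟨ψ, by rw [← hx, hA, ← hψ]; rfl⟩
    · refine Submodule.topologicalClosure_minimal _ ?_ (Submodule.isClosed_topologicalClosure _)
      rintro _ ⟨ψ, rfl⟩
      have hs : HasSum (fun c => ((ψ : EllTwo C) c • delta c,
          (ψ : EllTwo C) c • (T (finDelta c) : EllTwo C))) ((ψ : EllTwo C), (T ψ : EllTwo C)) :=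
        (hasSum_delta (ψ : EllTwo C)).prodMk (hb.hasSum_finDelta ψ)
      refine mem_closure_of_tendsto hs (Filter.Eventually.of_forall fun F => ?_)
      refine Submodule.sum_mem _ fun c _ => ?_
      obtain ⟨h2, h3⟩ := h.domRestrict (ψ := finDelta c) (hδ c)
      exact Submodule.smul_mem _ ((ψ : EllTwo C) c)
        ((LinearPMap.mem_graph_iff' _).mpr ⟨⟨_, h2⟩, congrArg (Prod.mk _) h3⟩)
  rw [← h1, (h.isClosable hD hT).graph_closure_eq_closure_graph, LinearPMap.mem_graph_iff]
  constructor
  · rintro ⟨hx, rfl⟩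
    exact ⟨⟨x, hx⟩, rfl, rfl⟩
  · rintro ⟨⟨z, hz⟩, rfl, rfl⟩
    exact ⟨hz, rfl⟩

end Core

end EllTwo

/-! ### Uniqueness of the group -/

section Uniqueness

variable {E : Type*} [NormedAddCommGroup E] [InnerProductSpace ℂ E] [CompleteSpace E]

theorem IsUnitaryGroupOf.isUnitaryGroup {A : E →ₗ.[ℂ] E} {U : ℝ → E →L[ℂ] E}
    (h : IsUnitaryGroupOf A U) : IsUnitaryGroup U := ⟨h.unitary, h.zero, h.add, h.continuous⟩

/-- A unitary group leaves the domain of its generator invariant. Uniqueness identifies the group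
chosen in `expI` with the constructed limit. -/
theorem IsUnitaryGroupOf.unique {A : E →ₗ.[ℂ] E} {U V : ℝ → E →L[ℂ] E}
    (hU : IsUnitaryGroupOf A U) (hV : IsUnitaryGroupOf A V) (hA : Dense (A.domain : Set E)) :
    U = V := by
  refine hU.isUnitaryGroup.eq_of_generator hV.isUnitaryGroup hA
    (fun x hx => ⟨_, (hU.generator x _).mp ⟨hx, rfl⟩, (hV.generator x _).mp ⟨hx, rfl⟩⟩)
    fun t x hx => ?_
  have h := hU.isUnitaryGroup.hasDerivAt_apply ((hU.generator x _).mp ⟨hx, rfl⟩) t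
  rw [map_smul] at h
  exact ((hU.generator _ _).mpr h).1

theorem IsUnitaryGroupOf.expI_eq {A : E →ₗ.[ℂ] E} {U : ℝ → E →L[ℂ] E} (hU : IsUnitaryGroupOf A U)
    (hA : Dense (A.domain : Set E)) : expI A = U := by
  have h : ∃ U, IsUnitaryGroupOf A U := ⟨U, hU⟩
  rw [expI, dif_pos h]
  exact h.choose_spec.unique hU hA

end Uniqueness

/-! ### Identification of the closed operators on the Fock space -/

namespace ModeBasis

variable {H : Type*} [NormedAddCommGroup H] [InnerProductSpace ℂ H] [CompleteSpace H]
variable {S : NeutralSpace H} {I K : Type*} (e : ModeBasis S I K) [LinearOrder K]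

theorem extends_create (f : H) : Extends (e.create f) (e.cr f) := fun ψ => by
  obtain ⟨m, hm⟩ := ψ.2
  exact ⟨e.memℓp_createFun f hm, rfl⟩

/-- `x` ranges over the maximal domain of `a†(f)`, so it is cut to the level of `ψ` first. This
changes neither side, because the components of `a†(f) x` up to level `m` involve only the
components of `x` below level `m`. -/
theorem inner_an_create (f : H) (ψ : FinFock I K) (x : (e.create f).domain) :
    ⟪(e.an f ψ : Fock I K), (x : Fock I K)⟫_ℂ = ⟪(ψ : Fock I K), e.create f x⟫_ℂ := by
  obtain ⟨m, hm⟩ := ψ.2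
  have h1 : (e.an f ψ : Fock I K) ∈ lev num m := lev_mono (Nat.sub_le m 1) (e.an_mem_lev f hm)
  have h2 := e.inner_an_left f ψ (cutFin num 1 m (x : Fock I K))
  rw [Submodule.coe_inner, Submodule.coe_inner, coe_cutFin, ← inner_cut, cut_one_of_mem h1] at h2
  rw [h2, lp.inner_eq_tsum, lp.inner_eq_tsum]
  refine tsum_congr fun c => ?_
  by_cases hc : m < num c
  · rw [hm c hc, inner_zero_left, inner_zero_left]
  have h3 : e.createFun f ((x : Fock I K) - cut num 1 m (x : Fock I K) : Fock I K) c = 0 :=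
    e.createFun_eq_zero f fun d hd => by
      rw [lp.coeFn_sub, Pi.sub_apply, cut_apply, if_pos (by omega)]
      simp
  have h4 := congrFun (e.createFun_add f
    ((x : Fock I K) - cut num 1 m (x : Fock I K) : Fock I K) (cut num 1 m (x : Fock I K))) c
  rw [Pi.add_apply, h3, zero_add, ← lp.coeFn_add, sub_add_cancel] at h4
  rw [cr_apply, coe_cutFin, ← h4]
  rfl

theorem extends_annihilate (f : H) : Extends (e.annihilate f) (e.an f) := fun ψ => by
  have hd : Dense ((e.create f).domain : Set (Fock I K)) :=
    (dense_fin (num := num (I := I) (K := K))).mono fun x hx => (e.extends_create f ⟨x, hx⟩).1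
  have h : (ψ : Fock I K) ∈ (e.annihilate f).domain :=
    LinearPMap.mem_adjoint_domain_of_exists _ ⟨_, e.inner_an_create f ψ⟩
  exact ⟨h, LinearPMap.adjoint_apply_eq hd ⟨_, h⟩ (e.inner_an_create f ψ)⟩

omit [LinearOrder K] in
theorem vacuum_eq : vacuum I K = delta (0, ∅) := by
  unfold vacuum delta
  congr!

theorem finiteDomain_le : e.finiteDomain ≤ FinFock I K := by
  refine Submodule.span_le.mpr fun ψ hψ => ?_
  induction hψ with
  | vacuum =>
    rw [vacuum_eq]
    exact (vac I K).2
  | create f hf ψ hψ h ih =>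
    have h1 := (e.extends_create f).apply ⟨ψ, ih⟩ hψ
    simp only at h1
    rw [h1]
    exact (e.cr f ⟨ψ, ih⟩).2

theorem delta_mem_finiteDomain (c : Config I K) : delta c ∈ e.finiteDomain := by
  -- A monomial in basis vectors is only a multiple of a basis state, with factors `√n` and signs;
  -- being nonzero, the factor is divided out in the span.
  have key : ∀ n, ∀ c : Config I K, num c = n → ∃ a : ℂ, a ≠ 0 ∧ e.IsMonomial (a • delta c) := by
    intro n
    induction n with
    | zero =>
      intro c hc
      refine ⟨1, one_ne_zero, ?_⟩
      rw [one_smul, eq_vac_of_num hc, ← vacuum_eq]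
      exact IsMonomial.vacuum
    | succ n ih =>
      intro c hc
      obtain ⟨j, hj⟩ := exists_amp_ne_zero (c := c) (by omega)
      obtain ⟨a, ha, hm⟩ := ih (low c j) (by have := num_low hj; omega)
      obtain ⟨h1, h2⟩ := e.extends_create (e.vec j) (a • finDelta (low c j))
      refine ⟨a * amp c j, mul_ne_zero ha (Complex.ofReal_ne_zero.mpr hj), ?_⟩
      have h3 := IsMonomial.create (e.vec j) (e.P_vec j) _ h1 hm
      rw [h2, map_smul, Submodule.coe_smul, cr_vec_delta, uamp_low hj, up_low hj, smul_smul] at h3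
      exact h3
  obtain ⟨a, ha, hm⟩ := key _ c rfl
  rw [← inv_smul_smul₀ ha (delta c)]
  exact Submodule.smul_mem _ _ (Submodule.subset_span hm)

/-- The unrestricted operator of which `dΓ(X)` is the restriction. -/
theorem exists_extends_dG (X : e.Alg) :
    ∃ A, Extends A (e.dG X) ∧ e.dGamma (op S e.basis X) = A.domRestrict e.finiteDomain := by
  refine ⟨_, ?_, rfl⟩
  have h1 : e.dG X = e.dG₁ X + (1 / 2 : ℂ) • e.dG₂ X - (1 / 2 : ℂ) • e.dG₃ X :=
    LinearMap.ext (e.dG_apply X)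
  rw [h1]
  refine ((Extends.opSum (T := fun j => e.term₁ j X) (fun j => ?_) (e.hasSum_dG₁ X)).add
    ((Extends.opSum (T := fun j => e.term₂ j X) (fun j => ?_) (e.hasSum_dG₂ X)).smul _)).sub
    ((Extends.opSum (T := fun j => e.term₃ j X) (fun j => ?_) (e.hasSum_dG₃ X)).smul _)
  · exact (e.extends_create _).opMul (e.extends_annihilate _)
  · exact (e.extends_create _).opMul (e.extends_create _)
  · exact (e.extends_annihilate _).opMul (e.extends_annihilate _)

theorem exists_extends_fld (f : H) :
    ∃ A, Extends A (e.fld f) ∧ e.field f = A.domRestrict e.finiteDomain := by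
  refine ⟨_, ?_, rfl⟩
  have h : e.fld f = e.cr (S.P f) - e.an (S.γ (S.J (f - S.P f))) := by
    rw [fld, cr_P, ← e.an_P (S.γ (S.J f)), S.P_γ, S.P_J, ← map_sub]
  rw [h]
  exact (e.extends_create _).sub (e.extends_annihilate _)

variable {e}

theorem dGamma_apply (X : e.Alg) {ψ : FinFock I K} (hψ : (ψ : Fock I K) ∈ e.finiteDomain) :
    ∃ h : (ψ : Fock I K) ∈ (e.dGamma (op S e.basis X)).domain, e.dGamma (op S e.basis X) ⟨ψ, h⟩ =
      (e.dG X ψ : Fock I K) := by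
  obtain ⟨A, hA, h⟩ := e.exists_extends_dG X
  rw [h]
  exact hA.domRestrict hψ

theorem field_apply (f : H) {ψ : FinFock I K} (hψ : (ψ : Fock I K) ∈ e.finiteDomain) :
    ∃ h : (ψ : Fock I K) ∈ (e.field f).domain, e.field f ⟨ψ, h⟩ = (e.fld f ψ : Fock I K) := by
  obtain ⟨A, hA, h⟩ := e.exists_extends_fld f
  rw [h]
  exact hA.domRestrict hψ

theorem dGamma_closure_iff {X : e.Alg} (hX : S.SelfDual (op S e.basis X)) (x y : Fock I K) :
    (∃ h : x ∈ (e.dGamma (op S e.basis X)).closure.domain,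
      (e.dGamma (op S e.basis X)).closure ⟨x, h⟩ = y) ↔
      (x, y) ∈ clGraph (e.dG X) := by
  obtain ⟨A, hA, h⟩ := e.exists_extends_dG X
  rw [h]
  exact hA.mem_closure_iff e.finiteDomain_le e.delta_mem_finiteDomain (T' := e.dG (dag X))
    (fun φ ψ => (inner_dG hX φ ψ).symm) (e.levBdd_dG X) x y

theorem field_closure_iff (f : H) (x y : Fock I K) :
    (∃ h : x ∈ (e.field f).closure.domain, (e.field f).closure ⟨x, h⟩ = y) ↔
      (x, y) ∈ clGraph (e.fld f) := by
  obtain ⟨A, hA, h⟩ := e.exists_extends_fld f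
  rw [h]
  refine hA.mem_closure_iff e.finiteDomain_le e.delta_mem_finiteDomain
    -- The formal adjoint of the field, needed only for closability.
    (T' := e.an f - e.cr (S.γ (S.J f))) (fun φ ψ => ?_) (e.banded_fld f).levBdd x y
  have h1 := e.inner_an_left f φ ψ
  have h2 := e.inner_an_right (S.γ (S.J f)) φ ψ
  rw [Submodule.coe_inner, Submodule.coe_inner] at h1 h2
  rw [fld_apply, Submodule.coe_inner, Submodule.coe_inner, LinearMap.sub_apply, Submodule.coe_sub,
    Submodule.coe_sub, inner_sub_left, inner_sub_right, h1, h2]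

theorem isUnitaryGroupOf_dGamma {X : e.Alg} (hX : S.SelfDual (op S e.basis X))
    (hs : Symm (e.dG X)) :
    ∃ U, IsFlowLimit (e.dG X) U ∧ IsUnitaryGroupOf (e.dGamma (op S e.basis X)).closure U ∧
      expI (e.dGamma (op S e.basis X)).closure = U := by
  obtain ⟨U, hU⟩ := exists_isFlowLimit (e.banded_dG X) hs
  have h := hU.isUnitaryGroup (e.banded_dG X) hs
  have hG : IsUnitaryGroupOf (e.dGamma (op S e.basis X)).closure U :=
    ⟨h.unitary, h.zero, h.add, h.continuous, fun x y =>
      (dGamma_closure_iff hX x y).trans (hU.mem_clGraph_iff (e.banded_dG X) hs x y)⟩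
  refine ⟨U, hU, hG, hG.expI_eq ?_⟩
  refine (dense_fin (num := num (I := I) (K := K))).mono fun x hx => ?_
  exact ((dGamma_closure_iff hX x (e.dG X ⟨x, hx⟩)).mpr (mem_clGraph_of_tendsto
    (ψ := fun _ => ⟨x, hx⟩) tendsto_const_nhds tendsto_const_nhds)).1

end ModeBasis

/-! ### Proof of the proposition -/

theorem proposition2 {H : Type*} [NormedAddCommGroup H] [InnerProductSpace ℂ H] [CompleteSpace H]
    (S : NeutralSpace H) {I K : Type*} [LinearOrder K] (e : ModeBasis S I K)
    (X : H →L[ℂ] H) (hX : S.IsG2 X) (hXeven : S.IsEven X)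
    (hXstar : ContinuousLinearMap.adjoint X = S.q * X * S.q) :
    -- the unitary group `e^{it dΓ(X)}` exists
    IsUnitaryGroupOf (e.dGamma X).closure (expI (e.dGamma X).closure) ∧
    -- `e^{it dΓ(X)} B†(f) e^{-it dΓ(X)} = B†(e^{itX} f)`
    (∀ (t : ℝ) (f : H), ∀ ψ ∈ e.finiteDomain,
      ∃ (h₁ : expI (e.dGamma X).closure (-t) ψ ∈ (e.field f).closure.domain)
        (h₂ : ψ ∈ (e.field (NormedSpace.exp ((Complex.I * t) • X) f)).domain),
        expI (e.dGamma X).closure t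
            ((e.field f).closure ⟨expI (e.dGamma X).closure (-t) ψ, h₁⟩) =
          e.field (NormedSpace.exp ((Complex.I * t) • X) f) ⟨ψ, h₂⟩) ∧
    -- `e^{it dΓ(X)} dΓ(Y) e^{-it dΓ(X)} = dΓ(e^{itX} Y e^{-itX}) - ½ b(tX, Y)`
    (∀ Y : H →L[ℂ] H, S.IsG2 Y → ∀ t : ℝ, S.IsG2 (evolve X Y t) ∧
      ∀ ψ ∈ e.finiteDomain,
        ∃ (h₁ : expI (e.dGamma X).closure (-t) ψ ∈ (e.dGamma Y).closure.domain)
          (h₂ : ψ ∈ (e.dGamma (evolve X Y t)).domain),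
          expI (e.dGamma X).closure t
              ((e.dGamma Y).closure ⟨expI (e.dGamma X).closure (-t) ψ, h₁⟩) =
            e.dGamma (evolve X Y t) ⟨ψ, h₂⟩ - ((1 / 2 : ℂ) * e.bTerm ((t : ℂ) • X) Y) • ψ) ∧
    -- the projective relation
    (∀ Y : H →L[ℂ] H, S.IsG2 Y → S.IsEven Y →
      ContinuousLinearMap.adjoint Y = S.q * Y * S.q →
      IsUnitaryGroupOf (e.dGamma Y).closure (expI (e.dGamma Y).closure) ∧
      ∀ s : ℝ,
        IsUnitaryGroupOf (e.dGamma (evolve X Y s)).closure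
          (expI (e.dGamma (evolve X Y s)).closure) ∧
        ∀ t : ℝ,
          expI (e.dGamma X).closure s * expI (e.dGamma Y).closure t *
              expI (e.dGamma X).closure (-s) =
            Complex.exp (-(Complex.I / 2) * t * e.bTerm ((s : ℂ) • X) Y) •
              expI (e.dGamma (evolve X Y s)).closure t) := by
  let Xa : e.Alg := HSAlg.mk X (hX.mem e.basis)
  have hXs : Symm (e.dG Xa) := ModeBasis.symm_dG (X := Xa) hX.selfDual hXstar
  obtain ⟨U, hU, hUG, hUe⟩ := ModeBasis.isUnitaryGroupOf_dGamma (X := Xa) hX.selfDual hXs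
  change IsUnitaryGroupOf (e.dGamma X).closure U at hUG
  change expI (e.dGamma X).closure = U at hUe
  have gU := hUG.isUnitaryGroup
  rw [hUe]
  refine ⟨hUG, fun t f ψ hψ => ?_, fun Y hY t => ?_, fun Y hY hYeven hYstar => ?_⟩
  · let φ : FinFock I K := ⟨ψ, e.finiteDomain_le hψ⟩
    obtain ⟨h₁, h₁'⟩ := (ModeBasis.field_closure_iff f _ _).mpr
      (ModeBasis.fld_mem_clGraph (X := Xa) hX.selfDual hXeven hXs hU f t φ)
    obtain ⟨h₂, h₂'⟩ := ModeBasis.field_apply (e := e) (oneParam X t f) (ψ := φ) hψ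
    refine ⟨h₁, h₂, ?_⟩
    exact (congrArg (U t) h₁').trans ((gU.apply_neg_apply t _).trans h₂'.symm)
  · let Ya : e.Alg := HSAlg.mk Y (hY.mem e.basis)
    have hYt : S.SelfDual (HSAlg.op S e.basis (HSAlg.evol S Xa Ya t)) :=
      ModeBasis.selfDual_evol (X := Xa) (Y := Ya) hX.selfDual hXeven hY.selfDual t
    have h := isG2_of_mem _ hYt
    rw [HSAlg.op_evol] at h
    refine ⟨h, fun ψ hψ => ?_⟩
    let φ : FinFock I K := ⟨ψ, e.finiteDomain_le hψ⟩
    obtain ⟨h₁, h₁'⟩ := (ModeBasis.dGamma_closure_iff (X := Ya) hY.selfDual _ _).mpr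
      (ModeBasis.dG_mem_clGraph (X := Xa) hX.selfDual hXeven hXs hU (Y := Ya) hY.selfDual t φ)
    have h₂ := ModeBasis.dGamma_apply (e := e) (HSAlg.evol S Xa Ya t) (ψ := φ) hψ
    rw [HSAlg.op_evol] at h₂
    obtain ⟨h₂, h₂'⟩ := h₂
    refine ⟨h₁, h₂, ?_⟩
    refine (congrArg (U t) h₁').trans ((gU.apply_neg_apply t _).trans ?_)
    exact congrArg (· - _) h₂'.symm
  · let Ya : e.Alg := HSAlg.mk Y (hY.mem e.basis)
    have hYt : ∀ t, S.SelfDual (HSAlg.op S e.basis (HSAlg.evol S Xa Ya t)) :=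
      ModeBasis.selfDual_evol (X := Xa) (Y := Ya) hX.selfDual hXeven hY.selfDual
    -- The relation `Y* = q Y q` is preserved by the evolution, so every evolved operator has a
    -- symmetric second quantisation and generates a group.
    have hsY : ∀ t, Symm (e.dG (HSAlg.evol S Xa Ya t)) := fun t => by
      refine ModeBasis.symm_dG (hYt t) ?_
      rw [HSAlg.op_evol]
      exact star_evolve hXstar hYstar t
    obtain ⟨V, hV, hVG, hVe⟩ := ModeBasis.isUnitaryGroupOf_dGamma (X := Ya) hY.selfDual
      (ModeBasis.symm_dG (X := Ya) hY.selfDual hYstar)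
    change IsUnitaryGroupOf (e.dGamma Y).closure V at hVG
    change expI (e.dGamma Y).closure = V at hVe
    rw [hVe]
    refine ⟨hVG, fun s => ?_⟩
    obtain ⟨W, hW, hWG, hWe⟩ := ModeBasis.isUnitaryGroupOf_dGamma (hYt s) (hsY s)
    rw [HSAlg.op_evol] at hWG hWe
    change IsUnitaryGroupOf (e.dGamma (evolve X Y s)).closure W at hWG
    change expI (e.dGamma (evolve X Y s)).closure = W at hWe
    rw [hWe]
    exact ⟨hWG, ModeBasis.mul_mul_eq_smul (X := Xa) hX.selfDual hXeven hXs hU (Y := Ya) hY.selfDual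
      hsY hV hW⟩

end
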